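/- Let $\Bbbk$ be a field of characteristic zero and let $(\mathscr{C},\cdot,\Delta,Q)$ be a differential Batalin–Vilkovisky (dBV) algebra over $\Bbbk$: $(\mathscr{C},\cdot)$ is a unital $\mathbb{Z}$-graded super-commutative associative $\Bbbk$-algebra, $Q$ and $\Delta$ are $\Bbbk$-linear of degree $1$ with $Q^2=\Delta^2=\Delta Q+Q\Delta=0$, $Q$ is a derivation of the product, and the BV bracket defined by $$(-1)^{|a|}(a,b)=\Delta(a\cdot b)-\Delta a\cdot b-(-1)^{|a|}a\cdot\Delta b$$ satisfies $(a,b\cdot c)=(a,b)\cdot c+(-1)^{(|a|+1)|b|}\,b\cdot(a,c)$. Then $(\mathscr{C},Q,(\ ,\ ))$, with Lie degree $|a|+1$, is a differential graded Lie algebra (DGLA). Let $H=\bigoplus_i H^i$ be the cohomology of $(\mathscr{C},Q)$, and assume that each $H^i$ is finite-dimensional and that every $Q$-cohomology class has a representative in $\operatorname{Ker}\Delta$. Then: 1. The DGLA $(\mathscr{C},Q,(\ ,\ ))$ is formal: it is joined by a finite zigzag of quasi-isomorphisms of DGLAs to its cohomology $H$ with zero differential and the induced bracket. 2. Its extended deformation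 functor is pro-represented by $\Bbbk[[H^*]]$. Here the extended deformation functor sends a finite-dimensional $\mathbb{Z}$-graded, graded-commutative local $\Bbbk$-algebra $A$ with residue field $\Bbbk$ and maximal ideal $\mathfrak{m}_A$ to the set of $\mathcal{O}\in(\mathscr{C}\otimes\mathfrak{m}_A)^0$ with $Q\mathcal{O}+\frac12(\mathcal{O},\mathcal{O})=0$, modulo the gauge action of $\exp\big((\mathscr{C}\otimes\mathfrak{m}_A)^{-1}\big)$; and $\Bbbk[[H^*]]$ is the algebra of formal power series on the graded vector space $H$, that is, the completion $\varprojlim_n S(H^*)/I^n$ of the graded symmetric algebra of the graded dual $H^*=\bigoplus_i (H^i)^*$ (with $(H^i)^*$ in degree $-i$) at its augmentation ideal $I$. In other words, there are bijections, natural in $A$, between the continuous $\Bbbk$-algebra homomorphisms of degree $0$ from $\Bbbk[[H^*]]$ to $A$ and the value of the functor at $A$. 3. Hence the formal graded moduli space is smooth: the extended deformation functor sends surjections $A\to B$ of such algebras to surjections. -/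

import Mathlib

open scoped TensorProduct DirectSum
open CategoryTheory

universe u

noncomputable section

/-! ### Graded modules -/

section Graded

variable {k : Type*} [Field k] {M N : Type*} [AddCommGroup M] [Module k M]
  [AddCommGroup N] [Module k N]

/-- The linear endomorphism of a graded module that multiplies the elements of degree `i`
by `c i`. -/
def gradeScale {gr : ℤ → Submodule k M} (h : DirectSum.IsInternal gr) (c : ℤ → ℤ) :
    M →ₗ[k] M :=
  DirectSum.toModule k ℤ M (fun i => c i • (gr i).subtype) ∘ₗ
    (LinearEquiv.ofBijective (DirectSum.coeLinearMap gr) h).symm.toLinearMap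

theorem gradeScale_of_mem {gr : ℤ → Submodule k M} (h : DirectSum.IsInternal gr) (c : ℤ → ℤ)
    {i : ℤ} {x : M} (hx : x ∈ gr i) : gradeScale h c x = c i • x := by
  have : (LinearEquiv.ofBijective (DirectSum.coeLinearMap gr) h).symm x
      = DirectSum.lof k ℤ (fun i => gr i) i ⟨x, hx⟩ := by
    refine (LinearEquiv.symm_apply_eq _).2 ?_
    exact (DirectSum.coeLinearMap_lof gr i ⟨x, hx⟩).symm
  rw [gradeScale, LinearMap.comp_apply, LinearEquiv.coe_coe, this, DirectSum.toModule_lof]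
  rfl

/-- A property that is closed under addition and holds for homogeneous elements holds for all
elements. -/
theorem grade_induction {gr : ℤ → Submodule k M} (h : DirectSum.IsInternal gr)
    {p : M → Prop} (h0 : p 0) (hadd : ∀ x y, p x → p y → p (x + y))
    (hp : ∀ i, ∀ x ∈ gr i, p x) (x : M) : p x := by
  have hx : x ∈ iSup gr := by rw [h.submodule_iSup_eq_top]; trivial
  exact Submodule.iSup_induction gr (motive := p) hx hp h0 hadd

theorem grade_linearMap_ext {gr : ℤ → Submodule k M} (h : DirectSum.IsInternal gr)
    {f g : M →ₗ[k] N} (hfg : ∀ i, ∀ x ∈ gr i, f x = g x) : f = g := by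
  ext x
  refine grade_induction h (p := fun x => f x = g x) (by simp) ?_ hfg x
  intro x y hx hy
  simp [hx, hy]

theorem map_gradeScale {gr : ℤ → Submodule k M} (h : DirectSum.IsInternal gr)
    {gr' : ℤ → Submodule k N} (h' : DirectSum.IsInternal gr') (c : ℤ → ℤ)
    {f : M →ₗ[k] N} (hf : ∀ i, ∀ x ∈ gr i, f x ∈ gr' i) (x : M) :
    f (gradeScale h c x) = gradeScale h' c (f x) := by
  have : f ∘ₗ gradeScale h c = gradeScale h' c ∘ₗ f := by
    apply grade_linearMap_ext h
    intro i x hx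
    simp [gradeScale_of_mem h c hx, gradeScale_of_mem h' c (hf i x hx)]
  exact LinearMap.congr_fun this x

/-- A family of submodules that spans and admits separating projections is a grading. -/
theorem isInternal_of_proj {gr : ℤ → Submodule k M} (htop : iSup gr = ⊤)
    (P : ℤ → M →ₗ[k] M) (h1 : ∀ i, ∀ x ∈ gr i, P i x = x)
    (h2 : ∀ i j, j ≠ i → ∀ x ∈ gr j, P i x = 0) : DirectSum.IsInternal gr := by
  rw [DirectSum.isInternal_submodule_iff_iSupIndep_and_iSup_eq_top]
  refine ⟨fun i => ?_, htop⟩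
  rw [Submodule.disjoint_def]
  intro x hx hx'
  have : (⨆ (j) (_ : j ≠ i), gr j) ≤ LinearMap.ker (P i) :=
    iSup₂_le fun j hj x hx => h2 i j hj x hx
  rw [← h1 i x hx]
  exact this hx'

theorem isInternal_shift {gr : ℤ → Submodule k M} (h : DirectSum.IsInternal gr) (n : ℤ) :
    DirectSum.IsInternal (fun i => gr (i - n)) := by
  rw [DirectSum.isInternal_submodule_iff_iSupIndep_and_iSup_eq_top] at h ⊢
  exact ⟨h.1.comp (sub_left_injective (b := n)), by
    rw [← h.2]; exact (Equiv.subRight n).iSup_comp (g := gr)⟩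

/-! ### Cohomology -/

/-- The (total) cohomology `ker d / im d` of a differential `d`. -/
abbrev Cohomology (d : M →ₗ[k] M) : Type _ :=
  LinearMap.ker d ⧸ (LinearMap.range d).comap (LinearMap.ker d).subtype

/-- The cohomology class of a cocycle. -/
abbrev cohClass (d : M →ₗ[k] M) : LinearMap.ker d →ₗ[k] Cohomology d :=
  Submodule.mkQ _

/-- The degree `i` part of the cohomology: the classes of the cocycles of degree `i`. -/
def cohDeg (gr : ℤ → Submodule k M) (d : M →ₗ[k] M) (i : ℤ) : Submodule k (Cohomology d) :=
  ((gr i).comap (LinearMap.ker d).subtype).map (cohClass d)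

theorem isInternal_cohDeg {gr : ℤ → Submodule k M} (h : DirectSum.IsInternal gr)
    {d : M →ₗ[k] M} (hd : ∀ i, ∀ x ∈ gr i, d x ∈ gr (i + 1)) :
    DirectSum.IsInternal (cohDeg gr d) := by
  classical
  let p : ℤ → M →ₗ[k] M := fun i => gradeScale h (fun j => if j = i then 1 else 0)
  have p1 : ∀ i, ∀ x ∈ gr i, p i x = x := fun i x hx => by
    simp [p, gradeScale_of_mem h _ hx]
  have p2 : ∀ i j, j ≠ i → ∀ x ∈ gr j, p i x = 0 := fun i j hj x hx => by
    simp [p, gradeScale_of_mem h _ hx, hj]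
  have pm : ∀ i x, p i x ∈ gr i := by
    intro i x
    refine grade_induction h (p := fun x => p i x ∈ gr i) (by simp) ?_ ?_ x
    · intro x y hx hy
      rw [map_add]
      exact add_mem hx hy
    · intro j x hx
      by_cases hj : j = i
      · subst hj
        rw [p1 j x hx]; exact hx
      · rw [p2 i j hj x hx]; exact zero_mem _
  have pd : ∀ i x, d (p i x) = p (i + 1) (d x) := by
    intro i x
    refine grade_induction h (p := fun x => d (p i x) = p (i + 1) (d x)) (by simp) ?_ ?_ x
    · intro x y hx hy
      simp only [map_add, hx, hy]
    · intro j x hx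
      by_cases hj : j = i
      · subst hj
        rw [p1 j x hx, p1 _ _ (hd _ _ hx)]
      · rw [p2 i j hj x hx, p2 (i + 1) (j + 1) (by omega) _ (hd _ _ hx), map_zero]
  have pker : ∀ i, ∀ x ∈ LinearMap.ker d, p i x ∈ LinearMap.ker d := by
    intro i x hx
    rw [LinearMap.mem_ker] at hx ⊢
    rw [pd, hx, map_zero]
  have psum : ∀ x : M, ∃ s : Finset ℤ, x = ∑ i ∈ s, p i x := by
    intro x
    have hx : x ∈ iSup gr := by rw [h.submodule_iSup_eq_top]; trivial
    rw [Submodule.mem_iSup_iff_exists_finsupp] at hx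
    obtain ⟨f, hf, hfx⟩ := hx
    have key : ∀ i, p i x = f i := by
      intro i
      rw [← hfx, Finsupp.sum, map_sum]
      by_cases hi : i ∈ f.support
      · rw [Finset.sum_eq_single i]
        · exact p1 i _ (hf i)
        · intro j _ hj
          exact p2 i j hj _ (hf j)
        · intro hi'
          exact absurd hi hi'
      · rw [Finset.sum_eq_zero]
        · exact (Finsupp.notMem_support_iff.mp hi).symm
        · intro j hj
          exact p2 i j (fun e => hi (e ▸ hj)) _ (hf j)
    refine ⟨f.support, ?_⟩
    rw [Finset.sum_congr rfl fun i _ => key i]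
    exact hfx.symm
  refine isInternal_of_proj ?_
    (fun i => Submodule.mapQ _ _ ((p i).restrict (pker i)) ?_) ?_ ?_
  · rw [eq_top_iff]
    rintro y -
    obtain ⟨⟨x, hx⟩, rfl⟩ := Submodule.mkQ_surjective _ y
    obtain ⟨s, hs⟩ := psum x
    have : (⟨x, hx⟩ : LinearMap.ker d) = ∑ i ∈ s, ⟨p i x, pker i x hx⟩ := by
      ext
      simpa using hs
    rw [this, map_sum]
    refine Submodule.sum_mem _ fun i _ => ?_
    exact Submodule.mem_iSup_of_mem i (Submodule.mem_map_of_mem (pm i x))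
  · rintro ⟨x, hx⟩ hx'
    simp only [Submodule.mem_comap, Submodule.subtype_apply, LinearMap.mem_range] at hx' ⊢
    obtain ⟨y, rfl⟩ := hx'
    exact ⟨p (i - 1) y, by rw [pd]; simp⟩
  · rintro i _ ⟨⟨x, hx⟩, hxi, rfl⟩
    rw [Submodule.mkQ_apply, Submodule.mapQ_apply]
    congr 1
    ext
    exact p1 i x hxi
  · rintro i j hj _ ⟨⟨x, hx⟩, hxi, rfl⟩
    rw [Submodule.mkQ_apply, Submodule.mapQ_apply]
    have : (p i).restrict (pker i) ⟨x, hx⟩ = 0 := by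
      ext
      exact p2 i j hj x hxi
    rw [this, Submodule.Quotient.mk_zero]

end Graded

/-! ### Differential graded Lie algebras -/

/-- A differential `ℤ`-graded Lie algebra over `k`, with differential and bracket of degrees
`1` and `0`. -/
structure DGLA (k : Type u) [Field k] where
  carrier : Type u
  [addCommGroup : AddCommGroup carrier]
  [module : Module k carrier]
  gr : ℤ → Submodule k carrier
  isInternal : DirectSum.IsInternal gr
  d : carrier →ₗ[k] carrier
  bracket : carrier →ₗ[k] carrier →ₗ[k] carrier
  d_mem : ∀ i, ∀ x ∈ gr i, d x ∈ gr (i + 1)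
  bracket_mem : ∀ i j, ∀ x ∈ gr i, ∀ y ∈ gr j, bracket x y ∈ gr (i + j)
  d_d : ∀ x, d (d x) = 0
  d_bracket : ∀ i, ∀ x ∈ gr i, ∀ y,
    d (bracket x y) = bracket (d x) y + i.negOnePow • bracket x (d y)
  skew : ∀ i j, ∀ x ∈ gr i, ∀ y ∈ gr j,
    bracket x y = -((i * j).negOnePow • bracket y x)
  jacobi : ∀ i j, ∀ x ∈ gr i, ∀ y ∈ gr j, ∀ z,
    bracket x (bracket y z)
      = bracket (bracket x y) z + (i * j).negOnePow • bracket y (bracket x z)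

namespace DGLA

attribute [instance] DGLA.addCommGroup DGLA.module

variable {k : Type u} [Field k]

/-- Multiplication by `(-1) ^ i` in degree `i`. -/
def parity (L : DGLA k) : L.carrier →ₗ[k] L.carrier :=
  gradeScale L.isInternal (fun i => (i.negOnePow : ℤ))

theorem parity_of_mem (L : DGLA k) {i : ℤ} {x : L.carrier} (hx : x ∈ L.gr i) :
    L.parity x = i.negOnePow • x := gradeScale_of_mem _ _ hx

theorem d_bracket' (L : DGLA k) (x y : L.carrier) :
    L.d (L.bracket x y) = L.bracket (L.d x) y + L.bracket (L.parity x) (L.d y) := by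
  refine grade_induction L.isInternal (p := fun x =>
    L.d (L.bracket x y) = L.bracket (L.d x) y + L.bracket (L.parity x) (L.d y))
    (by simp) ?_ ?_ x
  · intro x x' hx hx'
    simp only [map_add, LinearMap.add_apply, hx, hx']
    abel
  · intro i x hx
    rw [L.d_bracket i x hx, L.parity_of_mem hx, Units.smul_def, Units.smul_def, map_zsmul,
      LinearMap.smul_apply]

theorem parity_ker (L : DGLA k) {x : L.carrier} (hx : L.d x = 0) : L.d (L.parity x) = 0 := by
  have h : L.d (L.parity x) = - L.parity (L.d x) := by
    refine grade_induction L.isInternal (p := fun x => L.d (L.parity x) = - L.parity (L.d x))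
      (by simp) ?_ ?_ x
    · intro x y hx hy
      simp only [map_add, hx, hy]
      abel
    · intro i x hx
      rw [L.parity_of_mem hx, L.parity_of_mem (L.d_mem i x hx), Int.negOnePow_succ,
        Units.smul_def, map_zsmul, Units.smul_def]
      simp
  rw [h, hx, map_zero, neg_zero]

theorem parity_parity (L : DGLA k) (x : L.carrier) : L.parity (L.parity x) = x := by
  refine grade_induction L.isInternal (p := fun x => L.parity (L.parity x) = x)
      (by simp) ?_ ?_ x
  · intro x y hx hy
    simp only [map_add, hx, hy]
  · intro i x hx
    rw [L.parity_of_mem hx, Units.smul_def, map_zsmul, L.parity_of_mem hx, Units.smul_def,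
      smul_smul, ← Units.val_mul, Int.units_mul_self]
    simp

/-- The bracket of cocycles, as a cohomology class. -/
def cocycleBracket (L : DGLA k) :
    LinearMap.ker L.d →ₗ[k] LinearMap.ker L.d →ₗ[k] Cohomology L.d :=
  LinearMap.mk₂ k
    (fun x y => cohClass L.d ⟨L.bracket x.1 y.1, by
      rw [LinearMap.mem_ker, L.d_bracket', LinearMap.mem_ker.mp x.2, LinearMap.mem_ker.mp y.2]
      simp⟩)
    (fun x x' y => by
      rw [← map_add]; congr 1; ext; simp)
    (fun c x y => by
      rw [← map_smul]; congr 1; ext; simp)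
    (fun x y y' => by
      rw [← map_add]; congr 1; ext; simp)
    (fun c x y => by
      rw [← map_smul]; congr 1; ext; simp)

/-- The bracket induced on cohomology. -/
def cohBracket (L : DGLA k) :
    Cohomology L.d →ₗ[k] Cohomology L.d →ₗ[k] Cohomology L.d :=
  Submodule.liftQ _
    (LinearMap.flip (Submodule.liftQ _ L.cocycleBracket.flip (by
      rintro ⟨y, hy⟩ ⟨z, hz⟩
      simp only [Submodule.subtype_apply] at hz
      subst hz
      rw [LinearMap.mem_ker]
      ext ⟨x, hx⟩
      simp only [LinearMap.flip_apply, cocycleBracket, LinearMap.mk₂_apply, LinearMap.zero_apply]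
      rw [Submodule.mkQ_apply, Submodule.Quotient.mk_eq_zero]
      refine ⟨L.bracket (L.parity x) z, ?_⟩
      rw [L.d_bracket', L.parity_ker (LinearMap.mem_ker.mp hx), L.parity_parity]
      simp)))
    (by
      rintro ⟨x, hx⟩ ⟨z, hz⟩
      simp only [Submodule.subtype_apply] at hz
      subst hz
      rw [LinearMap.mem_ker]
      apply LinearMap.ext
      intro y
      obtain ⟨⟨y, hy⟩, rfl⟩ := Submodule.mkQ_surjective _ y
      simp only [LinearMap.flip_apply, cocycleBracket, LinearMap.mk₂_apply, LinearMap.zero_apply,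
        Submodule.mkQ_apply, Submodule.liftQ_apply]
      rw [Submodule.Quotient.mk_eq_zero]
      refine ⟨L.bracket z y, ?_⟩
      rw [L.d_bracket', LinearMap.mem_ker.mp hy]
      simp)

theorem cohBracket_mk (L : DGLA k) (x y : LinearMap.ker L.d) (h : L.bracket x.1 y.1 ∈ LinearMap.ker L.d) :
    L.cohBracket (cohClass L.d x) (cohClass L.d y) = cohClass L.d ⟨L.bracket x.1 y.1, h⟩ := rfl

/-- The cohomology of a DGLA, a DGLA with zero differential and the induced bracket. -/
def cohomology (L : DGLA k) : DGLA k where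
  carrier := Cohomology L.d
  gr := cohDeg L.gr L.d
  isInternal := isInternal_cohDeg L.isInternal L.d_mem
  d := 0
  bracket := L.cohBracket
  d_mem := fun i x _ => zero_mem _
  bracket_mem := by
    rintro i j _ ⟨x, hx, rfl⟩ _ ⟨y, hy, rfl⟩
    exact Submodule.mem_map_of_mem (L.bracket_mem i j _ hx _ hy)
  d_d := fun x => rfl
  d_bracket := by
    intro i x _ y
    simp
  skew := by
    rintro i j _ ⟨x, hx, rfl⟩ _ ⟨y, hy, rfl⟩
    have hxy : L.bracket x.1 y.1 ∈ LinearMap.ker L.d := by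
      rw [LinearMap.mem_ker, L.d_bracket', LinearMap.mem_ker.mp x.2, LinearMap.mem_ker.mp y.2]
      simp
    have hyx : L.bracket y.1 x.1 ∈ LinearMap.ker L.d := by
      rw [LinearMap.mem_ker, L.d_bracket', LinearMap.mem_ker.mp x.2, LinearMap.mem_ker.mp y.2]
      simp
    rw [L.cohBracket_mk x y hxy, L.cohBracket_mk y x hyx, Units.smul_def, ← map_zsmul, ← map_neg]
    congr 1
    ext
    exact L.skew i j _ hx _ hy
  jacobi := by
    rintro i j _ ⟨x, hx, rfl⟩ _ ⟨y, hy, rfl⟩ z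
    obtain ⟨z, rfl⟩ := Submodule.mkQ_surjective _ z
    have hb : ∀ x y : LinearMap.ker L.d, L.bracket x.1 y.1 ∈ LinearMap.ker L.d := by
      intro x y
      rw [LinearMap.mem_ker, L.d_bracket', LinearMap.mem_ker.mp x.2, LinearMap.mem_ker.mp y.2]
      simp
    have e1 := L.cohBracket_mk x ⟨_, hb y z⟩ (hb _ _)
    have e2 := L.cohBracket_mk ⟨_, hb x y⟩ z (hb _ _)
    have e3 := L.cohBracket_mk y ⟨_, hb x z⟩ (hb _ _)
    rw [L.cohBracket_mk y z (hb _ _), L.cohBracket_mk x y (hb _ _),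
      L.cohBracket_mk x z (hb _ _), e1, e2, e3, Units.smul_def, ← map_zsmul, ← map_add]
    congr 1
    ext
    exact L.jacobi i j _ hx _ hy z.1

/-- A morphism of DGLAs. -/
structure Hom (L M : DGLA k) where
  toLinearMap : L.carrier →ₗ[k] M.carrier
  map_mem : ∀ i, ∀ x ∈ L.gr i, toLinearMap x ∈ M.gr i
  map_d : ∀ x, toLinearMap (L.d x) = M.d (toLinearMap x)
  map_bracket : ∀ x y,
    toLinearMap (L.bracket x y) = M.bracket (toLinearMap x) (toLinearMap y)

/-- The map induced on cohomology by a morphism of DGLAs. -/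
def Hom.cohomologyMap {L M : DGLA k} (f : Hom L M) : Cohomology L.d →ₗ[k] Cohomology M.d :=
  Submodule.mapQ _ _
    (f.toLinearMap.restrict (p := LinearMap.ker L.d) (q := LinearMap.ker M.d) (by
      intro x hx
      rw [LinearMap.mem_ker] at hx ⊢
      rw [← f.map_d, hx, map_zero]))
    (by
      rintro ⟨x, hx⟩ ⟨y, hy⟩
      exact ⟨f.toLinearMap y, by
        rw [← f.map_d, hy]; rfl⟩)

/-- A quasi-isomorphism: a morphism inducing an isomorphism on cohomology. -/
def Hom.IsQuasiIso {L M : DGLA k} (f : Hom L M) : Prop :=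
  Function.Bijective f.cohomologyMap

/-- Two DGLAs are quasi-isomorphic if a finite zigzag of quasi-isomorphisms joins them. -/
def QuasiIsomorphic : DGLA k → DGLA k → Prop :=
  Relation.EqvGen fun L M => ∃ f : Hom L M, f.IsQuasiIso

/-- A DGLA is formal if it is quasi-isomorphic to its cohomology. -/
def IsFormal (L : DGLA k) : Prop :=
  QuasiIsomorphic L L.cohomology

end DGLA

/-! ### Graded Artin algebras -/

/-- A `ℤ`-graded, graded-commutative Artin local `k`-algebra with residue field `k`: it is
finite-dimensional and has an augmentation `A → k` whose kernel (the maximal ideal) is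
nilpotent. -/
structure GrArt (k : Type u) [Field k] where
  carrier : Type u
  [ring : Ring carrier]
  [algebra : Algebra k carrier]
  gr : ℤ → Submodule k carrier
  [gradedAlgebra : GradedAlgebra gr]
  graded_comm : ∀ i j, ∀ a ∈ gr i, ∀ b ∈ gr j, a * b = (i * j).negOnePow • (b * a)
  finite : Module.Finite k carrier
  aug : carrier →ₐ[k] k
  nilpotent : ∃ n : ℕ, (RingHom.ker aug) ^ n = ⊥

namespace GrArt

attribute [instance] GrArt.ring GrArt.algebra GrArt.gradedAlgebra

variable {k : Type u} [Field k]

theorem isInternal (A : GrArt k) : DirectSum.IsInternal A.gr :=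
  DirectSum.Decomposition.isInternal A.gr

/-- A morphism of graded Artin algebras: a `k`-algebra map of degree `0`. (It is automatically
local, see `aug_comp` below.) -/
@[ext]
structure Hom (A B : GrArt k) where
  toAlgHom : A.carrier →ₐ[k] B.carrier
  map_mem : ∀ i, ∀ a ∈ A.gr i, toAlgHom a ∈ B.gr i

instance : Category (GrArt k) where
  Hom := Hom
  id A := ⟨AlgHom.id k A.carrier, fun _ _ h => h⟩
  comp f g := ⟨g.toAlgHom.comp f.toAlgHom, fun i a h => g.map_mem i _ (f.map_mem i a h)⟩

/-- The algebra map underlying a morphism of graded Artin algebras. -/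
def alg {A B : GrArt k} (f : A ⟶ B) : A.carrier →ₐ[k] B.carrier := Hom.toAlgHom f

theorem alg_mem {A B : GrArt k} (f : A ⟶ B) : ∀ i, ∀ a ∈ A.gr i, alg f a ∈ B.gr i :=
  Hom.map_mem f

theorem alg_id (A : GrArt k) : alg (𝟙 A) = AlgHom.id k A.carrier := rfl

theorem alg_comp {A B C : GrArt k} (f : A ⟶ B) (g : B ⟶ C) :
    alg (f ≫ g) = (alg g).comp (alg f) := rfl

theorem aug_comp {A B : GrArt k} (f : A ⟶ B) : B.aug.comp (alg f) = A.aug := by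
  have key : ∀ a, A.aug a = 0 → B.aug (alg f a) = 0 := by
    intro a ha
    obtain ⟨n, hn⟩ := A.nilpotent
    have : a ^ n = 0 := by
      have h : a ^ n ∈ (RingHom.ker A.aug) ^ n := Ideal.pow_mem_pow (by simpa using ha) n
      rw [hn] at h
      simpa using h
    apply eq_zero_of_pow_eq_zero (n := n)
    rw [← map_pow, ← map_pow, this, map_zero, map_zero]
  ext a
  have h := key (a - algebraMap k A.carrier (A.aug a)) (by simp)
  rw [map_sub, map_sub, sub_eq_zero] at h
  simpa using h

end GrArt

/-! ### The extended deformation functor of a DGLA -/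

namespace DGLA

variable {k : Type u} [Field k] (L : DGLA k)

/-- The differential `d ⊗ id` on `L ⊗ A`. -/
def tensorD (A : GrArt k) :
    L.carrier ⊗[k] A.carrier →ₗ[k] L.carrier ⊗[k] A.carrier :=
  L.d.rTensor A.carrier

/-- The bracket `[x ⊗ a, y ⊗ b] = (-1) ^ (|a| |y|) [x, y] ⊗ a b` on `L ⊗ A`. The two summands
take care of the even and of the odd part of `a`. -/
def tensorBracket (A : GrArt k) :
    L.carrier ⊗[k] A.carrier →ₗ[k] L.carrier ⊗[k] A.carrier →ₗ[k]
      L.carrier ⊗[k] A.carrier :=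
  TensorProduct.map₂ L.bracket
      (LinearMap.mul k A.carrier ∘ₗ gradeScale A.isInternal (fun i => if Even i then 1 else 0))
    + TensorProduct.map₂ (L.bracket.compl₂ L.parity)
      (LinearMap.mul k A.carrier ∘ₗ gradeScale A.isInternal (fun i => if Even i then 0 else 1))

theorem tensorBracket_tmul (A : GrArt k) {i j : ℤ} (x y : L.carrier) (a b : A.carrier)
    (ha : a ∈ A.gr i) (hy : y ∈ L.gr j) :
    L.tensorBracket A (x ⊗ₜ a) (y ⊗ₜ b)
      = (i * j).negOnePow • (L.bracket x y ⊗ₜ[k] (a * b)) := by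
  simp only [tensorBracket, LinearMap.add_apply, TensorProduct.map₂_apply_tmul,
    LinearMap.comp_apply, gradeScale_of_mem A.isInternal _ ha]
  rcases Int.even_or_odd i with hi | hi
  · simp [hi, Int.negOnePow_even _ (hi.mul_right j)]
  · have hi' : ¬ Even i := by simpa using hi
    rcases Int.even_or_odd j with hj | hj
    · simp [hi', L.parity_of_mem hy, Int.negOnePow_even _ hj, Int.negOnePow_even _ (hj.mul_left i)]
    · simp [hi', L.parity_of_mem hy, Int.negOnePow_odd _ hj, Int.negOnePow_odd _ (hi.mul hj),
        TensorProduct.neg_tmul]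

/-- The elements of `L ⊗ A` of total degree `n`. -/
def tensorDeg (A : GrArt k) (n : ℤ) : Submodule k (L.carrier ⊗[k] A.carrier) :=
  Submodule.span k {z | ∃ i j, i + j = n ∧ ∃ x ∈ L.gr i, ∃ a ∈ A.gr j, z = x ⊗ₜ a}

/-- The subspace `L ⊗ m` of `L ⊗ A`, where `m` is the maximal ideal of `A`: the kernel of
`L ⊗ A → L ⊗ k`. -/
def tensorMax (A : GrArt k) : Submodule k (L.carrier ⊗[k] A.carrier) :=
  LinearMap.ker (A.aug.toLinearMap.lTensor L.carrier)

/-- The Maurer-Cartan elements of `L ⊗ m`: the elements `γ` of total degree `1` with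
`dγ + ½ [γ, γ] = 0`. -/
def MC (A : GrArt k) : Type u :=
  {γ : L.carrier ⊗[k] A.carrier // γ ∈ L.tensorDeg A 1 ∧ γ ∈ L.tensorMax A ∧
    L.tensorD A γ + (2 : k)⁻¹ • L.tensorBracket A γ γ = 0}

/-- Gauge equivalence: `γ' = e ^ ξ · γ`, for some `ξ ∈ L ⊗ m` of total degree `0`, where
`e ^ ξ · γ = γ + ∑ n ≥ 0, (ad ξ) ^ n ([ξ, γ] - dξ) / (n + 1)!`. The sum is finite, because
`m` is nilpotent; it can be cut off at any `N` with `(ad ξ) ^ N ([ξ, γ] - dξ) = 0`. -/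
def gaugeRel (A : GrArt k) (γ γ' : L.MC A) : Prop :=
  ∃ ξ : L.carrier ⊗[k] A.carrier, ξ ∈ L.tensorDeg A 0 ∧ ξ ∈ L.tensorMax A ∧ ∃ N : ℕ,
    ((L.tensorBracket A ξ) ^ N) (L.tensorBracket A ξ γ.1 - L.tensorD A ξ) = 0 ∧
    γ'.1 = γ.1 + ∑ n ∈ Finset.range N, ((n + 1).factorial : k)⁻¹ •
      ((L.tensorBracket A ξ) ^ n) (L.tensorBracket A ξ γ.1 - L.tensorD A ξ)

/-- Maurer-Cartan elements modulo gauge equivalence. -/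
def DefSet (A : GrArt k) : Type u := Quot (L.gaugeRel A)

/-- The map `id ⊗ f` from `L ⊗ A` to `L ⊗ B`. -/
def tensorMap {A B : GrArt k} (f : A ⟶ B) :
    L.carrier ⊗[k] A.carrier →ₗ[k] L.carrier ⊗[k] B.carrier :=
  (GrArt.alg f).toLinearMap.lTensor L.carrier

variable {A B : GrArt k} (f : A ⟶ B)

theorem tensorMap_deg {n : ℤ} {z} (hz : z ∈ L.tensorDeg A n) :
    L.tensorMap f z ∈ L.tensorDeg B n := by
  refine Submodule.span_induction (p := fun z _ => L.tensorMap f z ∈ L.tensorDeg B n)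
    ?_ (by simp) ?_ ?_ hz
  · rintro _ ⟨i, j, hij, x, hx, a, ha, rfl⟩
    exact Submodule.subset_span
      ⟨i, j, hij, x, hx, GrArt.alg f a, GrArt.alg_mem f j a ha, by simp [tensorMap]⟩
  · intro x y _ _ hx hy
    rw [map_add]
    exact add_mem hx hy
  · intro c x _ hx
    rw [map_smul]
    exact Submodule.smul_mem _ c hx

theorem tensorMap_max {z} (hz : z ∈ L.tensorMax A) : L.tensorMap f z ∈ L.tensorMax B := by
  rw [tensorMax, LinearMap.mem_ker] at hz ⊢
  rw [← hz, ← GrArt.aug_comp f, tensorMap, ← LinearMap.comp_apply, ← LinearMap.lTensor_comp]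
  rfl

theorem tensorMap_d (z) : L.tensorMap f (L.tensorD A z) = L.tensorD B (L.tensorMap f z) := by
  simp only [tensorMap, tensorD]
  rw [← LinearMap.comp_apply, ← LinearMap.comp_apply, LinearMap.lTensor_comp_rTensor,
    LinearMap.rTensor_comp_lTensor]

theorem tensorMap_bracket (z w) : L.tensorMap f (L.tensorBracket A z w)
    = L.tensorBracket B (L.tensorMap f z) (L.tensorMap f w) := by
  have hsc : ∀ (c : ℤ → ℤ) (a : A.carrier), GrArt.alg f (gradeScale A.isInternal c a)
      = gradeScale B.isInternal c (GrArt.alg f a) := fun c a =>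
    map_gradeScale A.isInternal B.isInternal c (f := (GrArt.alg f).toLinearMap)
      (GrArt.alg_mem f) a
  induction z using TensorProduct.induction_on with
  | zero => simp
  | add z z' hz hz' => simp only [map_add, LinearMap.add_apply, hz, hz']
  | tmul x a =>
    induction w using TensorProduct.induction_on with
    | zero => simp
    | add w w' hw hw' => simp only [map_add, hw, hw']
    | tmul y b => simp [tensorBracket, tensorMap, hsc]

theorem tensorMap_ad_pow (ξ w) (n : ℕ) :
    L.tensorMap f (((L.tensorBracket A ξ) ^ n) w)
      = ((L.tensorBracket B (L.tensorMap f ξ)) ^ n) (L.tensorMap f w) := by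
  induction n with
  | zero => simp
  | succ n ih => rw [pow_succ', pow_succ', Module.End.mul_apply, Module.End.mul_apply,
      tensorMap_bracket, ih]

/-- The map on Maurer-Cartan elements induced by a morphism of graded Artin algebras. -/
def mcMap (γ : L.MC A) : L.MC B :=
  ⟨L.tensorMap f γ.1, L.tensorMap_deg f γ.2.1, L.tensorMap_max f γ.2.2.1, by
    rw [← tensorMap_d, ← tensorMap_bracket, ← map_smul, ← map_add, γ.2.2.2, map_zero]⟩

theorem mcMap_id (A : GrArt k) (γ : L.MC A) : L.mcMap (𝟙 A) γ = γ := by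
  apply Subtype.ext
  have h : L.tensorMap (𝟙 A) = LinearMap.id := by
    rw [tensorMap, GrArt.alg_id]
    exact LinearMap.lTensor_id _ _
  exact LinearMap.congr_fun h γ.1

theorem mcMap_comp {A B C : GrArt k} (f : A ⟶ B) (g : B ⟶ C) (γ : L.MC A) :
    L.mcMap (f ≫ g) γ = L.mcMap g (L.mcMap f γ) := by
  apply Subtype.ext
  have h : L.tensorMap (f ≫ g) = L.tensorMap g ∘ₗ L.tensorMap f :=
    LinearMap.lTensor_comp L.carrier (GrArt.alg g).toLinearMap (GrArt.alg f).toLinearMap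
  exact LinearMap.congr_fun h γ.1

theorem mcMap_gauge (γ γ' : L.MC A) (h : L.gaugeRel A γ γ') :
    L.gaugeRel B (L.mcMap f γ) (L.mcMap f γ') := by
  obtain ⟨ξ, h0, hm, N, hN, h⟩ := h
  refine ⟨L.tensorMap f ξ, L.tensorMap_deg f h0, L.tensorMap_max f hm, N, ?_, ?_⟩
  · simp only [mcMap]
    rw [← tensorMap_bracket, ← tensorMap_d, ← map_sub, ← tensorMap_ad_pow, hN, map_zero]
  · simp only [mcMap]
    rw [h, map_add, map_sum]
    congr 1
    refine Finset.sum_congr rfl fun n _ => ?_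
    rw [map_smul, tensorMap_ad_pow, map_sub, tensorMap_bracket, tensorMap_d]

/-- The extended deformation functor of a DGLA, on graded Artin algebras. -/
def extDef (L : DGLA k) : GrArt k ⥤ Type u where
  obj A := L.DefSet A
  map f := TypeCat.ofHom (Quot.map (L.mcMap f) (L.mcMap_gauge f))
  map_id A := by
    ext x
    obtain ⟨γ, rfl⟩ := Quot.exists_rep x
    exact congrArg (Quot.mk _) (L.mcMap_id A γ)
  map_comp f g := by
    ext x
    obtain ⟨γ, rfl⟩ := Quot.exists_rep x
    exact congrArg (Quot.mk _) (L.mcMap_comp f g γ)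

end DGLA

/-- A functor on graded Artin algebras is smooth if it maps surjections to surjections. -/
def IsSmoothFunctor {k : Type u} [Field k] (F : GrArt k ⥤ Type u) : Prop :=
  ∀ ⦃A B : GrArt k⦄ (f : A ⟶ B), Function.Surjective (GrArt.alg f) →
    Function.Surjective (F.map f)

/-! ### Formal power series on a graded vector space -/

section PowerSeries

variable {k : Type u} [Field k] {V : Type u} [AddCommMonoid V] [Module k V]

/-- The relations of graded commutativity, together with the vanishing of the words of
length `n`. -/
inductive TruncRel (gr : ℤ → Submodule k V) (n : ℕ) :
    TensorAlgebra k V → TensorAlgebra k V → Prop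
  | swap (i j : ℤ) (v w : V) (hv : v ∈ gr i) (hw : w ∈ gr j) :
      TruncRel gr n (TensorAlgebra.ι k v * TensorAlgebra.ι k w)
        ((i * j).negOnePow • (TensorAlgebra.ι k w * TensorAlgebra.ι k v))
  | kill (l : List V) (hl : l.length = n) :
      TruncRel gr n (l.map (TensorAlgebra.ι k)).prod 0

/-- The quotient `S(V) / I ^ n` of the graded symmetric algebra of `V` by the `n`-th power of
its augmentation ideal. -/
abbrev TruncSym (gr : ℤ → Submodule k V) (n : ℕ) : Type u := RingQuot (TruncRel gr n)

/-- The projection `S(V) / I ^ (n + 1) → S(V) / I ^ n`. -/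
def TruncSym.proj (gr : ℤ → Submodule k V) (n : ℕ) :
    TruncSym gr (n + 1) →ₐ[k] TruncSym gr n :=
  RingQuot.liftAlgHom k ⟨RingQuot.mkAlgHom k (TruncRel gr n), by
    intro x y h
    cases h with
    | swap i j v w hv hw => exact RingQuot.mkAlgHom_rel k (TruncRel.swap i j v w hv hw)
    | kill l hl =>
      cases l with
      | nil => simp at hl
      | cons v l =>
        rw [List.map_cons, List.prod_cons, map_mul,
          RingQuot.mkAlgHom_rel k (TruncRel.kill (gr := gr) l (by simpa using hl)), map_zero,
          mul_zero]⟩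

/-- The elements of degree `d` of `S(V) / I ^ n`: the span of the products of homogeneous
elements of `V` with degrees of sum `d`. -/
def TruncSym.deg (gr : ℤ → Submodule k V) (n : ℕ) (d : ℤ) : Submodule k (TruncSym gr n) :=
  Submodule.span k {z | ∃ l : List (ℤ × V), (∀ p ∈ l, p.2 ∈ gr p.1) ∧
    (l.map Prod.fst).sum = d ∧
    z = RingQuot.mkAlgHom k (TruncRel gr n)
      (l.map fun p => TensorAlgebra.ι k p.2).prod}

/-- The completed graded symmetric algebra `lim S(V) / I ^ n` of the graded vector space `V`,
that is, the algebra of formal power series whose linear coordinates are the elements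
of `V`. -/
def CompletedSym (gr : ℤ → Submodule k V) : Subalgebra k (∀ n, TruncSym gr n) where
  carrier := {s | ∀ n, TruncSym.proj gr n (s (n + 1)) = s n}
  mul_mem' := by
    intro a b ha hb n
    simp only [Set.mem_ofPred_eq, Pi.mul_apply, map_mul] at ha hb ⊢
    rw [ha, hb]
  add_mem' := by
    intro a b ha hb n
    simp only [Set.mem_ofPred_eq, Pi.add_apply, map_add] at ha hb ⊢
    rw [ha, hb]
  algebraMap_mem' := by
    intro r n
    simp

/-- The continuous `k`-algebra homomorphisms of degree `0` from `lim S(V) / I ^ n` to a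
(discrete) graded Artin algebra `A`. Continuity means that the kernel of some
projection to `S(V) / I ^ N` is mapped to `0`. -/
def ContHom (gr : ℤ → Submodule k V) (A : GrArt k) : Type u :=
  {φ : CompletedSym gr →ₐ[k] A.carrier //
    (∃ N : ℕ, ∀ s : CompletedSym gr, s.1 N = 0 → φ s = 0) ∧
    (∀ (d : ℤ) (s : CompletedSym gr), (∀ n, s.1 n ∈ TruncSym.deg gr n d) → φ s ∈ A.gr d)}

/-- The functor on graded Artin algebras pro-represented by `lim S(V) / I ^ n`. -/
def proRep (gr : ℤ → Submodule k V) : GrArt k ⥤ Type u where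
  obj A := ContHom gr A
  map {A B} f := TypeCat.ofHom fun φ : ContHom gr A =>
    (⟨(GrArt.alg f).comp φ.1,
      ⟨φ.2.1.choose, fun s hs => by
        rw [AlgHom.comp_apply, φ.2.1.choose_spec s hs, map_zero]⟩,
      fun d s hs => GrArt.alg_mem f d _ (φ.2.2 d s hs)⟩ : ContHom gr B)
  map_id A := by
    ext φ
    rfl
  map_comp f g := by
    ext φ
    rfl

end PowerSeries

section GradedDual

variable {k : Type u} [Field k] {H : Type u} [AddCommGroup H] [Module k H]

/-- The graded dual of a graded vector space, the direct sum of the duals of its graded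
pieces. -/
abbrev GradedDual (gr : ℤ → Submodule k H) : Type u :=
  ⨁ i, Module.Dual k (gr i)

/-- The grading of the graded dual: the dual of the degree `i` piece has degree `-i`. -/
def GradedDual.deg (gr : ℤ → Submodule k H) (i : ℤ) : Submodule k (GradedDual gr) :=
  LinearMap.range (DirectSum.lof k ℤ (fun i => Module.Dual k (gr i)) (-i))

end GradedDual

/-! ### Differential Batalin-Vilkovisky algebras -/

section DBV

variable {k : Type u} [Field k] {C : Type u} [Ring C] [Algebra k C]

/-- Multiplication by `(-1) ^ i` in degree `i`. -/
def ghostParity (𝒞 : ℤ → Submodule k C) [GradedAlgebra 𝒞] : C →ₗ[k] C :=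
  gradeScale (DirectSum.Decomposition.isInternal 𝒞) (fun i => (i.negOnePow : ℤ))

theorem ghostParity_of_mem (𝒞 : ℤ → Submodule k C) [GradedAlgebra 𝒞] {i : ℤ} {a : C}
    (ha : a ∈ 𝒞 i) : ghostParity 𝒞 a = i.negOnePow • a := gradeScale_of_mem _ _ ha

/-- The bracket `(a, b)` with `(-1) ^ |a| (a, b) = Δ (a b) - (Δ a) b - (-1) ^ |a| a (Δ b)`
(see `bvBracket_eq` below) that an operator `Δ` defines. -/
def bvBracket (𝒞 : ℤ → Submodule k C) [GradedAlgebra 𝒞] (Δ : C →ₗ[k] C) :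
    C →ₗ[k] C →ₗ[k] C :=
  (LinearMap.mul k C).compr₂ Δ ∘ₗ ghostParity 𝒞
    - LinearMap.mul k C ∘ₗ Δ ∘ₗ ghostParity 𝒞
    - (LinearMap.mul k C).compl₂ Δ

theorem bvBracket_apply (𝒞 : ℤ → Submodule k C) [GradedAlgebra 𝒞] (Δ : C →ₗ[k] C) (a b : C) :
    bvBracket 𝒞 Δ a b
      = Δ (ghostParity 𝒞 a * b) - Δ (ghostParity 𝒞 a) * b - a * Δ b := by
  simp [bvBracket]

theorem bvBracket_eq (𝒞 : ℤ → Submodule k C) [GradedAlgebra 𝒞] (Δ : C →ₗ[k] C) {i : ℤ}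
    {a : C} (ha : a ∈ 𝒞 i) (b : C) :
    i.negOnePow • bvBracket 𝒞 Δ a b
      = Δ (a * b) - Δ a * b - i.negOnePow • (a * Δ b) := by
  rw [bvBracket_apply, ghostParity_of_mem 𝒞 ha]
  rcases Int.even_or_odd i with hi | hi
  · simp [Int.negOnePow_even _ hi]
  · simp [Int.negOnePow_odd _ hi]
    abel

/-- The structure of a differential Batalin-Vilkovisky algebra on the graded algebra `C`. -/
structure DBVAlgebra (𝒞 : ℤ → Submodule k C) [GradedAlgebra 𝒞] where
  graded_comm : ∀ i j, ∀ a ∈ 𝒞 i, ∀ b ∈ 𝒞 j, a * b = (i * j).negOnePow • (b * a)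
  Q : C →ₗ[k] C
  Q_mem : ∀ i, ∀ a ∈ 𝒞 i, Q a ∈ 𝒞 (i + 1)
  Q_Q : ∀ a, Q (Q a) = 0
  Q_mul : ∀ i, ∀ a ∈ 𝒞 i, ∀ b, Q (a * b) = Q a * b + i.negOnePow • (a * Q b)
  Δ : C →ₗ[k] C
  Δ_mem : ∀ i, ∀ a ∈ 𝒞 i, Δ a ∈ 𝒞 (i + 1)
  Δ_Δ : ∀ a, Δ (Δ a) = 0
  poisson : ∀ i j, ∀ a ∈ 𝒞 i, ∀ b ∈ 𝒞 j, ∀ c,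
    bvBracket 𝒞 Δ a (b * c)
      = bvBracket 𝒞 Δ a b * c + ((i + 1) * j).negOnePow • (b * bvBracket 𝒞 Δ a c)
  Δ_Q : ∀ a, Δ (Q a) + Q (Δ a) = 0

namespace DBVAlgebra

variable {𝒞 : ℤ → Submodule k C} [GradedAlgebra 𝒞] (B : DBVAlgebra 𝒞)

/-- The BV bracket `(a, b)`. -/
abbrev bracket : C →ₗ[k] C →ₗ[k] C := bvBracket 𝒞 B.Δ

theorem bracket_mem {i j : ℤ} {a b : C} (ha : a ∈ 𝒞 i) (hb : b ∈ 𝒞 j) :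
    B.bracket a b ∈ 𝒞 (i + j + 1) := by
  have h : i.negOnePow • B.bracket a b ∈ 𝒞 (i + j + 1) := by
    rw [bvBracket_eq 𝒞 B.Δ ha]
    refine sub_mem (sub_mem ?_ ?_) ?_
    · exact B.Δ_mem _ _ (SetLike.mul_mem_graded ha hb)
    · have := SetLike.mul_mem_graded (B.Δ_mem _ _ ha) hb
      rwa [show i + 1 + j = i + j + 1 by ring] at this
    · have := SetLike.mul_mem_graded ha (B.Δ_mem _ _ hb)
      rw [← add_assoc] at this
      rw [Units.smul_def]
      exact zsmul_mem this _
  rcases Int.even_or_odd i with hi | hi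
  · simpa [Int.negOnePow_even _ hi] using h
  · simpa [Int.negOnePow_odd _ hi] using h

theorem bracket_even {i : ℤ} (hi : Even i) {a : C} (ha : a ∈ 𝒞 i) (b : C) :
    B.bracket a b = B.Δ (a * b) - B.Δ a * b - a * B.Δ b := by
  have := bvBracket_eq 𝒞 B.Δ ha b
  simpa [Int.negOnePow_even _ hi] using this

theorem bracket_odd {i : ℤ} (hi : Odd i) {a : C} (ha : a ∈ 𝒞 i) (b : C) :
    B.bracket a b = -B.Δ (a * b) + B.Δ a * b - a * B.Δ b := by
  have := bvBracket_eq 𝒞 B.Δ ha b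
  simp only [Int.negOnePow_odd _ hi, Units.neg_smul, one_smul] at this
  rw [← neg_inj, this]
  abel

theorem Q_mul_even {i : ℤ} (hi : Even i) {a : C} (ha : a ∈ 𝒞 i) (b : C) :
    B.Q (a * b) = B.Q a * b + a * B.Q b := by
  simpa [Int.negOnePow_even _ hi] using B.Q_mul i a ha b

theorem Q_mul_odd {i : ℤ} (hi : Odd i) {a : C} (ha : a ∈ 𝒞 i) (b : C) :
    B.Q (a * b) = B.Q a * b - a * B.Q b := by
  simpa [Int.negOnePow_odd _ hi, sub_eq_add_neg] using B.Q_mul i a ha b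

theorem Q_Δ (a : C) : B.Q (B.Δ a) = -B.Δ (B.Q a) :=
  eq_neg_of_add_eq_zero_right (B.Δ_Q a)

theorem Q_bracket {i : ℤ} {a : C} (ha : a ∈ 𝒞 i) (b : C) :
    B.Q (B.bracket a b)
      = B.bracket (B.Q a) b + (i + 1).negOnePow • B.bracket a (B.Q b) := by
  rcases Int.even_or_odd i with hi | hi
  · rw [B.bracket_even hi ha, B.bracket_even hi ha, B.bracket_odd hi.add_one (B.Q_mem _ _ ha),
      Int.negOnePow_odd _ hi.add_one]
    simp only [map_sub, B.Q_mul_even hi ha, B.Q_mul_odd hi.add_one (B.Δ_mem _ _ ha), B.Q_Δ,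
      map_add, Units.neg_smul, one_smul, neg_mul, mul_neg]
    abel
  · rw [B.bracket_odd hi ha, B.bracket_odd hi ha, B.bracket_even hi.add_one (B.Q_mem _ _ ha),
      Int.negOnePow_even _ hi.add_one]
    simp only [map_sub, map_neg, B.Q_mul_odd hi ha, B.Q_mul_even hi.add_one (B.Δ_mem _ _ ha),
      B.Q_Δ, map_add, one_smul, neg_mul, mul_neg]
    abel

theorem Δ_bracket {i : ℤ} {a : C} (ha : a ∈ 𝒞 i) (b : C) :
    B.Δ (B.bracket a b)
      = B.bracket (B.Δ a) b + (i + 1).negOnePow • B.bracket a (B.Δ b) := by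
  rcases Int.even_or_odd i with hi | hi
  · rw [B.bracket_even hi ha, B.bracket_even hi ha, B.bracket_odd hi.add_one (B.Δ_mem _ _ ha),
      Int.negOnePow_odd _ hi.add_one]
    simp only [map_sub, B.Δ_Δ, Units.neg_smul, one_smul, zero_mul, mul_zero]
    abel
  · rw [B.bracket_odd hi ha, B.bracket_odd hi ha, B.bracket_even hi.add_one (B.Δ_mem _ _ ha),
      Int.negOnePow_even _ hi.add_one]
    simp only [map_sub, map_neg, B.Δ_Δ, map_add, one_smul, zero_mul, mul_zero]
    abel

theorem bracket_skew {i j : ℤ} {a b : C} (ha : a ∈ 𝒞 i) (hb : b ∈ 𝒞 j) :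
    B.bracket a b = -(((i + 1) * (j + 1)).negOnePow • B.bracket b a) := by
  have h1 := B.graded_comm _ _ _ ha _ hb
  have h2 := B.graded_comm _ _ _ (B.Δ_mem _ _ ha) _ hb
  have h3 := B.graded_comm _ _ _ ha _ (B.Δ_mem _ _ hb)
  rcases Int.even_or_odd i with hi | hi <;> rcases Int.even_or_odd j with hj | hj
  · rw [Int.negOnePow_even _ (hi.mul_right _), one_smul] at h1 h3
    rw [Int.negOnePow_even _ (hj.mul_left _), one_smul] at h2
    rw [B.bracket_even hi ha, B.bracket_even hj hb, h1, h2, h3,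
      Int.negOnePow_odd _ (hi.add_one.mul hj.add_one)]
    simp only [Units.neg_smul, one_smul, neg_neg]
    abel
  · rw [Int.negOnePow_even _ (hi.mul_right _), one_smul] at h1 h3
    rw [Int.negOnePow_odd _ (hi.add_one.mul hj), Units.neg_smul, one_smul] at h2
    rw [B.bracket_even hi ha, B.bracket_odd hj hb, h1, h2, h3,
      Int.negOnePow_even _ (hj.add_one.mul_left _)]
    simp only [one_smul]
    abel
  · rw [Int.negOnePow_even _ (hj.mul_left _), one_smul] at h1 h2
    rw [Int.negOnePow_odd _ (hi.mul hj.add_one), Units.neg_smul, one_smul] at h3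
    rw [B.bracket_odd hi ha, B.bracket_even hj hb, h1, h2, h3,
      Int.negOnePow_even _ (hi.add_one.mul_right _)]
    simp only [one_smul]
    abel
  · rw [Int.negOnePow_odd _ (hi.mul hj), Units.neg_smul, one_smul] at h1
    rw [Int.negOnePow_even _ (hi.add_one.mul_right _), one_smul] at h2
    rw [Int.negOnePow_even _ (hj.add_one.mul_left _), one_smul] at h3
    rw [B.bracket_odd hi ha, B.bracket_odd hj hb, h1, h2, h3,
      Int.negOnePow_even _ (hi.add_one.mul_right _)]
    simp only [one_smul, map_neg]
    abel

theorem bracket_jacobi {i j : ℤ} {a b : C} (ha : a ∈ 𝒞 i) (hb : b ∈ 𝒞 j) (c : C) :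
    B.bracket a (B.bracket b c)
      = B.bracket (B.bracket a b) c
        + ((i + 1) * (j + 1)).negOnePow • B.bracket b (B.bracket a c) := by
  have hab := B.bracket_mem ha hb
  have hΔa := B.Δ_mem _ _ ha
  have hΔb := B.Δ_mem _ _ hb
  have d1 := B.Δ_bracket ha (b * c)
  have d2 := B.Δ_bracket ha b
  have d3 := B.Δ_bracket ha c
  have p1 := B.poisson _ _ _ ha _ hb c
  have p2 := B.poisson _ _ _ hΔa _ hb c
  have p3 := B.poisson _ _ _ ha _ hΔb c
  have p4 := B.poisson _ _ _ ha _ hb (B.Δ c)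
  rcases Int.even_or_odd i with hi | hi <;> rcases Int.even_or_odd j with hj | hj
  · have e1 := Int.negOnePow_odd _ hi.add_one
    have e2 := Int.negOnePow_even _ (hj.mul_left (i + 1))
    have e3 := Int.negOnePow_even _ (hj.mul_left (i + 1 + 1))
    have e4 := Int.negOnePow_odd _ (hi.add_one.mul hj.add_one)
    have q1 := B.bracket_even hj hb
    have q2 := B.bracket_odd (hi.add hj).add_one hab c
    simp only [e1, e2, e3, e4, one_smul, Units.neg_smul] at *
    have d1' : B.bracket a (B.Δ (b * c)) = B.bracket (B.Δ a) (b * c) - B.Δ (B.bracket a (b * c)) := by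
      rw [d1]; abel
    rw [q1 c, q1 (B.bracket a c), q2, map_sub, map_sub, d1', p1, p2, p3, p4, map_add, d2, d3]
    simp only [mul_add, add_mul, mul_neg, neg_mul]
    abel
  · have e1 := Int.negOnePow_odd _ hi.add_one
    have e2 := Int.negOnePow_odd _ (hi.add_one.mul hj)
    have e3 := Int.negOnePow_even _ (hi.add_one.add_one.mul_right j)
    have e4 := Int.negOnePow_even _ (hj.add_one.mul_left (i + 1))
    have q1 := B.bracket_odd hj hb
    have q2 := B.bracket_even (hi.add_odd hj).add_one hab c
    simp only [e1, e2, e3, e4, one_smul, Units.neg_smul] at *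
    have d1' : B.bracket a (B.Δ (b * c)) = B.bracket (B.Δ a) (b * c) - B.Δ (B.bracket a (b * c)) := by
      rw [d1]; abel
    rw [q1 c, q1 (B.bracket a c), q2, map_sub, map_add, map_neg, d1', p1, p2, p3, p4, map_add,
      map_neg, d2, d3]
    simp only [mul_add, add_mul, mul_neg, neg_mul]
    abel
  · have e1 := Int.negOnePow_even _ hi.add_one
    have e2 := Int.negOnePow_even _ (hj.mul_left (i + 1))
    have e3 := Int.negOnePow_even _ (hj.mul_left (i + 1 + 1))
    have e4 := Int.negOnePow_even _ (hi.add_one.mul_right (j + 1))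
    have q1 := B.bracket_even hj hb
    have q2 := B.bracket_even (hi.add_even hj).add_one hab c
    simp only [e1, e2, e3, e4, one_smul] at *
    have d1' : B.bracket a (B.Δ (b * c)) = B.Δ (B.bracket a (b * c)) - B.bracket (B.Δ a) (b * c) := by
      rw [d1]; abel
    rw [q1 c, q1 (B.bracket a c), q2, map_sub, map_sub, d1', p1, p2, p3, p4, map_add, d2, d3]
    simp only [mul_add, add_mul]
    abel
  · have e1 := Int.negOnePow_even _ hi.add_one
    have e2 := Int.negOnePow_even _ (hi.add_one.mul_right j)
    have e3 := Int.negOnePow_odd _ (hi.add_one.add_one.mul hj)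
    have e4 := Int.negOnePow_even _ (hi.add_one.mul_right (j + 1))
    have q1 := B.bracket_odd hj hb
    have q2 := B.bracket_odd (hi.add_odd hj).add_one hab c
    simp only [e1, e2, e3, e4, one_smul, Units.neg_smul] at *
    have d1' : B.bracket a (B.Δ (b * c)) = B.Δ (B.bracket a (b * c)) - B.bracket (B.Δ a) (b * c) := by
      rw [d1]; abel
    rw [q1 c, q1 (B.bracket a c), q2, map_sub, map_add, map_neg, d1', p1, p2, p3, p4, map_add,
      d2, d3]
    simp only [mul_add, add_mul]
    abel

/-- The DGLA `(C, Q, (·, ·))`. The bracket has degree `1` with respect to the ghost number, so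
the DGLA degree is the ghost number plus `1`. -/
def toDGLA : DGLA k where
  carrier := C
  gr i := 𝒞 (i - 1)
  isInternal := isInternal_shift (DirectSum.Decomposition.isInternal 𝒞) 1
  d := B.Q
  bracket := B.bracket
  d_mem i x hx := by
    have := B.Q_mem _ _ hx
    rwa [show i - 1 + 1 = i + 1 - 1 by ring] at this
  bracket_mem i j x hx y hy := by
    have := B.bracket_mem hx hy
    rwa [show i - 1 + (j - 1) + 1 = i + j - 1 by ring] at this
  d_d := B.Q_Q
  d_bracket i x hx y := by
    have := B.Q_bracket hx y
    rwa [sub_add_cancel] at this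
  skew i j x hx y hy := by
    have := B.bracket_skew hx hy
    rwa [sub_add_cancel, sub_add_cancel] at this
  jacobi i j x hx y hy z := by
    have := B.bracket_jacobi hx hy z
    rwa [sub_add_cancel, sub_add_cancel] at this

/-- The degree `i` part of the cohomology of the complex `(C, Q)`, graded by the ghost
number. -/
abbrev cohDegree (i : ℤ) : Submodule k (Cohomology B.Q) := cohDeg 𝒞 B.Q i

/-- The functor pro-represented by the algebra of formal power series on the graded vector
space `H` (the cohomology of `(C, Q)`), that is, by the completed graded symmetric algebra of
the graded dual of `H`. -/
def powerSeriesFunctor : GrArt k ⥤ Type u :=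
  proRep (GradedDual.deg B.cohDegree)

end DBVAlgebra

end DBV

end

/-!
The proof connects the DGLA `L` of the algebra `C` and its cohomology `H` by acyclic fibrations
(surjective quasi-isomorphisms) `L ← P → H`. They give formality, and since acyclic fibrations
induce isomorphisms of extended deformation functors (`isIso_extDefMap`, by lifting
Maurer-Cartan elements and gauge equivalences along the powers of the maximal ideal), the
deformation functor of `L` is that of `H`. The bracket of `H` vanishes: for representatives in the
kernel of `Δ`, `(a, b) = ± Δ (a b)`, and `a b = h + Q v` with `Δ h = 0`, so that
`Δ (a b) = - Q Δ v` is exact (`cohomology_bracket_eq_zero`). Hence the gauge action on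
`H ⊗ m` is trivial and every element of degree `1` is a Maurer-Cartan element, that is, a
homomorphism from the algebra of formal power series on `H` (`extDef_iso_linFunctor_of_abelian`,
`proRepIsoLin`). These clearly lift along surjections.

The DGLA `P` comes from a universal solution `Γ` of the Maurer-Cartan equation
(`exists_universal_solution`), a power series on `H` with coefficients in `C` whose linear
part consists of representatives in the kernel of `Δ`. To find it, one solves the quantum master
equation `(Q + ħ Δ) Γ + ½ (Γ, Γ) = 0` order by order and puts `ħ = 0`. This equation says
that `exp (Γ / ħ)` is annihilated by `Q + ħ Δ`. So the lowest order term `E` of the error is, up to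
a power of `ħ`, exact for `Q + ħ Δ` (`exists_primitive`), and the condition that all classes of `Q`
are represented in the kernel of `Δ` allows the division by `ħ` (`hasExactDivision_param`).
For this purpose, power series need not be graded commutative. They are modelled by arbitrary
functions on words (`Words`), which are the values of the iterated derivatives at the origin. The
derivations `∂_i` by the letters do not commute, but are still compatible with the operations,
and this is all that is used. The formal parameter `ħ` is one more letter, of degree `0`.

Finally, let `G` be the DGLA of power series with the differential twisted by `Γ`. The constant term
is a morphism `G → L`, since `Γ` has no constant term. The derivatives `c h = ∂_h Γ` are cocycles
of `G`, their constant terms represent the class `h`, and `∂_h` commutes with the differential of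
`G` up to the bracket with `c h` (`d_der_twist`). On the polynomial paths `A` in `G` starting at `0`,
with parameter `X`, there is moreover the derivation `X d/dX`, which is invertible. Then `P` consists
of `a + b ε + h` with `a` and `b` in `A`, `ε` of degree `1`, and `h` in `H`, where
`d a = d_A a ± X a' ε`, `d h = X c h ε`, and `h` acts by `X ∂_h` (`PathData.path`). The kernel of the
projection to `H` is acyclic because `X d/dX` is invertible. The evaluation of `a` at the end
point of the path, followed by the constant term, is the acyclic fibration to `L`, because `h`
extends to the cocycle `h ∓ X c h` of `P`.
-/

noncomputable section

/-! ### Graded linear algebra -/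

section GradedLinear

variable {k : Type*} [Field k] {M N : Type*} [AddCommGroup M] [Module k M]
  [AddCommGroup N] [Module k N]

/-- The projection of a graded module to its degree `i` component. -/
def gradeProj {gr : ℤ → Submodule k M} (h : DirectSum.IsInternal gr) (i : ℤ) : M →ₗ[k] M :=
  gradeScale h (fun j => if j = i then 1 else 0)

theorem gradeProj_of_mem {gr : ℤ → Submodule k M} (h : DirectSum.IsInternal gr) {i : ℤ} {x : M}
    (hx : x ∈ gr i) : gradeProj h i x = x := by
  simp [gradeProj, gradeScale_of_mem h _ hx]

theorem gradeProj_of_ne {gr : ℤ → Submodule k M} (h : DirectSum.IsInternal gr) {i j : ℤ} {x : M}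
    (hx : x ∈ gr j) (hij : j ≠ i) : gradeProj h i x = 0 := by
  simp [gradeProj, gradeScale_of_mem h _ hx, hij]

theorem gradeProj_mem {gr : ℤ → Submodule k M} (h : DirectSum.IsInternal gr) (i : ℤ) (x : M) :
    gradeProj h i x ∈ gr i := by
  refine grade_induction h (p := fun x => gradeProj h i x ∈ gr i) (by simp) ?_ ?_ x
  · intro x y hx hy
    rw [map_add]
    exact add_mem hx hy
  · intro j x hx
    by_cases hj : j = i
    · subst hj
      rwa [gradeProj_of_mem h hx]
    · rw [gradeProj_of_ne h hx hj]
      exact zero_mem _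

theorem map_gradeProj {gr : ℤ → Submodule k M} (h : DirectSum.IsInternal gr)
    {gr' : ℤ → Submodule k N} (h' : DirectSum.IsInternal gr') {r : ℤ}
    {f : M →ₗ[k] N} (hf : ∀ i, ∀ x ∈ gr i, f x ∈ gr' (i + r)) (i : ℤ) (x : M) :
    f (gradeProj h i x) = gradeProj h' (i + r) (f x) := by
  refine grade_induction h (p := fun x => f (gradeProj h i x) = gradeProj h' (i + r) (f x))
    (by simp) ?_ ?_ x
  · intro x y hx hy
    simp only [map_add, hx, hy]
  · intro j x hx
    by_cases hj : j = i
    · subst hj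
      rw [gradeProj_of_mem h hx, gradeProj_of_mem h' (hf _ _ hx)]
    · rw [gradeProj_of_ne h hx hj, gradeProj_of_ne h' (hf _ _ hx) (by simpa using hj), map_zero]

theorem eq_zero_of_gradeProj {gr : ℤ → Submodule k M} (h : DirectSum.IsInternal gr) {x : M}
    (hx : ∀ i, gradeProj h i x = 0) : x = 0 := by
  have hsum : ∃ s : Finset ℤ, x = ∑ i ∈ s, gradeProj h i x := by
    have key : ∀ x, ∃ s : Finset ℤ, ∀ t : Finset ℤ, s ⊆ t → x = ∑ i ∈ t, gradeProj h i x := by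
      intro x
      refine grade_induction h (p := fun x => ∃ s : Finset ℤ, ∀ t : Finset ℤ, s ⊆ t →
        x = ∑ i ∈ t, gradeProj h i x) ⟨∅, by simp⟩ ?_ ?_ x
      · rintro x y ⟨s, hs⟩ ⟨t, ht⟩
        classical
        refine ⟨s ∪ t, fun r hr => ?_⟩
        simp only [map_add, Finset.sum_add_distrib]
        rw [← hs r (Finset.union_subset_left hr), ← ht r (Finset.union_subset_right hr)]
      · intro i x hx
        refine ⟨{i}, fun t ht => ?_⟩
        rw [Finset.sum_eq_single i, gradeProj_of_mem h hx]
        · intro j _ hj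
          exact gradeProj_of_ne h hx (Ne.symm hj)
        · intro hi
          exact absurd (ht (Finset.mem_singleton_self i)) hi
    obtain ⟨s, hs⟩ := key x
    exact ⟨s, hs s (Finset.Subset.refl s)⟩
  obtain ⟨s, hs⟩ := hsum
  rw [hs]
  exact Finset.sum_eq_zero fun i _ => hx i

/-- The linear map on a graded module that is given by `g i` in degree `i`. -/
def gradeLift {gr : ℤ → Submodule k M} (h : DirectSum.IsInternal gr)
    (g : ∀ i, gr i →ₗ[k] N) : M →ₗ[k] N :=
  DirectSum.toModule k ℤ N g ∘ₗ
    (LinearEquiv.ofBijective (DirectSum.coeLinearMap gr) h).symm.toLinearMap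

theorem gradeLift_of_mem {gr : ℤ → Submodule k M} (h : DirectSum.IsInternal gr)
    (g : ∀ i, gr i →ₗ[k] N) {i : ℤ} {x : M} (hx : x ∈ gr i) :
    gradeLift h g x = g i ⟨x, hx⟩ := by
  have : (LinearEquiv.ofBijective (DirectSum.coeLinearMap gr) h).symm x
      = DirectSum.lof k ℤ (fun i => gr i) i ⟨x, hx⟩ := by
    refine (LinearEquiv.symm_apply_eq _).2 ?_
    exact (DirectSum.coeLinearMap_lof gr i ⟨x, hx⟩).symm
  rw [gradeLift, LinearMap.comp_apply, LinearEquiv.coe_coe, this, DirectSum.toModule_lof]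

/-- A linear map between vector spaces has a generalized inverse. -/
theorem exists_generalized_inverse (g : M →ₗ[k] N) :
    ∃ r : N →ₗ[k] M, ∀ x, g (r (g x)) = g x := by
  obtain ⟨s, hs⟩ := g.rangeRestrict.exists_rightInverse_of_surjective g.range_rangeRestrict
  obtain ⟨r, hr⟩ := LinearMap.exists_extend s
  refine ⟨r, fun x => ?_⟩
  have h1 : r (g x) = s (g.rangeRestrict x) :=
    LinearMap.congr_fun hr (g.rangeRestrict x)
  rw [h1]
  exact congrArg Subtype.val (LinearMap.congr_fun hs (g.rangeRestrict x))

/-- A homogeneous linear map of degree `r` has a homogeneous generalized inverse of degree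
`-r`, also relative to a subspace `K` of the source. -/
theorem exists_homogeneous_generalized_inverse {gr : ℤ → Submodule k M}
    {gr' : ℤ → Submodule k N} (h' : DirectSum.IsInternal gr') (f : M →ₗ[k] N) (r : ℤ)
    (hf : ∀ i, ∀ x ∈ gr i, f x ∈ gr' (i + r)) (K : Submodule k M) :
    ∃ R : N →ₗ[k] M, (∀ y, R y ∈ K) ∧ (∀ i, ∀ y ∈ gr' i, R y ∈ gr (i - r)) ∧
      ∀ i, ∀ x ∈ gr i, x ∈ K → f (R (f x)) = f x := by
  choose s hs using fun i : ℤ =>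
    exists_generalized_inverse (f ∘ₗ (K ⊓ gr (i - r)).subtype)
  let g : ∀ i, gr' i →ₗ[k] M := fun i =>
    (K ⊓ gr (i - r)).subtype ∘ₗ s i ∘ₗ (gr' i).subtype
  have hg : ∀ i, ∀ y, ∀ hy : y ∈ gr' i, gradeLift h' g y = s i y := fun i y hy =>
    gradeLift_of_mem h' g hy
  refine ⟨gradeLift h' g, fun y => ?_, fun i y hy => ?_, fun i x hx hxK => ?_⟩
  · refine grade_induction h' (p := fun y => gradeLift h' g y ∈ K) (by simp) ?_ ?_ y
    · intro x y hx hy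
      rw [map_add]
      exact add_mem hx hy
    · intro i y hy
      rw [hg i y hy]
      exact (s i y).2.1
  · rw [hg i y hy]
    exact (s i y).2.2
  · rw [hg _ _ (hf i x hx)]
    exact hs (i + r) ⟨x, hxK, by simpa using hx⟩

end GradedLinear

/-! ### Acyclic fibrations of DGLAs -/

namespace DGLA

variable {k : Type u} [Field k] {L M : DGLA k}

theorem hom_proj (f : Hom L M) (i : ℤ) (x : L.carrier) :
    f.toLinearMap (gradeProj L.isInternal i x) = gradeProj M.isInternal i (f.toLinearMap x) := by
  simpa using map_gradeProj L.isInternal M.isInternal (r := 0)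
    (fun i x hx => by simpa using f.map_mem i x hx) i x

theorem d_proj (L : DGLA k) (i : ℤ) (x : L.carrier) :
    L.d (gradeProj L.isInternal i x) = gradeProj L.isInternal (i + 1) (L.d x) :=
  map_gradeProj L.isInternal L.isInternal L.d_mem i x

/-- An acyclic fibration: a surjective morphism with acyclic kernel. -/
structure Hom.IsAcyclicFibration (f : Hom L M) : Prop where
  surjective : Function.Surjective f.toLinearMap
  acyclic : ∀ x, f.toLinearMap x = 0 → L.d x = 0 → ∃ y, f.toLinearMap y = 0 ∧ L.d y = x

theorem Hom.cohomologyMap_mk (f : Hom L M) (x : LinearMap.ker L.d)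
    (hx : f.toLinearMap x.1 ∈ LinearMap.ker M.d) :
    f.cohomologyMap (cohClass L.d x) = cohClass M.d ⟨f.toLinearMap x.1, hx⟩ := rfl

theorem cohClass_eq_zero {V : Type*} [AddCommGroup V] [Module k V] (d : V →ₗ[k] V)
    (x : LinearMap.ker d) : cohClass d x = 0 ↔ ∃ y, d y = x.1 := by
  rw [Submodule.mkQ_apply, Submodule.Quotient.mk_eq_zero]
  rfl

theorem Hom.IsAcyclicFibration.isQuasiIso {f : Hom L M} (hf : f.IsAcyclicFibration) :
    f.IsQuasiIso := by
  have hmem : ∀ x ∈ LinearMap.ker L.d, f.toLinearMap x ∈ LinearMap.ker M.d := by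
    intro x hx
    rw [LinearMap.mem_ker] at hx ⊢
    rw [← f.map_d, hx, map_zero]
  constructor
  · rw [injective_iff_map_eq_zero]
    intro c hc
    obtain ⟨x, rfl⟩ := Submodule.mkQ_surjective _ c
    rw [f.cohomologyMap_mk x (hmem _ x.2), cohClass_eq_zero] at hc
    obtain ⟨y, hy⟩ := hc
    obtain ⟨z, rfl⟩ := hf.surjective y
    obtain ⟨t, -, ht⟩ := hf.acyclic (x.1 - L.d z) (by rw [map_sub, f.map_d, hy]; simp)
      (by rw [map_sub, L.d_d, sub_zero]; exact x.2)
    rw [cohClass_eq_zero]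
    exact ⟨t + z, by rw [map_add, ht]; simp⟩
  · intro c
    obtain ⟨y, rfl⟩ := Submodule.mkQ_surjective _ c
    obtain ⟨x, hx⟩ := hf.surjective y.1
    obtain ⟨z, hz, hz'⟩ := hf.acyclic (L.d x)
      (by rw [f.map_d, hx]; exact y.2) (L.d_d x)
    have hxz : x - z ∈ LinearMap.ker L.d := by
      rw [LinearMap.mem_ker, map_sub, hz', sub_self]
    refine ⟨cohClass L.d ⟨x - z, hxz⟩, ?_⟩
    rw [f.cohomologyMap_mk _ (hmem _ hxz)]
    congr 1
    ext
    simp [hx, hz]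

/-- A surjective quasi-isomorphism is an acyclic fibration. The quasi-isomorphism property is
stated on the level of cocycles. -/
theorem Hom.isAcyclicFibration_of_cocycles (f : Hom L M)
    (hs : Function.Surjective f.toLinearMap)
    (h1 : ∀ x, L.d x = 0 → (∃ y, M.d y = f.toLinearMap x) → ∃ y, L.d y = x)
    (h2 : ∀ y, M.d y = 0 → ∃ x z, L.d x = 0 ∧ y = f.toLinearMap x + M.d z) :
    f.IsAcyclicFibration := by
  refine ⟨hs, fun x hx hdx => ?_⟩
  obtain ⟨y, hy⟩ := h1 x hdx ⟨0, by rw [map_zero, hx]⟩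
  obtain ⟨z, w, hz, hw⟩ := h2 (f.toLinearMap y) (by rw [← f.map_d, hy, hx])
  obtain ⟨w, rfl⟩ := hs w
  refine ⟨y - z - L.d w, ?_, ?_⟩
  · rw [map_sub, map_sub, hw, f.map_d]
    abel
  · rw [map_sub, map_sub, hy, hz, L.d_d]
    simp

/-- An acyclic fibration `f` has a homogeneous linear section `σ`, and the kernel of `f` has a
contracting homotopy `s`. Both are expressed by operators on the whole source, so that they can
be tensored with an algebra: `1 - σ f` is a projection to the kernel. -/
theorem Hom.IsAcyclicFibration.exists_contraction {f : Hom L M} (hf : f.IsAcyclicFibration) :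
    ∃ (σ : M.carrier →ₗ[k] L.carrier) (s : L.carrier →ₗ[k] L.carrier),
      (∀ i, ∀ y ∈ M.gr i, σ y ∈ L.gr i) ∧ (∀ i, ∀ x ∈ L.gr i, s x ∈ L.gr (i - 1)) ∧
      f.toLinearMap ∘ₗ σ = LinearMap.id ∧ f.toLinearMap ∘ₗ s = 0 ∧
      (L.d ∘ₗ s + s ∘ₗ L.d) ∘ₗ (LinearMap.id - σ ∘ₗ f.toLinearMap)
        = LinearMap.id - σ ∘ₗ f.toLinearMap := by
  obtain ⟨σ, -, hσ, hσf⟩ := exists_homogeneous_generalized_inverse (gr := L.gr) M.isInternal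
    f.toLinearMap 0 (fun i x hx => by simpa using f.map_mem i x hx) ⊤
  have hfσf : ∀ x, f.toLinearMap (σ (f.toLinearMap x)) = f.toLinearMap x := by
    intro x
    refine grade_induction L.isInternal
      (p := fun x => f.toLinearMap (σ (f.toLinearMap x)) = f.toLinearMap x) (by simp) ?_ ?_ x
    · intro x y hx hy
      simp only [map_add, hx, hy]
    · intro i x hx
      exact hσf i x hx trivial
  have hfσ : ∀ y, f.toLinearMap (σ y) = y := by
    intro y
    obtain ⟨x, rfl⟩ := hf.surjective y
    exact hfσf x
  obtain ⟨R, hRK, hR, hRd⟩ := exists_homogeneous_generalized_inverse (gr := L.gr) L.isInternal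
    L.d 1 L.d_mem (LinearMap.ker f.toLinearMap)
  have hfR : ∀ y, f.toLinearMap (R y) = 0 := fun y => hRK y
  -- `R` is a right inverse of `d` on the cocycles of the kernel
  have hdR : ∀ y, f.toLinearMap y = 0 → L.d y = 0 → L.d (R y) = y := by
    intro y hy hdy
    rw [← sub_eq_zero]
    refine eq_zero_of_gradeProj L.isInternal fun i => ?_
    obtain ⟨x, hx, rfl⟩ := hf.acyclic y hy hdy
    have h1 : gradeProj L.isInternal i (L.d (R (L.d x)))
        = L.d (R (L.d (gradeProj L.isInternal (i - 1) x))) := by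
      have e1 := L.d_proj (i - 1) (R (L.d x))
      have e2 := map_gradeProj L.isInternal L.isInternal (f := R) (r := -1)
        (fun i x hx => by simpa [sub_eq_add_neg] using hR i x hx) i (L.d x)
      have e3 := L.d_proj (i - 1) x
      rw [sub_add_cancel] at e1 e3
      rw [← e1, sub_eq_add_neg, ← e2, ← sub_eq_add_neg, e3]
    have h2 := L.d_proj (i - 1) x
    rw [sub_add_cancel] at h2
    rw [map_sub, h1, ← h2, hRd (i - 1) _ (gradeProj_mem _ _ _), sub_self]
    rw [LinearMap.mem_ker, hom_proj, hx, map_zero]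
  refine ⟨σ, R ∘ₗ (LinearMap.id - R ∘ₗ L.d) ∘ₗ (LinearMap.id - σ ∘ₗ f.toLinearMap),
    fun i y hy => by simpa using hσ i y hy, ?_, LinearMap.ext hfσ, ?_, ?_⟩
  · intro i x hx
    have hx' : x - σ (f.toLinearMap x) ∈ L.gr i :=
      sub_mem hx (by simpa using hσ i _ (f.map_mem i x hx))
    refine hR i _ (sub_mem hx' ?_)
    simpa using hR (i + 1) _ (L.d_mem i _ hx')
  · ext x
    exact hfR _
  · ext x
    have hp : f.toLinearMap (x - σ (f.toLinearMap x)) = 0 := by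
      rw [map_sub, hfσ, sub_self]
    set p := x - σ (f.toLinearMap x) with hpdef
    have hdp : f.toLinearMap (L.d p) = 0 := by rw [f.map_d, hp, map_zero]
    have h1 : L.d (R (L.d p)) = L.d p := hdR _ hdp (L.d_d _)
    have h2 : L.d (R (p - R (L.d p))) = p - R (L.d p) := by
      apply hdR
      · rw [map_sub, hp, hfR, sub_zero]
      · rw [map_sub, h1, sub_self]
    simp only [LinearMap.comp_apply, LinearMap.add_apply, LinearMap.sub_apply,
      LinearMap.id_apply, ← hpdef, hp, hdp, map_zero, sub_zero, L.d_d, h2]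
    abel

end DGLA

/-! ### The DGLA `L ⊗ A` -/

section Sign

theorem negOnePow_zero_smul {V : Type*} [AddCommGroup V] (x : V) :
    (0 : ℤ).negOnePow • x = x := by simp

theorem zunit_smul_tmul {k : Type*} [Field k] {V W : Type*} [AddCommGroup V] [Module k V]
    [AddCommGroup W] [Module k W] (s : ℤˣ) (x : V) (y : W) :
    (s • x) ⊗ₜ[k] y = s • (x ⊗ₜ[k] y) := by
  rcases Int.units_eq_one_or s with rfl | rfl <;> simp [TensorProduct.neg_tmul]

theorem zunit_tmul_smul {k : Type*} [Field k] {V W : Type*} [AddCommGroup V] [Module k V]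
    [AddCommGroup W] [Module k W] (s : ℤˣ) (x : V) (y : W) :
    x ⊗ₜ[k] (s • y) = s • (x ⊗ₜ[k] y) := by
  rcases Int.units_eq_one_or s with rfl | rfl <;> simp [TensorProduct.tmul_neg]

theorem map_zunit_smul {k : Type*} [Field k] {V W : Type*} [AddCommGroup V] [Module k V]
    [AddCommGroup W] [Module k W] (f : V →ₗ[k] W) (s : ℤˣ) (x : V) : f (s • x) = s • f x := by
  rcases Int.units_eq_one_or s with rfl | rfl <;> simp

theorem zunit_smul_apply {k : Type*} [Field k] {V W : Type*} [AddCommGroup V] [Module k V]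
    [AddCommGroup W] [Module k W] (f : V →ₗ[k] W) (s : ℤˣ) (x : V) : (s • f) x = s • f x := by
  rcases Int.units_eq_one_or s with rfl | rfl <;> simp

theorem zunit_smul_mem {k : Type*} [Field k] {V : Type*} [AddCommGroup V] [Module k V]
    (p : Submodule k V) (s : ℤˣ) {x : V} (hx : x ∈ p) : s • x ∈ p := by
  rcases Int.units_eq_one_or s with rfl | rfl
  · simpa using hx
  · simpa using hx

end Sign

namespace DGLA

variable {k : Type u} [Field k] (L : DGLA k) (A : GrArt k)

theorem tensorDeg_induction {n : ℤ} {p : L.carrier ⊗[k] A.carrier → Prop}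
    (h0 : p 0) (hadd : ∀ x y, p x → p y → p (x + y)) (hsmul : ∀ (c : k) x, p x → p (c • x))
    (hp : ∀ i j, i + j = n → ∀ x ∈ L.gr i, ∀ a ∈ A.gr j, p (x ⊗ₜ a))
    {z} (hz : z ∈ L.tensorDeg A n) : p z := by
  refine Submodule.span_induction (p := fun z _ => p z) ?_ h0 (fun x y _ _ => hadd x y)
    (fun c x _ => hsmul c x) hz
  rintro _ ⟨i, j, hij, x, hx, a, ha, rfl⟩
  exact hp i j hij x hx a ha

variable {L A}

theorem tmul_mem_tensorDeg {i j n : ℤ} (hij : i + j = n) {x : L.carrier} (hx : x ∈ L.gr i)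
    {a : A.carrier} (ha : a ∈ A.gr j) : x ⊗ₜ a ∈ L.tensorDeg A n :=
  Submodule.subset_span ⟨i, j, hij, x, hx, a, ha, rfl⟩

/-- A homogeneous operator of degree `r` extends to a homogeneous operator of degree `r`. -/
theorem rTensor_mem_tensorDeg {M : DGLA k} {f : L.carrier →ₗ[k] M.carrier} {r : ℤ}
    (hf : ∀ i, ∀ x ∈ L.gr i, f x ∈ M.gr (i + r)) {n : ℤ} {z} (hz : z ∈ L.tensorDeg A n) :
    f.rTensor A.carrier z ∈ M.tensorDeg A (n + r) := by
  refine tensorDeg_induction L A (p := fun z => f.rTensor A.carrier z ∈ M.tensorDeg A (n + r))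
    (by simp) ?_ ?_ ?_ hz
  · intro x y hx hy
    rw [map_add]
    exact add_mem hx hy
  · intro c x hx
    rw [map_smul]
    exact Submodule.smul_mem _ c hx
  · intro i j hij x hx a ha
    exact tmul_mem_tensorDeg (by rw [← hij]; ring) (hf i x hx) ha

theorem tensorD_mem {n : ℤ} {z} (hz : z ∈ L.tensorDeg A n) :
    L.tensorD A z ∈ L.tensorDeg A (n + 1) :=
  rTensor_mem_tensorDeg L.d_mem hz

theorem tensorBracket_mem {m n : ℤ} {z w} (hz : z ∈ L.tensorDeg A m)
    (hw : w ∈ L.tensorDeg A n) : L.tensorBracket A z w ∈ L.tensorDeg A (m + n) := by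
  refine tensorDeg_induction L A (p := fun z => L.tensorBracket A z w ∈ L.tensorDeg A (m + n))
    (by simp) ?_ ?_ ?_ hz
  · intro x y hx hy
    rw [map_add, LinearMap.add_apply]
    exact add_mem hx hy
  · intro c x hx
    rw [map_smul, LinearMap.smul_apply]
    exact Submodule.smul_mem _ c hx
  intro i p hip x hx a ha
  refine tensorDeg_induction L A
    (p := fun w => L.tensorBracket A (x ⊗ₜ a) w ∈ L.tensorDeg A (m + n)) (by simp) ?_ ?_ ?_ hw
  · intro y y' hy hy'
    rw [map_add]
    exact add_mem hy hy'
  · intro c y hy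
    rw [map_smul]
    exact Submodule.smul_mem _ c hy
  intro j q hjq y hy b hb
  rw [L.tensorBracket_tmul A x y a b ha hy]
  exact zunit_smul_mem _ _ (tmul_mem_tensorDeg (by rw [← hip, ← hjq]; ring)
    (L.bracket_mem _ _ _ hx _ hy) (SetLike.mul_mem_graded ha hb))

theorem tensorD_tensorD (z) : L.tensorD A (L.tensorD A z) = 0 := by
  have : L.d ∘ₗ L.d = 0 := LinearMap.ext L.d_d
  rw [tensorD, ← LinearMap.comp_apply, ← LinearMap.rTensor_comp, this]
  simp

theorem tensorBracket_skew {m n : ℤ} {z w} (hz : z ∈ L.tensorDeg A m)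
    (hw : w ∈ L.tensorDeg A n) :
    L.tensorBracket A z w = -((m * n).negOnePow • L.tensorBracket A w z) := by
  refine tensorDeg_induction L A (p := fun z =>
    L.tensorBracket A z w = -((m * n).negOnePow • L.tensorBracket A w z)) (by simp) ?_ ?_ ?_ hz
  · intro x y hx hy
    simp only [map_add, LinearMap.add_apply, hx, hy, smul_add, neg_add]
  · intro c x hx
    simp only [map_smul, LinearMap.smul_apply, hx, smul_neg, smul_comm c]
  intro i p hip x hx a ha
  refine tensorDeg_induction L A (p := fun w => L.tensorBracket A (x ⊗ₜ a) w
    = -((m * n).negOnePow • L.tensorBracket A w (x ⊗ₜ a))) (by simp) ?_ ?_ ?_ hw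
  · intro x y hx hy
    simp only [map_add, LinearMap.add_apply, hx, hy, smul_add, neg_add]
  · intro c x hx
    simp only [map_smul, LinearMap.smul_apply, hx, smul_neg, smul_comm c]
  intro j q hjq y hy b hb
  rw [L.tensorBracket_tmul A x y a b ha hy, L.tensorBracket_tmul A y x b a hb hx,
    L.skew i j x hx y hy, A.graded_comm p q a ha b hb, TensorProduct.neg_tmul, smul_neg,
    zunit_smul_tmul, zunit_tmul_smul, smul_smul, smul_smul, smul_smul, neg_inj]
  congr 1
  simp only [← Int.negOnePow_add, ← hip, ← hjq]
  rw [Int.negOnePow_eq_iff]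
  simp only [parity_simps]
  tauto

theorem tensorBracket_jacobi {m n l : ℤ} {z w v} (hz : z ∈ L.tensorDeg A m)
    (hw : w ∈ L.tensorDeg A n) (hv : v ∈ L.tensorDeg A l) :
    L.tensorBracket A z (L.tensorBracket A w v)
      = L.tensorBracket A (L.tensorBracket A z w) v
        + (m * n).negOnePow • L.tensorBracket A w (L.tensorBracket A z v) := by
  refine tensorDeg_induction L A (p := fun z => L.tensorBracket A z (L.tensorBracket A w v)
      = L.tensorBracket A (L.tensorBracket A z w) v
        + (m * n).negOnePow • L.tensorBracket A w (L.tensorBracket A z v)) (by simp) ?_ ?_ ?_ hz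
  · intro x y hx hy
    simp only [map_add, LinearMap.add_apply, hx, hy, smul_add]
    abel
  · intro c x hx
    simp only [map_smul, LinearMap.smul_apply, hx, smul_add, smul_comm c]
  intro i p hip x hx a ha
  refine tensorDeg_induction L A (p := fun w =>
    L.tensorBracket A (x ⊗ₜ a) (L.tensorBracket A w v)
      = L.tensorBracket A (L.tensorBracket A (x ⊗ₜ a) w) v
        + (m * n).negOnePow • L.tensorBracket A w (L.tensorBracket A (x ⊗ₜ a) v))
    (by simp) ?_ ?_ ?_ hw
  · intro x y hx hy
    simp only [map_add, LinearMap.add_apply, hx, hy, smul_add]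
    abel
  · intro c x hx
    simp only [map_smul, LinearMap.smul_apply, hx, smul_add, smul_comm c]
  intro j q hjq y hy b hb
  refine tensorDeg_induction L A (p := fun v =>
    L.tensorBracket A (x ⊗ₜ a) (L.tensorBracket A (y ⊗ₜ b) v)
      = L.tensorBracket A (L.tensorBracket A (x ⊗ₜ a) (y ⊗ₜ b)) v
        + (m * n).negOnePow • L.tensorBracket A (y ⊗ₜ b) (L.tensorBracket A (x ⊗ₜ a) v))
    (by simp) ?_ ?_ ?_ hv
  · intro x y hx hy
    simp only [map_add, hx, hy, smul_add]
    abel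
  · intro c x hx
    simp only [map_smul, hx, smul_add, smul_comm c]
  intro r s hrs t ht c hc
  rw [L.tensorBracket_tmul A y t b c hb ht, L.tensorBracket_tmul A x y a b ha hy,
    L.tensorBracket_tmul A x t a c ha ht, map_zunit_smul, map_zunit_smul, map_zunit_smul,
    zunit_smul_apply,
    L.tensorBracket_tmul A x _ a _ ha (L.bracket_mem _ _ _ hy _ ht),
    L.tensorBracket_tmul A _ t _ c (SetLike.mul_mem_graded ha hb) ht,
    L.tensorBracket_tmul A y _ b _ hb (L.bracket_mem _ _ _ hx _ ht),
    L.jacobi i j x hx y hy t, TensorProduct.add_tmul, zunit_smul_tmul, ← mul_assoc, ← mul_assoc,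
    A.graded_comm q p b hb a ha, smul_mul_assoc, zunit_tmul_smul, smul_add, smul_add]
  simp only [smul_smul, ← Int.negOnePow_add, ← hip, ← hjq]
  congr 2
  · rw [Int.negOnePow_eq_iff]
    simp only [parity_simps]
    grind
  · rw [Int.negOnePow_eq_iff]
    simp only [parity_simps]
    grind

theorem tensorD_bracket {m n : ℤ} {z w} (hz : z ∈ L.tensorDeg A m) (hw : w ∈ L.tensorDeg A n) :
    L.tensorD A (L.tensorBracket A z w)
      = L.tensorBracket A (L.tensorD A z) w
        + m.negOnePow • L.tensorBracket A z (L.tensorD A w) := by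
  refine tensorDeg_induction L A (p := fun z => L.tensorD A (L.tensorBracket A z w)
      = L.tensorBracket A (L.tensorD A z) w
        + m.negOnePow • L.tensorBracket A z (L.tensorD A w)) (by simp) ?_ ?_ ?_ hz
  · intro x y hx hy
    simp only [map_add, LinearMap.add_apply, hx, hy, smul_add]
    abel
  · intro c x hx
    simp only [map_smul, LinearMap.smul_apply, hx, smul_add, smul_comm c]
  intro i p hip x hx a ha
  refine tensorDeg_induction L A (p := fun w => L.tensorD A (L.tensorBracket A (x ⊗ₜ a) w)
      = L.tensorBracket A (L.tensorD A (x ⊗ₜ a)) w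
        + m.negOnePow • L.tensorBracket A (x ⊗ₜ a) (L.tensorD A w)) (by simp) ?_ ?_ ?_ hw
  · intro x y hx hy
    simp only [map_add, hx, hy, smul_add]
    abel
  · intro c x hx
    simp only [map_smul, hx, smul_add, smul_comm c]
  intro j q hjq y hy b hb
  have e : ∀ (x : L.carrier) (a : A.carrier), L.tensorD A (x ⊗ₜ a) = L.d x ⊗ₜ a := fun _ _ => rfl
  rw [L.tensorBracket_tmul A x y a b ha hy, map_zunit_smul, e, e, e,
    L.tensorBracket_tmul A _ y a b ha hy,
    L.tensorBracket_tmul A x _ a b ha (L.d_mem _ _ hy), L.d_bracket i x hx y,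
    TensorProduct.add_tmul, zunit_smul_tmul, smul_add]
  simp only [smul_smul, ← Int.negOnePow_add, ← hip]
  congr 2
  rw [Int.negOnePow_eq_iff]
  simp only [parity_simps]
  tauto

/-! ### The filtration by the powers of the maximal ideal -/

theorem aug_gradeScale (A : GrArt k) (c : ℤ → ℤ) (a : A.carrier) :
    A.aug (gradeScale A.isInternal c a) = c 0 • A.aug a := by
  have hz : ∀ i, i ≠ 0 → ∀ a ∈ A.gr i, A.aug a = 0 := by
    intro i hi a ha
    -- the powers of `a` lie in pairwise different degrees
    by_contra hne
    have hpow : ∀ n : ℕ, a ^ n ≠ 0 := by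
      intro n h0
      have := congrArg A.aug h0
      rw [map_pow, map_zero] at this
      exact hne (eq_zero_of_pow_eq_zero this)
    have hmem : ∀ n : ℕ, a ^ n ∈ A.gr (n * i) := by
      intro n
      simpa using SetLike.pow_mem_graded n ha
    have hind : LinearIndependent k (fun n : ℕ => a ^ n) := by
      have h1 := A.isInternal.submodule_iSupIndep
      have h2 : iSupIndep fun n : ℕ => A.gr (n * i) :=
        h1.comp (f := fun n : ℕ => (n : ℤ) * i) (by
          intro m n hmn
          simpa [hi] using hmn)
      exact h2.linearIndependent _ hmem hpow
    have := A.finite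
    exact not_finite_iff_infinite.mpr (inferInstance : Infinite ℕ)
      (LinearIndependent.finite hind)
  refine grade_induction A.isInternal
    (p := fun a => A.aug (gradeScale A.isInternal c a) = c 0 • A.aug a) (by simp) ?_ ?_ a
  · intro x y hx hy
    simp only [map_add, hx, hy, smul_add]
  · intro i x hx
    rw [gradeScale_of_mem _ _ hx, map_zsmul]
    by_cases hi : i = 0
    · rw [hi]
    · rw [hz i hi x hx, smul_zero, smul_zero]

variable (L A) in
/-- The filtration of `L ⊗ A` by the subspaces `L ⊗ m ^ n`. -/
def tensorFil (n : ℕ) : Submodule k (L.carrier ⊗[k] A.carrier) :=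
  LinearMap.range
    ((((RingHom.ker A.aug) ^ n).restrictScalars k).subtype.lTensor L.carrier)

theorem tensorFil_induction {n : ℕ} {p : L.carrier ⊗[k] A.carrier → Prop}
    (h0 : p 0) (hadd : ∀ x y, p x → p y → p (x + y))
    (hp : ∀ x, ∀ a ∈ (RingHom.ker A.aug) ^ n, p (x ⊗ₜ a))
    {z} (hz : z ∈ L.tensorFil A n) : p z := by
  obtain ⟨t, rfl⟩ := hz
  induction t using TensorProduct.induction_on with
  | zero => simpa using h0
  | add x y hx hy => rw [map_add]; exact hadd _ _ hx hy
  | tmul x a => exact hp x a.1 a.2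

theorem tmul_mem_tensorFil {n : ℕ} (x : L.carrier) {a : A.carrier}
    (ha : a ∈ (RingHom.ker A.aug) ^ n) : x ⊗ₜ a ∈ L.tensorFil A n :=
  ⟨x ⊗ₜ ⟨a, ha⟩, rfl⟩

theorem tensorFil_one : L.tensorFil A 1 = L.tensorMax A := by
  apply le_antisymm
  · intro z hz
    refine tensorFil_induction (p := fun z => z ∈ L.tensorMax A) (zero_mem _)
      (fun x y => add_mem) ?_ hz
    intro x a ha
    rw [Submodule.pow_one, RingHom.mem_ker] at ha
    rw [tensorMax, LinearMap.mem_ker, LinearMap.lTensor_tmul]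
    exact (congrArg (x ⊗ₜ[k] ·) ha).trans (TensorProduct.tmul_zero _ _)
  · intro z hz
    let q : A.carrier →ₗ[k] A.carrier :=
      LinearMap.id - Algebra.linearMap k A.carrier ∘ₗ A.aug.toLinearMap
    have hq : ∀ t, q.lTensor L.carrier t ∈ L.tensorFil A 1 := by
      intro t
      induction t using TensorProduct.induction_on with
      | zero => simp
      | add x y hx hy => rw [map_add]; exact add_mem hx hy
      | tmul x a =>
        refine tmul_mem_tensorFil x ?_
        rw [Submodule.pow_one, RingHom.mem_ker]
        simp [q]
    have : q.lTensor L.carrier z = z := by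
      have hz' : A.aug.toLinearMap.lTensor L.carrier z = 0 := hz
      simp only [q, LinearMap.lTensor_sub, LinearMap.lTensor_comp, LinearMap.sub_apply,
        LinearMap.comp_apply, hz', map_zero, LinearMap.lTensor_id, LinearMap.id_apply, sub_zero]
    rw [← this]
    exact hq z

theorem tensorFil_succ_le (n : ℕ) : L.tensorFil A (n + 1) ≤ L.tensorFil A n := by
  intro z hz
  refine tensorFil_induction (p := fun z => z ∈ L.tensorFil A n) (zero_mem _)
    (fun x y => add_mem) ?_ hz
  intro x a ha
  refine tmul_mem_tensorFil x ?_
  rcases Nat.eq_zero_or_pos n with rfl | hn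
  · rw [Submodule.pow_zero]
    exact ⟨a, by simp⟩
  · rw [Submodule.pow_succ' _ hn.ne'] at ha
    exact Submodule.mul_le.2 (fun x _ y hy => Ideal.mul_mem_left _ x hy) ha

theorem exists_tensorFil_eq_bot : ∃ N, 1 ≤ N ∧ L.tensorFil A N = ⊥ := by
  obtain ⟨n, hn⟩ := A.nilpotent
  refine ⟨n + 1, by omega, ?_⟩
  rw [eq_bot_iff]
  intro z hz
  refine tensorFil_induction (p := fun z => z ∈ (⊥ : Submodule k _)) (zero_mem _)
    (fun x y => add_mem) ?_ (tensorFil_succ_le n hz)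
  intro x a ha
  rw [hn] at ha
  rw [show a = 0 from ha]
  simp

theorem rTensor_mem_tensorFil {M : DGLA k} (f : L.carrier →ₗ[k] M.carrier) {n : ℕ} {z}
    (hz : z ∈ L.tensorFil A n) : f.rTensor A.carrier z ∈ M.tensorFil A n := by
  refine tensorFil_induction (p := fun z => f.rTensor A.carrier z ∈ M.tensorFil A n) (by simp)
    ?_ ?_ hz
  · intro x y hx hy
    rw [map_add]
    exact add_mem hx hy
  · intro x a ha
    exact tmul_mem_tensorFil (f x) ha

theorem tensorBracket_mem_tensorFil {n : ℕ} {z w} (hz : z ∈ L.tensorMax A)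
    (hw : w ∈ L.tensorFil A n) : L.tensorBracket A z w ∈ L.tensorFil A (n + 1) := by
  rw [← tensorFil_one] at hz
  refine tensorFil_induction (p := fun z => L.tensorBracket A z w ∈ L.tensorFil A (n + 1))
    (by simp) ?_ ?_ hz
  · intro x y hx hy
    rw [map_add, LinearMap.add_apply]
    exact add_mem hx hy
  intro x a ha
  refine tensorFil_induction
    (p := fun w => L.tensorBracket A (x ⊗ₜ a) w ∈ L.tensorFil A (n + 1)) (by simp) ?_ ?_ hw
  · intro x y hx hy
    rw [map_add]
    exact add_mem hx hy
  intro y b hb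
  rw [Submodule.pow_one, RingHom.mem_ker] at ha
  have hs : ∀ c : ℤ → ℤ, gradeScale A.isInternal c a * b ∈ (RingHom.ker A.aug) ^ (n + 1) := by
    intro c
    have hc : gradeScale A.isInternal c a ∈ RingHom.ker A.aug := by
      rw [RingHom.mem_ker, aug_gradeScale, ha, smul_zero]
    rcases Nat.eq_zero_or_pos n with rfl | hn
    · rw [Submodule.pow_one, RingHom.mem_ker, map_mul, RingHom.mem_ker.1 hc, zero_mul]
    · rw [Submodule.pow_succ' _ hn.ne']
      exact Submodule.mul_mem_mul hc hb
  simp only [tensorBracket, LinearMap.add_apply, TensorProduct.map₂_apply_tmul,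
    LinearMap.comp_apply]
  exact add_mem (tmul_mem_tensorFil _ (hs _)) (tmul_mem_tensorFil _ (hs _))

theorem tensorBracket_pow_mem {ξ} (hξ : ξ ∈ L.tensorMax A) (m n : ℕ) {z}
    (hz : z ∈ L.tensorFil A m) : ((L.tensorBracket A ξ) ^ n) z ∈ L.tensorFil A (m + n) := by
  induction n with
  | zero => simpa using hz
  | succ n ih =>
    rw [pow_succ', Module.End.mul_apply]
    exact tensorBracket_mem_tensorFil hξ ih

theorem exists_tensorBracket_pow_eq_zero {ξ} (hξ : ξ ∈ L.tensorMax A) :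
    ∃ N, (L.tensorBracket A ξ) ^ N = 0 := by
  obtain ⟨N, -, hN⟩ := exists_tensorFil_eq_bot (L := L) (A := A)
  refine ⟨N, LinearMap.ext fun z => ?_⟩
  have h0 : z ∈ L.tensorFil A 0 := by
    induction z using TensorProduct.induction_on with
    | zero => exact zero_mem _
    | add x y hx hy => exact add_mem hx hy
    | tmul x a => exact tmul_mem_tensorFil x ⟨a, by simp⟩
  have := tensorBracket_pow_mem hξ 0 N h0
  rw [zero_add, hN] at this
  exact this

theorem tensorD_mem_tensorFil {n : ℕ} {z} (hz : z ∈ L.tensorFil A n) :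
    L.tensorD A z ∈ L.tensorFil A n :=
  rTensor_mem_tensorFil L.d hz

end DGLA

/-! ### The gauge action -/

/-- If `a` and `D` are nilpotent and `a` acts on the values of the bilinear map `β` by the
Leibniz rule with `D`, then `exp a (β x y) = β (exp D x) (exp D y)`. -/
theorem exp_bilinear_of_derivation {R M V : Type*} [CommRing R] [AddCommGroup M] [Module R M]
    [AddCommGroup V] [Module R V] [Module ℚ M] [Module ℚ V] [Module ℚ (M ⊗[R] M)]
    (β : M →ₗ[R] M →ₗ[R] V) (D : Module.End R M) (a : Module.End R V)
    (h : ∀ x y, a (β x y) = β (D x) y + β x (D y)) (hD : IsNilpotent D) (ha : IsNilpotent a)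
    (x y : M) :
    IsNilpotent.exp a (β x y) = β (IsNilpotent.exp D x) (IsNilpotent.exp D y) := by
  let DL : Module.End R (M ⊗[R] M) := D.lTensor M
  let DR : Module.End R (M ⊗[R] M) := D.rTensor M
  have h_nilL : IsNilpotent DL := hD.map <| Module.End.lTensorAlgHom R M M
  have h_nilR : IsNilpotent DR := hD.map <| Module.End.rTensorAlgHom R M M
  have h_comm : Commute DL DR := by ext; simp [DL, DR]
  set m : M ⊗[R] M →ₗ[R] V := TensorProduct.lift β with hm
  have h₁ : IsNilpotent.exp a (β x y) = m (IsNilpotent.exp (DL + DR) (x ⊗ₜ[R] y)) := by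
    suffices IsNilpotent.exp a ∘ₗ m = m ∘ₗ IsNilpotent.exp (DL + DR) by
      simpa [hm] using! LinearMap.congr_fun this (x ⊗ₜ[R] y)
    apply Module.End.commute_exp_left_of_commute (h_comm.isNilpotent_add h_nilL h_nilR) ha
    ext
    simp [DL, DR, hm, h, add_comm]
  have h₂ : IsNilpotent.exp DL = (IsNilpotent.exp D).lTensor M :=
    (hD.map_exp (Module.End.lTensorAlgHom R M M)).symm
  have h₃ : IsNilpotent.exp DR = (IsNilpotent.exp D).rTensor M :=
    (hD.map_exp (Module.End.rTensorAlgHom R M M)).symm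
  simp [h₁, IsNilpotent.exp_add_of_commute h_comm h_nilL h_nilR, h₂, h₃, hm]

theorem sum_range_eq_of_pow_apply_eq_zero {k V : Type*} [Field k] [AddCommGroup V] [Module k V]
    (a : Module.End k V) (c : ℕ → k) {v : V} {m n : ℕ} (hm : (a ^ m) v = 0)
    (hn : (a ^ n) v = 0) :
    ∑ i ∈ Finset.range m, c i • (a ^ i) v = ∑ i ∈ Finset.range n, c i • (a ^ i) v := by
  have key : ∀ m n, m ≤ n → (a ^ m) v = 0 →
      ∑ i ∈ Finset.range m, c i • (a ^ i) v = ∑ i ∈ Finset.range n, c i • (a ^ i) v := by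
    intro m n hmn hm
    refine Finset.sum_subset (Finset.range_mono hmn) fun i _ hi => ?_
    obtain ⟨j, rfl⟩ := Nat.exists_eq_add_of_le (not_lt.1 fun h => hi (Finset.mem_range.2 h))
    rw [add_comm, pow_add, Module.End.mul_apply, hm, map_zero, smul_zero]
  rcases le_total m n with h | h
  · exact key m n h hm
  · exact (key n m h hn).symm

namespace DGLA

variable {k : Type u} [Field k] {L : DGLA k} {A : GrArt k}

/-- The curvature `dγ + ½ [γ, γ]`. -/
def curvature (L : DGLA k) (A : GrArt k) (γ : L.carrier ⊗[k] A.carrier) :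
    L.carrier ⊗[k] A.carrier :=
  L.tensorD A γ + (2 : k)⁻¹ • L.tensorBracket A γ γ

/-- The element `e ^ ξ · γ`, by a sum with `N` terms. -/
def gauge (L : DGLA k) (A : GrArt k) (N : ℕ) (ξ γ : L.carrier ⊗[k] A.carrier) :
    L.carrier ⊗[k] A.carrier :=
  γ + ∑ n ∈ Finset.range N, ((n + 1).factorial : k)⁻¹ •
      ((L.tensorBracket A ξ) ^ n) (L.tensorBracket A ξ γ - L.tensorD A ξ)

theorem tensorBracket_pow_mem_deg {ξ} (hξ : ξ ∈ L.tensorDeg A 0) {d : ℤ} {z}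
    (hz : z ∈ L.tensorDeg A d) (n : ℕ) : ((L.tensorBracket A ξ) ^ n) z ∈ L.tensorDeg A d := by
  induction n with
  | zero => simpa using hz
  | succ n ih =>
    rw [pow_succ', Module.End.mul_apply]
    simpa using tensorBracket_mem hξ ih

theorem gauge_gen_mem_deg {ξ γ} (hξ : ξ ∈ L.tensorDeg A 0) (hγ : γ ∈ L.tensorDeg A 1) :
    L.tensorBracket A ξ γ - L.tensorD A ξ ∈ L.tensorDeg A 1 :=
  sub_mem (by simpa using tensorBracket_mem hξ hγ) (by simpa using tensorD_mem hξ)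

theorem gauge_gen_mem_fil {ξ γ} {n : ℕ} (hξ : ξ ∈ L.tensorDeg A 0) (hγ : γ ∈ L.tensorDeg A 1)
    (hξn : ξ ∈ L.tensorFil A n) (hγm : γ ∈ L.tensorMax A) :
    L.tensorBracket A ξ γ ∈ L.tensorFil A (n + 1) := by
  rw [tensorBracket_skew hξ hγ]
  exact neg_mem (zunit_smul_mem _ _ (tensorBracket_mem_tensorFil hγm hξn))

theorem gauge_mem_deg {ξ γ} (N : ℕ) (hξ : ξ ∈ L.tensorDeg A 0) (hγ : γ ∈ L.tensorDeg A 1) :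
    L.gauge A N ξ γ ∈ L.tensorDeg A 1 :=
  add_mem hγ (Submodule.sum_mem _ fun n _ => Submodule.smul_mem _ _
    (tensorBracket_pow_mem_deg hξ (gauge_gen_mem_deg hξ hγ) n))

theorem gauge_mem_max {ξ γ} (N : ℕ) (hξ : ξ ∈ L.tensorMax A) (hγ : γ ∈ L.tensorMax A) :
    L.gauge A N ξ γ ∈ L.tensorMax A := by
  refine add_mem hγ (Submodule.sum_mem _ fun n _ => Submodule.smul_mem _ _ ?_)
  rw [← tensorFil_one] at hγ ⊢
  have h1 : L.tensorBracket A ξ γ - L.tensorD A ξ ∈ L.tensorFil A 1 :=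
    sub_mem (tensorFil_succ_le 1 (tensorBracket_mem_tensorFil hξ hγ))
      (tensorD_mem_tensorFil (by rwa [tensorFil_one]))
  clear * - h1 hξ
  induction n with
  | zero => simpa using h1
  | succ n ih =>
    rw [pow_succ', Module.End.mul_apply]
    exact tensorFil_succ_le 1 (tensorBracket_mem_tensorFil hξ ih)

/-- The gauge action preserves Maurer-Cartan elements. In the extension of `L ⊗ A` by an element
`∂` with `[∂, x] = dx`, the Maurer-Cartan equation says that `[γ + ∂, γ + ∂] = 0`, and `e ^ ξ`
is the exponential of a derivation. -/
theorem curvature_gauge [CharZero k] {ξ γ} {N : ℕ} (hξ : ξ ∈ L.tensorDeg A 0)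
    (hγ : γ ∈ L.tensorDeg A 1) (hN : (L.tensorBracket A ξ) ^ N = 0)
    (hc : L.curvature A γ = 0) : L.curvature A (L.gauge A N ξ γ) = 0 := by
  let W := L.tensorDeg A 1
  let a : Module.End k (L.carrier ⊗[k] A.carrier) := L.tensorBracket A ξ
  have haW : ∀ x ∈ W, a x ∈ W := fun x hx => by simpa [a, W] using tensorBracket_mem hξ hx
  have hdW : L.tensorD A ξ ∈ W := by simpa using tensorD_mem hξ
  let D : Module.End k (W × k) := LinearMap.inl k W k ∘ₗ
    ((a.restrict haW) ∘ₗ LinearMap.fst k W k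
      - (LinearMap.toSpanSingleton k W ⟨L.tensorD A ξ, hdW⟩) ∘ₗ LinearMap.snd k W k)
  have hD : ∀ x : W × k, D x = (⟨a x.1 - x.2 • L.tensorD A ξ,
      sub_mem (haW _ x.1.2) (W.smul_mem _ hdW)⟩, 0) := by
    intro x
    refine Prod.ext (Subtype.ext ?_) ?_
    · simp [D]
    · simp [D]
  let β : (W × k) →ₗ[k] (W × k) →ₗ[k] L.carrier ⊗[k] A.carrier :=
    (L.tensorBracket A).compl₁₂ (W.subtype ∘ₗ LinearMap.fst k W k)
        (W.subtype ∘ₗ LinearMap.fst k W k)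
      + (LinearMap.lsmul k (L.carrier ⊗[k] A.carrier)).compl₁₂ (LinearMap.snd k W k)
        (L.tensorD A ∘ₗ W.subtype ∘ₗ LinearMap.fst k W k)
      + ((LinearMap.lsmul k (L.carrier ⊗[k] A.carrier)).compl₁₂ (LinearMap.snd k W k)
        (L.tensorD A ∘ₗ W.subtype ∘ₗ LinearMap.fst k W k)).flip
  have hβ : ∀ x y : W × k, β x y = L.tensorBracket A x.1.1 y.1.1 + x.2 • L.tensorD A y.1.1
      + y.2 • L.tensorD A x.1.1 := fun x y => by simp [β]
  let _ : Module ℚ (L.carrier ⊗[k] A.carrier) := Module.compHom _ (algebraMap ℚ k)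
  let _ : Module ℚ (W × k) := Module.compHom _ (algebraMap ℚ k)
  let _ : Module ℚ ((W × k) ⊗[k] (W × k)) := Module.compHom _ (algebraMap ℚ k)
  have hder : ∀ x y, a (β x y) = β (D x) y + β x (D y) := by
    rintro ⟨⟨x, hx⟩, s⟩ ⟨⟨y, hy⟩, t⟩
    have e1 := tensorBracket_jacobi hξ hx hy
    have e2 := tensorD_bracket hξ hx
    have e3 := tensorD_bracket hξ hy
    have e4 := tensorBracket_skew hx hdW
    simp only [zero_mul, negOnePow_zero_smul] at e1 e2 e3
    simp only [one_mul, Int.negOnePow_one, Units.neg_smul, one_smul, neg_neg] at e4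
    simp only [hβ, hD, a, map_add, map_sub, map_smul, LinearMap.sub_apply, LinearMap.smul_apply,
      e1, e2, e3, e4, tensorD_tensorD, zero_smul, smul_zero]
    module
  have haN : a ^ N = 0 := hN
  have hDpow : ∀ (n : ℕ) (x : W × k), (D ^ (n + 1)) x = (⟨(a ^ n) (a x.1 - x.2 • L.tensorD A ξ),
      tensorBracket_pow_mem_deg hξ (sub_mem (haW _ x.1.2) (W.smul_mem _ hdW)) n⟩, 0) := by
    intro n x
    induction n with
    | zero => simp [hD]
    | succ n ih =>
      rw [pow_succ', Module.End.mul_apply, ih, hD]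
      refine Prod.ext (Subtype.ext ?_) rfl
      simp [pow_succ']
  have hDN : D ^ (N + 1) = 0 := by
    refine LinearMap.ext fun x => ?_
    rw [hDpow]
    refine Prod.ext (Subtype.ext ?_) rfl
    simp [haN]
  have key := exp_bilinear_of_derivation β D a hder ⟨_, hDN⟩ ⟨_, haN⟩ (⟨γ, hγ⟩, 1) (⟨γ, hγ⟩, 1)
  have hexp : IsNilpotent.exp D (⟨γ, hγ⟩, 1) = (⟨L.gauge A N ξ γ, gauge_mem_deg N hξ hγ⟩, 1) := by
    rw [IsNilpotent.exp_eq_sum hDN, LinearMap.sum_apply, Finset.sum_range_succ']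
    simp only [LinearMap.smul_apply, hDpow, ← Rat.cast_smul_eq_qsmul k]
    refine Prod.ext (Subtype.ext ?_) ?_
    · simp [gauge, Prod.fst_sum, a, add_comm]
    · simp [Prod.snd_sum]
  have h2 : ∀ z : W × k, z.2 = 1 → β z z = (2 : k) • L.curvature A z.1.1 := by
    intro z hz
    rw [hβ, hz, curvature, smul_add, smul_smul, mul_inv_cancel₀ two_ne_zero]
    module
  rw [hexp, h2 _ rfl, h2 _ rfl, hc, smul_zero, map_zero] at key
  exact (smul_eq_zero.1 key.symm).resolve_left two_ne_zero

/-- The gauge action on Maurer-Cartan elements. -/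
theorem exists_gaugeRel [CharZero k] (γ : L.MC A) {ξ} (h0 : ξ ∈ L.tensorDeg A 0)
    (hm : ξ ∈ L.tensorMax A) :
    ∃ (N : ℕ) (γ' : L.MC A), (L.tensorBracket A ξ) ^ N = 0 ∧ γ'.1 = L.gauge A N ξ γ.1 ∧
      L.gaugeRel A γ γ' := by
  obtain ⟨N, hN⟩ := exists_tensorBracket_pow_eq_zero hm
  refine ⟨N, ⟨L.gauge A N ξ γ.1, gauge_mem_deg N h0 γ.2.1, gauge_mem_max N hm γ.2.2.1,
    curvature_gauge h0 γ.2.1 hN γ.2.2.2⟩, hN, rfl, ξ, h0, hm, N, ?_, rfl⟩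
  rw [hN, LinearMap.zero_apply]

end DGLA

/-! ### Acyclic fibrations induce isomorphisms of deformation functors -/

namespace DGLA

variable {k : Type u} [Field k] {P L : DGLA k} (f : Hom P L) (A : GrArt k)

/-- The map `f ⊗ id` from `P ⊗ A` to `L ⊗ A`. -/
def Hom.tensor : P.carrier ⊗[k] A.carrier →ₗ[k] L.carrier ⊗[k] A.carrier :=
  f.toLinearMap.rTensor A.carrier

variable {A}

theorem Hom.tensor_deg {n : ℤ} {z} (hz : z ∈ P.tensorDeg A n) :
    f.tensor A z ∈ L.tensorDeg A n := by
  have := rTensor_mem_tensorDeg (r := 0) (fun i x hx => by simpa using f.map_mem i x hx) hz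
  rwa [add_zero] at this

theorem Hom.tensor_max {z} (hz : z ∈ P.tensorMax A) : f.tensor A z ∈ L.tensorMax A := by
  rw [← tensorFil_one] at hz ⊢
  exact rTensor_mem_tensorFil _ hz

theorem Hom.tensor_d (z) : f.tensor A (P.tensorD A z) = L.tensorD A (f.tensor A z) := by
  simp only [tensor, tensorD, ← LinearMap.comp_apply, ← LinearMap.rTensor_comp]
  congr 2
  exact LinearMap.ext f.map_d

theorem Hom.tensor_bracket (z w) : f.tensor A (P.tensorBracket A z w)
    = L.tensorBracket A (f.tensor A z) (f.tensor A w) := by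
  have hpar : ∀ x, f.toLinearMap (P.parity x) = L.parity (f.toLinearMap x) :=
    map_gradeScale P.isInternal L.isInternal _ f.map_mem
  induction z using TensorProduct.induction_on with
  | zero => simp
  | add z z' hz hz' => simp only [map_add, LinearMap.add_apply, hz, hz']
  | tmul x a =>
    induction w using TensorProduct.induction_on with
    | zero => simp
    | add w w' hw hw' => simp only [map_add, hw, hw']
    | tmul y b => simp [tensorBracket, tensor, f.map_bracket, hpar]

theorem Hom.tensor_curvature (z) :
    f.tensor A (P.curvature A z) = L.curvature A (f.tensor A z) := by
  simp only [curvature, map_add, map_smul, f.tensor_d, f.tensor_bracket]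

theorem Hom.tensor_bracket_pow (n : ℕ) (ξ w) :
    f.tensor A (((P.tensorBracket A ξ) ^ n) w)
      = ((L.tensorBracket A (f.tensor A ξ)) ^ n) (f.tensor A w) := by
  induction n with
  | zero => simp
  | succ n ih => rw [pow_succ', pow_succ', Module.End.mul_apply, Module.End.mul_apply,
      f.tensor_bracket, ih]

theorem Hom.tensor_gauge (N : ℕ) (ξ γ) :
    f.tensor A (P.gauge A N ξ γ) = L.gauge A N (f.tensor A ξ) (f.tensor A γ) := by
  simp only [gauge, map_add, map_sum, map_smul, f.tensor_bracket_pow, map_sub,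
    f.tensor_d, f.tensor_bracket]

variable (A) in
/-- The map induced by a morphism of DGLAs on Maurer-Cartan elements. -/
def Hom.mc (γ : P.MC A) : L.MC A :=
  ⟨f.tensor A γ.1, f.tensor_deg γ.2.1, f.tensor_max γ.2.2.1, by
    have := f.tensor_curvature γ.1
    rw [show P.curvature A γ.1 = 0 from γ.2.2.2, map_zero] at this
    exact this.symm⟩

theorem Hom.mc_gaugeRel (γ γ' : P.MC A) (h : P.gaugeRel A γ γ') :
    L.gaugeRel A (f.mc A γ) (f.mc A γ') := by
  obtain ⟨ξ, h0, hm, N, hN, h⟩ := h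
  refine ⟨f.tensor A ξ, f.tensor_deg h0, f.tensor_max hm, N, ?_, ?_⟩
  · rw [Hom.mc, ← f.tensor_bracket, ← f.tensor_d, ← map_sub, ← f.tensor_bracket_pow, hN, map_zero]
  · have := f.tensor_gauge N ξ γ.1
    rw [show P.gauge A N ξ γ.1 = γ'.1 from h.symm] at this
    exact this

/-- The natural transformation of deformation functors induced by a morphism of DGLAs. -/
def Hom.extDefMap : P.extDef ⟶ L.extDef where
  app A := TypeCat.ofHom (Quot.map (f.mc A) f.mc_gaugeRel)
  naturality A B g := by
    ext x
    obtain ⟨γ, rfl⟩ := Quot.exists_rep x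
    refine congrArg (Quot.mk _) (Subtype.ext ?_)
    change f.tensor B (P.tensorMap g γ.1) = L.tensorMap g (f.tensor A γ.1)
    simp only [tensorMap, tensor, ← LinearMap.comp_apply, LinearMap.lTensor_comp_rTensor,
      LinearMap.rTensor_comp_lTensor]

variable {f} [CharZero k]

theorem curvature_add {γ x} (hγ : γ ∈ L.tensorDeg A 1) (hx : x ∈ L.tensorDeg A 1) :
    L.curvature A (γ + x) = L.curvature A γ
      + (L.tensorD A x + L.tensorBracket A γ x + (2 : k)⁻¹ • L.tensorBracket A x x) := by
  have h := tensorBracket_skew hx hγ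
  simp only [one_mul, Int.negOnePow_one, Units.neg_smul, one_smul, neg_neg] at h
  simp only [curvature, map_add, LinearMap.add_apply, h]
  have h2 : (2 : k) ≠ 0 := two_ne_zero
  match_scalars <;> field_simp <;> norm_num

/-- Along an acyclic fibration, Maurer-Cartan elements lift: a lift with curvature `E` in
`P ⊗ m ^ n` is improved to `z - s E`, where `s` is the contraction of the kernel. -/
theorem Hom.IsAcyclicFibration.mc_surjective (hf : f.IsAcyclicFibration) :
    Function.Surjective (f.mc A) := by
  intro γ
  obtain ⟨σ, s, hσ, hs, hfσ, hfs, hds⟩ := hf.exists_contraction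
  have hfs' : ∀ z, f.tensor A (s.rTensor A.carrier z) = 0 := by
    intro z
    rw [tensor, ← LinearMap.comp_apply, ← LinearMap.rTensor_comp, hfs]
    simp
  have hds' : ∀ z, f.tensor A z = 0 → P.tensorD A (s.rTensor A.carrier z)
      + s.rTensor A.carrier (P.tensorD A z) = z := by
    intro z hz
    have := congrArg (fun g => g.rTensor A.carrier z) hds
    have hz' : f.toLinearMap.rTensor A.carrier z = 0 := hz
    simp only [LinearMap.rTensor_sub, LinearMap.rTensor_comp, LinearMap.rTensor_add,
      LinearMap.comp_apply, LinearMap.sub_apply, LinearMap.add_apply, hz', map_zero,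
      LinearMap.rTensor_id, LinearMap.id_apply, sub_zero] at this
    exact this
  have step : ∀ n : ℕ, ∃ z, z ∈ P.tensorDeg A 1 ∧ z ∈ P.tensorMax A ∧ f.tensor A z = γ.1 ∧
      P.curvature A z ∈ P.tensorFil A (n + 1) := by
    intro n
    induction n with
    | zero =>
      have hm : σ.rTensor A.carrier γ.1 ∈ P.tensorFil A 1 :=
        rTensor_mem_tensorFil σ (by rw [tensorFil_one]; exact γ.2.2.1)
      refine ⟨σ.rTensor A.carrier γ.1, ?_, by rwa [← tensorFil_one], ?_, ?_⟩
      · simpa using rTensor_mem_tensorDeg (r := 0) (fun i x hx => by simpa using hσ i x hx)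
          γ.2.1
      · rw [tensor, ← LinearMap.comp_apply, ← LinearMap.rTensor_comp, hfσ]
        simp
      · exact add_mem (tensorD_mem_tensorFil hm) (Submodule.smul_mem _ _ (tensorFil_succ_le 1
          (tensorBracket_mem_tensorFil (by rwa [← tensorFil_one]) hm)))
    | succ n ih =>
      obtain ⟨z, hz1, hzm, hfz, hE⟩ := ih
      have hE2 : P.curvature A z ∈ P.tensorDeg A 2 :=
        add_mem (by simpa using tensorD_mem hz1)
          (Submodule.smul_mem _ _ (by simpa using tensorBracket_mem hz1 hz1))
      have hEm : P.curvature A z ∈ P.tensorFil A 1 := by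
        rw [← tensorFil_one] at hzm
        exact add_mem (tensorD_mem_tensorFil hzm) (Submodule.smul_mem _ _ (tensorFil_succ_le 1
          (tensorBracket_mem_tensorFil (by rwa [← tensorFil_one]) hzm)))
      have hfE : f.tensor A (P.curvature A z) = 0 := by
        rw [f.tensor_curvature, hfz]
        exact γ.2.2.2
      set E := P.curvature A z with hEdef
      -- the Bianchi identity
      have hdE : P.tensorD A E ∈ P.tensorFil A (n + 2) := by
        have e1 := tensorD_bracket hz1 hz1
        have e2 := tensorBracket_skew hz1 (tensorD_mem hz1)
        have e3 := tensorBracket_jacobi hz1 hz1 hz1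
        have e4 := tensorBracket_skew (tensorBracket_mem hz1 hz1) hz1
        have e5 : P.tensorD A E = - P.tensorBracket A z E := by
          have e6 : P.tensorBracket A z (P.tensorBracket A z z) = 0 := by
            have h3 : (3 : k) • P.tensorBracket A z (P.tensorBracket A z z) = 0 := by
              simp only [show (1 : ℤ) * 1 = 1 by rfl, show ((1 : ℤ) + 1) * 1 = 2 by rfl,
                Int.negOnePow_one, show (2 : ℤ).negOnePow = 1 from Int.negOnePow_even 2 (by decide),
                Units.neg_smul, one_smul] at e3 e4
              rw [e4] at e3
              have : P.tensorBracket A z (P.tensorBracket A z z)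
                + P.tensorBracket A z (P.tensorBracket A z z)
                + P.tensorBracket A z (P.tensorBracket A z z) = 0 := by
                nth_rewrite 1 [e3]
                abel
              rw [← this]
              module
            exact (smul_eq_zero.1 h3).resolve_left three_ne_zero
          simp only [show (1 : ℤ) * (1 + 1) = 2 by rfl, Int.negOnePow_one,
                show (2 : ℤ).negOnePow = 1 from Int.negOnePow_even 2 (by decide),
                Units.neg_smul, one_smul] at e1 e2
          have e7 : P.tensorBracket A (P.tensorD A z) z
              = - P.tensorBracket A z (P.tensorD A z) := by rw [e2, neg_neg]
          rw [hEdef, curvature, map_add, tensorD_tensorD, map_smul, e1, e7, map_add, map_smul, e6]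
          have h2 : (2 : k) ≠ 0 := two_ne_zero
          match_scalars
          field_simp
          norm_num
        rw [e5]
        exact neg_mem (tensorBracket_mem_tensorFil hzm hE)
      set y := s.rTensor A.carrier E with hydef
      have hy1 : y ∈ P.tensorDeg A 1 := by
        simpa using rTensor_mem_tensorDeg (r := -1)
          (fun i x hx => by simpa [sub_eq_add_neg] using hs i x hx) hE2
      have hyn : y ∈ P.tensorFil A (n + 1) := rTensor_mem_tensorFil s hE
      have hym : y ∈ P.tensorMax A := by
        rw [← tensorFil_one]
        exact rTensor_mem_tensorFil s hEm
      refine ⟨z - y, sub_mem hz1 hy1, sub_mem hzm hym, by rw [map_sub, hfz, hfs', sub_zero], ?_⟩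
      have hcurv : P.curvature A (z - y) = s.rTensor A.carrier (P.tensorD A E)
          - P.tensorBracket A z y + (2 : k)⁻¹ • P.tensorBracket A y y := by
        rw [sub_eq_add_neg, curvature_add hz1 (neg_mem hy1), ← hEdef, eq_sub_of_add_eq' (hds' E hfE)]
        simp only [map_neg, LinearMap.neg_apply, neg_neg]
        abel
      rw [hcurv]
      exact add_mem (sub_mem (rTensor_mem_tensorFil s hdE) (tensorBracket_mem_tensorFil hzm hyn))
        (Submodule.smul_mem _ _ (tensorBracket_mem_tensorFil hym hyn))
  obtain ⟨N, hN1, hN⟩ := exists_tensorFil_eq_bot (L := P) (A := A)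
  obtain ⟨z, hz1, hzm, hfz, hE⟩ := step N
  have hE' := tensorFil_succ_le N hE
  rw [hN] at hE'
  exact ⟨⟨z, hz1, hzm, hE'⟩, Subtype.ext hfz⟩

/-- Maurer-Cartan elements with the same image under an acyclic fibration are gauge
equivalent. -/
theorem Hom.IsAcyclicFibration.eqvGen_of_mc_eq (hf : f.IsAcyclicFibration) (γ γ' : P.MC A)
    (h : f.mc A γ = f.mc A γ') : Relation.EqvGen (P.gaugeRel A) γ γ' := by
  obtain ⟨σ, s, hσ, hs, hfσ, hfs, hds⟩ := hf.exists_contraction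
  have hfs' : ∀ z, f.tensor A (s.rTensor A.carrier z) = 0 := by
    intro z
    rw [tensor, ← LinearMap.comp_apply, ← LinearMap.rTensor_comp, hfs]
    simp
  have hds' : ∀ z, f.tensor A z = 0 → P.tensorD A (s.rTensor A.carrier z)
      + s.rTensor A.carrier (P.tensorD A z) = z := by
    intro z hz
    have := congrArg (fun g => g.rTensor A.carrier z) hds
    have hz' : f.toLinearMap.rTensor A.carrier z = 0 := hz
    simp only [LinearMap.rTensor_sub, LinearMap.rTensor_comp, LinearMap.rTensor_add,
      LinearMap.comp_apply, LinearMap.sub_apply, LinearMap.add_apply, hz', map_zero,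
      LinearMap.rTensor_id, LinearMap.id_apply, sub_zero] at this
    exact this
  obtain ⟨N, hN1, hN⟩ := exists_tensorFil_eq_bot (L := P) (A := A)
  have step : ∀ m n : ℕ, n + m = N → ∀ γ γ' : P.MC A, f.mc A γ = f.mc A γ' →
      γ'.1 - γ.1 ∈ P.tensorFil A n → Relation.EqvGen (P.gaugeRel A) γ γ' := by
    intro m
    induction m with
    | zero =>
      intro n hn γ γ' _ hx
      rw [show n = N by omega, hN, Submodule.mem_bot, sub_eq_zero] at hx
      rw [Subtype.ext hx]
      exact Relation.EqvGen.refl _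
    | succ m ih =>
      intro n hn γ γ' hγ hxn
      set x := γ'.1 - γ.1 with hx
      have hx1 : x ∈ P.tensorDeg A 1 := sub_mem γ'.2.1 γ.2.1
      have hxm : x ∈ P.tensorMax A := sub_mem γ'.2.2.1 γ.2.2.1
      have hfx : f.tensor A x = 0 := by
        rw [hx, map_sub, sub_eq_zero]
        exact (congrArg Subtype.val hγ).symm
      have hdx : P.tensorD A x ∈ P.tensorFil A (n + 1) := by
        have e1 : P.curvature A γ.1 = 0 := γ.2.2.2
        have e2 : P.curvature A γ'.1 = 0 := γ'.2.2.2
        have e3 := curvature_add γ.2.1 hx1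
        rw [show γ.1 + x = γ'.1 by rw [hx]; abel, e1, e2, zero_add] at e3
        have e4 : P.tensorD A x = -(P.tensorBracket A γ.1 x
            + (2 : k)⁻¹ • P.tensorBracket A x x) := by
          rw [eq_neg_iff_add_eq_zero, ← add_assoc]
          exact e3.symm
        rw [e4]
        exact neg_mem (add_mem (tensorBracket_mem_tensorFil γ.2.2.1 hxn)
          (Submodule.smul_mem _ _ (tensorBracket_mem_tensorFil hxm hxn)))
      set ξ := -(s.rTensor A.carrier x) with hξ
      have hξ0 : ξ ∈ P.tensorDeg A 0 := by
        rw [hξ]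
        refine neg_mem ?_
        simpa using rTensor_mem_tensorDeg (r := -1)
          (fun i x hx => by simpa [sub_eq_add_neg] using hs i x hx) hx1
      have hξm : ξ ∈ P.tensorMax A := by
        rw [← tensorFil_one] at hxm ⊢
        exact neg_mem (rTensor_mem_tensorFil s hxm)
      have hξn : ξ ∈ P.tensorFil A n := neg_mem (rTensor_mem_tensorFil s hxn)
      have hfξ : f.tensor A ξ = 0 := by rw [hξ, map_neg, hfs', neg_zero]
      obtain ⟨N', γ₁, hN', hγ₁, hrel⟩ := exists_gaugeRel γ hξ0 hξm
      refine Relation.EqvGen.trans _ γ₁ _ (Relation.EqvGen.rel _ _ hrel) ?_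
      refine ih (n + 1) (by omega) γ₁ γ' ?_ ?_
      · rw [← hγ]
        apply Subtype.ext
        change f.tensor A γ₁.1 = f.tensor A γ.1
        rw [hγ₁, f.tensor_gauge, hfξ]
        simp [gauge]
      · -- `e ^ ξ · γ = γ - dξ` modulo `P ⊗ m ^ (n + 1)`, and `dξ = -x` there
        have hv : P.tensorBracket A ξ γ.1 - P.tensorD A ξ - x ∈ P.tensorFil A (n + 1) := by
          have : P.tensorBracket A ξ γ.1 - P.tensorD A ξ - x
              = P.tensorBracket A ξ γ.1 - s.rTensor A.carrier (P.tensorD A x) := by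
            rw [eq_sub_of_add_eq' (hds' x hfx), hξ, map_neg (P.tensorD A)]
            abel
          rw [this]
          exact sub_mem (gauge_gen_mem_fil hξ0 γ.2.1 hξn γ.2.2.1)
            (rTensor_mem_tensorFil s hdx)
        have hvn : P.tensorBracket A ξ γ.1 - P.tensorD A ξ ∈ P.tensorFil A n :=
          sub_mem (tensorFil_succ_le n (gauge_gen_mem_fil hξ0 γ.2.1 hξn γ.2.2.1))
            (tensorD_mem_tensorFil hξn)
        have hsum : P.gauge A (N' + 1) ξ γ.1 - γ.1 - x ∈ P.tensorFil A (n + 1) := by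
          have : P.gauge A (N' + 1) ξ γ.1 - γ.1 - x = (P.tensorBracket A ξ γ.1 - P.tensorD A ξ - x)
              + ∑ i ∈ Finset.range N', ((i + 1 + 1).factorial : k)⁻¹ •
                ((P.tensorBracket A ξ) ^ (i + 1))
                  (P.tensorBracket A ξ γ.1 - P.tensorD A ξ) := by
            rw [gauge, Finset.sum_range_succ']
            simp only [zero_add, Nat.factorial_one, Nat.cast_one, inv_one, pow_zero,
              Module.End.one_apply, one_smul]
            abel
          rw [this]
          refine add_mem hv (Submodule.sum_mem _ fun i _ => Submodule.smul_mem _ _ ?_)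
          have hi : ∀ i : ℕ, ((P.tensorBracket A ξ) ^ (i + 1))
              (P.tensorBracket A ξ γ.1 - P.tensorD A ξ) ∈ P.tensorFil A (n + 1) := by
            intro i
            induction i with
            | zero =>
              rw [zero_add, pow_one]
              exact tensorBracket_mem_tensorFil hξm hvn
            | succ i ih =>
              rw [pow_succ', Module.End.mul_apply]
              exact tensorFil_succ_le _ (tensorBracket_mem_tensorFil hξm ih)
          exact hi i
        have hg : P.gauge A (N' + 1) ξ γ.1 = γ₁.1 := by
          rw [hγ₁, gauge, gauge]
          congr 1
          exact sum_range_eq_of_pow_apply_eq_zero _ _ (by rw [pow_succ, hN']; simp)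
            (by rw [hN']; simp)
        rw [hg] at hsum
        have : γ'.1 - γ₁.1 = -(γ₁.1 - γ.1 - x) := by rw [hx]; abel
        rw [this]
        exact neg_mem hsum
  refine step N 0 (by omega) γ γ' h ?_
  have : ∀ z, z ∈ P.tensorFil A 0 := by
    intro z
    induction z using TensorProduct.induction_on with
    | zero => exact zero_mem _
    | add x y hx hy => exact add_mem hx hy
    | tmul x a => exact tmul_mem_tensorFil x ⟨a, by simp⟩
  exact this _

/-- An acyclic fibration induces a bijection of the gauge equivalence classes of Maurer-Cartan
elements. -/
theorem Hom.IsAcyclicFibration.bijective_defSet (hf : f.IsAcyclicFibration) :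
    Function.Bijective (Quot.map (f.mc A) f.mc_gaugeRel) := by
  constructor
  · have key : ∀ a b : L.MC A, Relation.EqvGen (L.gaugeRel A) a b → ∀ γ γ' : P.MC A,
        f.mc A γ = a → f.mc A γ' = b → Relation.EqvGen (P.gaugeRel A) γ γ' := by
      intro a b hab
      induction hab with
      | refl a =>
        intro γ γ' h h'
        exact hf.eqvGen_of_mc_eq γ γ' (h.trans h'.symm)
      | symm a b _ ih =>
        intro γ γ' h h'
        exact Relation.EqvGen.symm _ _ (ih γ' γ h' h)
      | trans a b c _ _ ih ih' =>
        intro γ γ' h h'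
        obtain ⟨β, hβ⟩ := hf.mc_surjective b
        exact Relation.EqvGen.trans _ _ _ (ih γ β h hβ) (ih' β γ' hβ h')
      | rel a b hab =>
        intro γ γ' h h'
        obtain ⟨ξ, hξ0, hξm, N, hN, hb⟩ := hab
        obtain ⟨σ, -, hσ, -, hfσ, -, -⟩ := hf.exists_contraction
        have hσm : σ.rTensor A.carrier ξ ∈ P.tensorMax A := by
          rw [← tensorFil_one] at hξm ⊢
          exact rTensor_mem_tensorFil σ hξm
        have hσ0 : σ.rTensor A.carrier ξ ∈ P.tensorDeg A 0 := by
          simpa using rTensor_mem_tensorDeg (r := 0) (fun i x hx => by simpa using hσ i x hx) hξ0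
        have hσξ : f.tensor A (σ.rTensor A.carrier ξ) = ξ := by
          rw [tensor, ← LinearMap.comp_apply, ← LinearMap.rTensor_comp, hfσ]
          simp
        obtain ⟨N', γ₁, hN', hγ₁, hrel⟩ := exists_gaugeRel γ hσ0 hσm
        refine Relation.EqvGen.trans _ γ₁ _ (Relation.EqvGen.rel _ _ hrel)
          (hf.eqvGen_of_mc_eq γ₁ γ' ?_)
        rw [h']
        apply Subtype.ext
        change f.tensor A γ₁.1 = b.1
        have hγa : f.tensor A γ.1 = a.1 := congrArg Subtype.val h
        rw [hγ₁, f.tensor_gauge, hσξ, hγa, hb, gauge]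
        congr 1
        refine sum_range_eq_of_pow_apply_eq_zero _ _ ?_ hN
        have hpow : ∀ (n : ℕ) (w), f.tensor A
            (((P.tensorBracket A (σ.rTensor A.carrier ξ)) ^ n) w)
            = ((L.tensorBracket A ξ) ^ n) (f.tensor A w) := by
          intro n w
          induction n with
          | zero => simp
          | succ n ih => rw [pow_succ', pow_succ', Module.End.mul_apply, Module.End.mul_apply,
              f.tensor_bracket, ih, hσξ]
        have := hpow N' (P.tensorBracket A (σ.rTensor A.carrier ξ) γ.1
          - P.tensorD A (σ.rTensor A.carrier ξ))
        rw [hN', LinearMap.zero_apply, map_zero, map_sub, f.tensor_bracket, f.tensor_d, hσξ,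
          hγa] at this
        exact this.symm
    intro x y hxy
    obtain ⟨γ, rfl⟩ := Quot.exists_rep x
    obtain ⟨γ', rfl⟩ := Quot.exists_rep y
    exact Quot.eqvGen_sound (key _ _ (Quot.eqvGen_exact hxy) γ γ' rfl rfl)
  · intro x
    obtain ⟨γ, rfl⟩ := Quot.exists_rep x
    obtain ⟨γ', rfl⟩ := hf.mc_surjective γ
    exact ⟨Quot.mk _ γ', rfl⟩

/-- An acyclic fibration induces an isomorphism of deformation functors. -/
theorem Hom.IsAcyclicFibration.isIso_extDefMap (hf : f.IsAcyclicFibration) :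
    IsIso f.extDefMap := by
  rw [NatTrans.isIso_iff_isIso_app]
  intro A
  exact (bijective_iff_isIso_ofHom _).1 hf.bijective_defSet

end DGLA

/-! ### Homomorphisms from the algebra of formal power series -/

section LinearFunctor

variable {k : Type u} [Field k] {V : Type u} [AddCommMonoid V] [Module k V]

/-- The linear maps of degree `0` from a graded vector space to the maximal ideal of a graded
Artin algebra. -/
def LinHom (gr : ℤ → Submodule k V) (A : GrArt k) : Type u :=
  {ψ : V →ₗ[k] A.carrier // (∀ i, ∀ v ∈ gr i, ψ v ∈ A.gr i) ∧ ∀ v, A.aug (ψ v) = 0}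

/-- The functor of linear maps of degree `0` to the maximal ideal. -/
def linFunctor (gr : ℤ → Submodule k V) : GrArt k ⥤ Type u where
  obj A := LinHom gr A
  map {A B} f := TypeCat.ofHom fun ψ : LinHom gr A =>
    (⟨(GrArt.alg f).toLinearMap ∘ₗ ψ.1, fun i v hv => GrArt.alg_mem f i _ (ψ.2.1 i v hv),
      fun v => (AlgHom.congr_fun (GrArt.aug_comp f) (ψ.1 v)).trans (ψ.2.2 v)⟩ : LinHom gr B)
  map_id A := by
    ext ψ
    rfl
  map_comp f g := by
    ext ψ
    rfl

variable (gr : ℤ → Submodule k V)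

/-- The map from the tensor algebra to the completed graded symmetric algebra. -/
def CompletedSym.ofTensor : TensorAlgebra k V →ₐ[k] CompletedSym gr :=
  (AlgHom.pi fun n => RingQuot.mkAlgHom k (TruncRel gr n)).codRestrict _ (by
    intro p n
    have : (TruncSym.proj gr n).comp (RingQuot.mkAlgHom k (TruncRel gr (n + 1)))
        = RingQuot.mkAlgHom k (TruncRel gr n) := by
      apply AlgHom.ext
      intro x
      rw [TruncSym.proj, AlgHom.comp_apply, RingQuot.liftAlgHom_mkAlgHom_apply]
    exact AlgHom.congr_fun this p)

theorem CompletedSym.ofTensor_apply (p : TensorAlgebra k V) (n : ℕ) :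
    (CompletedSym.ofTensor gr p).1 n = RingQuot.mkAlgHom k (TruncRel gr n) p := rfl

theorem CompletedSym.apply_eq_zero_of_le (s : CompletedSym gr) {m n : ℕ} (hmn : m ≤ n)
    (h : s.1 n = 0) : s.1 m = 0 := by
  induction n, hmn using Nat.le_induction with
  | base => exact h
  | succ n _ ih =>
    apply ih
    rw [← s.2 n, h, map_zero]

variable {gr}

theorem ContHom.aug_eq_zero {A : GrArt k} (φ : ContHom gr A) (v : V) :
    A.aug (φ.1 (CompletedSym.ofTensor gr (TensorAlgebra.ι k v))) = 0 := by
  obtain ⟨N, hN⟩ := φ.2.1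
  refine eq_zero_of_pow_eq_zero (n := N) ?_
  rw [← map_pow, ← map_pow, ← map_pow, hN, map_zero]
  rw [CompletedSym.ofTensor_apply]
  have := RingQuot.mkAlgHom_rel k (TruncRel.kill (gr := gr) (List.replicate N v)
    List.length_replicate)
  simpa using this

/-- The restriction of a homomorphism to the linear coordinates. -/
def ContHom.toLin {A : GrArt k} (φ : ContHom gr A) : LinHom gr A :=
  ⟨φ.1.toLinearMap ∘ₗ (CompletedSym.ofTensor gr).toLinearMap ∘ₗ TensorAlgebra.ι k,
    fun i v hv => φ.2.2 i _ fun n => Submodule.subset_span ⟨[(i, v)], by simpa using hv,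
      by simp, by simp [CompletedSym.ofTensor_apply]⟩,
    fun v => φ.aug_eq_zero v⟩

theorem ContHom.toLin_injective {A : GrArt k} :
    Function.Injective (ContHom.toLin : ContHom gr A → LinHom gr A) := by
  intro φ φ' h
  obtain ⟨N, hN⟩ := φ.2.1
  obtain ⟨N', hN'⟩ := φ'.2.1
  have hcomp : φ.1.comp (CompletedSym.ofTensor gr) = φ'.1.comp (CompletedSym.ofTensor gr) :=
    TensorAlgebra.hom_ext (congrArg Subtype.val h)
  apply Subtype.ext
  apply AlgHom.ext
  intro s
  obtain ⟨p, hp⟩ := RingQuot.mkAlgHom_surjective k (TruncRel gr (max N N')) (s.1 (max N N'))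
  have hs : (s + (-1 : k) • CompletedSym.ofTensor gr p).1 (max N N') = 0 := by
    change s.1 (max N N') + (-1 : k) • (CompletedSym.ofTensor gr p).1 (max N N') = 0
    rw [CompletedSym.ofTensor_apply, hp]
    nth_rewrite 1 [← one_smul k (s.1 (max N N'))]
    rw [← add_smul, add_neg_cancel, zero_smul]
  have h1 := hN _ (CompletedSym.apply_eq_zero_of_le gr _ (le_max_left N N') hs)
  have h2 := hN' _ (CompletedSym.apply_eq_zero_of_le gr _ (le_max_right N N') hs)
  rw [map_add, map_smul, neg_one_smul, add_neg_eq_zero] at h1 h2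
  rw [h1, h2]
  exact AlgHom.congr_fun hcomp p

theorem prod_mem_ker_pow (A : GrArt k) (l : List A.carrier) (hl : ∀ a ∈ l, A.aug a = 0) :
    l.prod ∈ (RingHom.ker A.aug) ^ l.length := by
  induction l with
  | nil => exact ⟨1, by simp⟩
  | cons a l ih =>
    have ha : a ∈ RingHom.ker A.aug := hl a (by simp)
    rcases Nat.eq_zero_or_pos l.length with h0 | h0
    · rw [List.length_eq_zero_iff.1 h0]
      simpa [Submodule.pow_one] using ha
    · rw [List.prod_cons, List.length_cons, Submodule.pow_succ' _ h0.ne']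
      exact Submodule.mul_mem_mul ha (ih fun b hb => hl b (by simp [hb]))

theorem ContHom.toLin_surjective {A : GrArt k} :
    Function.Surjective (ContHom.toLin : ContHom gr A → LinHom gr A) := by
  intro ψ
  obtain ⟨N, hN⟩ := A.nilpotent
  have hlift : ∀ l : List V, TensorAlgebra.lift k ψ.1 (l.map (TensorAlgebra.ι k)).prod
      = (l.map ψ.1).prod := by
    intro l
    rw [map_list_prod, List.map_map]
    congr 1
    refine List.map_congr_left fun v _ => ?_
    simp
  let φ₀ : TruncSym gr N →ₐ[k] A.carrier :=
    RingQuot.liftAlgHom k ⟨TensorAlgebra.lift k ψ.1, by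
      intro x y h
      cases h with
      | swap i j v w hv hw =>
        have := A.graded_comm i j _ (ψ.2.1 i v hv) _ (ψ.2.1 j w hw)
        rw [Units.smul_def, map_zsmul, map_mul, map_mul]
        simpa [Units.smul_def] using this
      | kill l hl =>
        rw [hlift, map_zero]
        have := prod_mem_ker_pow A (l.map ψ.1) (by
          intro a ha
          obtain ⟨v, -, rfl⟩ := List.mem_map.1 ha
          exact ψ.2.2 v)
        rw [List.length_map, hl, hN] at this
        exact this⟩
  have hφ₀ : ∀ p, φ₀ (RingQuot.mkAlgHom k (TruncRel gr N) p) = TensorAlgebra.lift k ψ.1 p :=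
    fun p => RingQuot.liftAlgHom_mkAlgHom_apply _ _ _ _
  let φ : CompletedSym gr →ₐ[k] A.carrier :=
    φ₀.comp ((Pi.evalAlgHom k _ N).comp (CompletedSym gr).val)
  have hφ : ∀ s : CompletedSym gr, φ s = φ₀ (s.1 N) := fun s => rfl
  refine ⟨⟨φ, ⟨N, fun s hs => by rw [hφ, hs, map_zero]⟩, ?_⟩, ?_⟩
  · intro d s hs
    rw [hφ]
    refine Submodule.span_induction (p := fun z _ => φ₀ z ∈ A.gr d) ?_ (by simp) ?_ ?_ (hs N)
    · rintro _ ⟨l, hl, hd, rfl⟩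
      rw [hφ₀]
      have := hlift (l.map Prod.snd)
      rw [List.map_map, List.map_map] at this
      refine (congrArg (· ∈ A.gr d) this).mpr ?_
      rw [← hd]
      clear this hd hs
      induction l with
      | nil => simpa using SetLike.one_mem_graded A.gr
      | cons p l ih =>
        simp only [List.map_cons, List.prod_cons, List.sum_cons]
        exact SetLike.mul_mem_graded (ψ.2.1 _ _ (hl p (by simp)))
          (ih fun q hq => hl q (by simp [hq]))
    · intro x y _ _ hx hy
      rw [map_add]
      exact add_mem hx hy
    · intro c x _ hx
      rw [map_smul]
      exact Submodule.smul_mem _ c hx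
  · apply Subtype.ext
    apply LinearMap.ext
    intro v
    change φ₀ ((CompletedSym.ofTensor gr (TensorAlgebra.ι k v)).1 N) = ψ.1 v
    rw [CompletedSym.ofTensor_apply, hφ₀, TensorAlgebra.lift_ι_apply]

variable (gr) in
/-- A continuous homomorphism from the algebra of formal power series is determined by its values
on the linear coordinates, which are arbitrary. -/
def proRepIsoLin : proRep gr ≅ linFunctor gr :=
  NatIso.ofComponents
    (fun A => (Equiv.ofBijective (ContHom.toLin : ContHom gr A → LinHom gr A)
      ⟨ContHom.toLin_injective, ContHom.toLin_surjective⟩).toIso)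
    (fun f => by
      ext φ
      rfl)

end LinearFunctor

/-! ### The deformation functor of an abelian DGLA with zero differential -/

namespace DGLA

variable {k : Type u} [Field k]

/-- A graded Artin algebra vanishes in almost all degrees. -/
theorem _root_.GrArt.finite_degrees (A : GrArt k) : {i | A.gr i ≠ ⊥}.Finite := by
  have := A.finite
  exact WellFoundedGT.finite_ne_bot_of_iSupIndep A.isInternal.submodule_iSupIndep

variable {N : DGLA k} {gr' : ℤ → Submodule k N.carrier}

/-- The contraction of `N ⊗ A` with a linear form on `N`. -/
def contract (A : GrArt k) (l : Module.Dual k N.carrier) :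
    N.carrier ⊗[k] A.carrier →ₗ[k] A.carrier :=
  (TensorProduct.lid k A.carrier).toLinearMap ∘ₗ l.rTensor A.carrier

theorem contract_tmul (A : GrArt k) (l : Module.Dual k N.carrier) (x : N.carrier)
    (a : A.carrier) : contract A l (x ⊗ₜ a) = l x • a := by
  simp [contract]

/-- A linear form on a graded piece, extended by zero. -/
def extendForm (hi : DirectSum.IsInternal gr') (i : ℤ) :
    Module.Dual k (gr' i) →ₗ[k] Module.Dual k N.carrier :=
  LinearMap.lcomp k k ((gradeProj hi i).codRestrict (gr' i) (gradeProj_mem hi i))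

theorem extendForm_of_mem (hi : DirectSum.IsInternal gr') (i : ℤ) (l : Module.Dual k (gr' i))
    {x : N.carrier} (hx : x ∈ gr' i) : extendForm hi i l x = l ⟨x, hx⟩ := by
  change l _ = l _
  congr 1
  exact Subtype.ext (gradeProj_of_mem hi hx)

theorem extendForm_of_ne (hi : DirectSum.IsInternal gr') {i j : ℤ} (l : Module.Dual k (gr' i))
    {x : N.carrier} (hx : x ∈ gr' j) (hij : j ≠ i) : extendForm hi i l x = 0 := by
  change l _ = 0
  rw [← map_zero l]
  congr 1
  exact Subtype.ext (gradeProj_of_ne hi hx hij)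

theorem eq_zero_of_contract (hi : DirectSum.IsInternal gr') (A : GrArt k)
    (z : N.carrier ⊗[k] A.carrier)
    (h : ∀ i l, contract A (extendForm hi i l) z = 0) : z = 0 := by
  let b := Module.Free.chooseBasis k A.carrier
  let e := TensorProduct.equivFinsuppOfBasisRight (M := N.carrier) b
  have key : ∀ (l : Module.Dual k N.carrier) (z) (j), b.repr (contract A l z) j = l (e z j) := by
    intro l z j
    induction z using TensorProduct.induction_on with
    | zero => simp
    | add x y hx hy => simp [hx, hy]
    | tmul x a => simp [contract_tmul, e, mul_comm]
  rw [← e.map_eq_zero_iff]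
  ext j
  refine eq_zero_of_gradeProj hi fun i => ?_
  have hx : ∀ l : Module.Dual k (gr' i), l ⟨_, gradeProj_mem hi i (e z j)⟩ = 0 := by
    intro l
    have := key (extendForm hi i l) z j
    rw [h i l, map_zero] at this
    exact this.symm
  exact congrArg Subtype.val ((Module.forall_dual_apply_eq_zero_iff k _).1 hx)

/-- The linear map from the graded dual of `N` to `A` that an element of `N ⊗ A` defines. -/
def gradedDualMap (hi : DirectSum.IsInternal gr') (A : GrArt k)
    (z : N.carrier ⊗[k] A.carrier) : GradedDual gr' →ₗ[k] A.carrier :=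
  DirectSum.toModule k ℤ A.carrier fun i =>
    { toFun := fun l => contract A (extendForm hi i l) z
      map_add' := fun l l' => by simp [contract, LinearMap.rTensor_add]
      map_smul' := fun c l => by simp [contract, LinearMap.rTensor_smul] }

theorem gradedDualMap_lof (hi : DirectSum.IsInternal gr') (A : GrArt k)
    (z : N.carrier ⊗[k] A.carrier) (i : ℤ) (l : Module.Dual k (gr' i)) :
    gradedDualMap hi A z (DirectSum.lof k ℤ (fun i => Module.Dual k (gr' i)) i l)
      = contract A (extendForm hi i l) z :=
  DirectSum.toModule_lof _ _ _

theorem gradedDualMap_mem (hgr : ∀ i, N.gr i = gr' (i - 1)) (hi : DirectSum.IsInternal gr')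
    {A : GrArt k} {z} (hz : z ∈ N.tensorDeg A 1) (i : ℤ) (v : GradedDual gr')
    (hv : v ∈ GradedDual.deg gr' i) : gradedDualMap hi A z v ∈ A.gr i := by
  obtain ⟨l, rfl⟩ := hv
  rw [gradedDualMap_lof]
  refine tensorDeg_induction N A (p := fun z => contract A (extendForm hi (-i) l) z ∈ A.gr i)
    (by simp) ?_ ?_ ?_ hz
  · intro x y hx hy
    rw [map_add]
    exact add_mem hx hy
  · intro c x hx
    rw [map_smul]
    exact Submodule.smul_mem _ c hx
  · intro j m hjm x hx a ha
    rw [contract_tmul]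
    rw [hgr] at hx
    by_cases hj : j - 1 = -i
    · have hm : m = i := by omega
      rw [hm] at ha
      exact Submodule.smul_mem _ _ ha
    · rw [extendForm_of_ne hi l hx hj, zero_smul]
      exact zero_mem _

theorem aug_gradedDualMap (hi : DirectSum.IsInternal gr')
    {A : GrArt k} {z} (hz : z ∈ N.tensorMax A) (v : GradedDual gr') :
    A.aug (gradedDualMap hi A z v) = 0 := by
  have h1 : ∀ (l : Module.Dual k N.carrier) (z : N.carrier ⊗[k] A.carrier), A.aug (contract A l z)
      = l (TensorProduct.rid k N.carrier (A.aug.toLinearMap.lTensor N.carrier z)) := by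
    intro l z
    induction z using TensorProduct.induction_on with
    | zero => simp
    | add x y hx hy => simp only [map_add, hx, hy]
    | tmul x a => simp [contract_tmul, mul_comm]
  induction v using DirectSum.induction_on with
  | zero => simp
  | of i l =>
    have := gradedDualMap_lof hi A z i l
    rw [DirectSum.lof_eq_of] at this
    rw [this, h1, show A.aug.toLinearMap.lTensor N.carrier z = 0 from hz]
    simp
  | add x y hx hy => rw [map_add, map_add, hx, hy, add_zero]

theorem gradedDualMap_injective (hi : DirectSum.IsInternal gr') (A : GrArt k)
    {z z' : N.carrier ⊗[k] A.carrier} (h : gradedDualMap hi A z = gradedDualMap hi A z') :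
    z = z' := by
  rw [← sub_eq_zero]
  refine eq_zero_of_contract hi A _ fun i l => ?_
  rw [map_sub, ← gradedDualMap_lof, ← gradedDualMap_lof, h, sub_self]

theorem gradedDualMap_surjective (hgr : ∀ i, N.gr i = gr' (i - 1))
    (hi : DirectSum.IsInternal gr') (hfin : ∀ i, Module.Finite k (gr' i))
    {A : GrArt k} (ψ : LinHom (GradedDual.deg gr') A) :
    ∃ z, z ∈ N.tensorDeg A 1 ∧ z ∈ N.tensorMax A ∧ gradedDualMap hi A z = ψ.1 := by
  classical
  have hS : {i | A.gr (-i) ≠ ⊥}.Finite := A.finite_degrees.preimage neg_injective.injOn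
  let b := fun i => Module.Free.chooseBasis k (gr' i)
  let lof := fun i => DirectSum.lof k ℤ (fun i => Module.Dual k (gr' i)) i
  have hψ : ∀ i l, ψ.1 (lof i l) ∈ A.gr (-i) := fun i l => by
    refine ψ.2.1 (-i) _ ⟨cast (by rw [neg_neg]) l, ?_⟩
    have : ∀ j (e : j = i) (h : Module.Dual k (gr' i) = Module.Dual k (gr' j)),
        lof j (cast h l) = lof i l := by
      rintro j rfl h
      rfl
    exact this _ (neg_neg i) _
  refine ⟨∑ i ∈ hS.toFinset, ∑ j, (b i j : N.carrier) ⊗ₜ ψ.1 (lof i ((b i).coord j)), ?_, ?_, ?_⟩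
  · refine Submodule.sum_mem _ fun i _ => Submodule.sum_mem _ fun j _ => ?_
    refine tmul_mem_tensorDeg (i := i + 1) (j := -i) (by ring) ?_ (hψ i _)
    rw [hgr, add_sub_cancel_right]
    exact (b i j).2
  · refine Submodule.sum_mem _ fun i _ => Submodule.sum_mem _ fun j _ => ?_
    rw [tensorMax, LinearMap.mem_ker, LinearMap.lTensor_tmul]
    exact (congrArg (_ ⊗ₜ[k] ·) (ψ.2.2 _)).trans (TensorProduct.tmul_zero _ _)
  · refine DirectSum.linearMap_ext _ fun i => LinearMap.ext fun l => ?_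
    rw [LinearMap.comp_apply, LinearMap.comp_apply, gradedDualMap_lof, map_sum]
    simp only [map_sum, contract_tmul]
    have hsum : ∑ j, extendForm hi i l (b i j) • ψ.1 (lof i ((b i).coord j)) = ψ.1 (lof i l) := by
      simp only [← map_smul, ← map_sum]
      congr 2
      refine (b i).ext fun m => ?_
      simp only [extendForm_of_mem hi i l (b i _).2, LinearMap.sum_apply, LinearMap.smul_apply,
        Module.Basis.coord_apply, Module.Basis.repr_self]
      rw [Finset.sum_eq_single m]
      · simp
      · intro j _ hj
        simp [Ne.symm hj]
      · simp
    have hne : ∀ i', i' ≠ i →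
        ∑ j, extendForm hi i l (b i' j) • ψ.1 (lof i' ((b i').coord j)) = 0 := by
      intro i' hi'
      refine Finset.sum_eq_zero fun j _ => ?_
      rw [extendForm_of_ne hi l (b i' j).2 hi', zero_smul]
    by_cases hiS : i ∈ hS.toFinset
    · rw [Finset.sum_eq_single i (fun i' _ => hne i') (fun h => absurd hiS h), hsum]
    · rw [Finset.sum_eq_zero fun i' h' => hne i' fun e => hiS (e ▸ h')]
      have hbot : A.gr (-i) = ⊥ := by simpa using hiS
      have := hψ i l
      rw [hbot] at this
      exact (this : ψ.1 (lof i l) = 0).symm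

variable (N) in
/-- The deformation functor of an abelian DGLA `N` with zero differential and finite-dimensional
graded pieces is the functor of linear maps on the graded dual of `N`. -/
theorem extDef_iso_linFunctor_of_abelian (hd : N.d = 0) (hb : N.bracket = 0)
    (hgr : ∀ i, N.gr i = gr' (i - 1)) (hi : DirectSum.IsInternal gr')
    (hfin : ∀ i, Module.Finite k (gr' i)) :
    Nonempty (N.extDef ≅ linFunctor (GradedDual.deg gr')) := by
  have hD : ∀ A : GrArt k, N.tensorD A = 0 := fun A => by simp [tensorD, hd]
  have hB : ∀ A : GrArt k, N.tensorBracket A = 0 := fun A => by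
    ext
    simp [tensorBracket, hb]
  have hrel : ∀ (A : GrArt k) (γ γ' : N.MC A), N.gaugeRel A γ γ' → γ' = γ := by
    rintro A γ γ' ⟨ξ, -, -, M, -, h⟩
    apply Subtype.ext
    rw [h]
    simp [hD, hB]
  let F : ∀ A : GrArt k, N.MC A → LinHom (GradedDual.deg gr') A := fun A γ =>
    ⟨gradedDualMap hi A γ.1, gradedDualMap_mem hgr hi γ.2.1, aug_gradedDualMap hi γ.2.2.1⟩
  let G : ∀ A : GrArt k, N.DefSet A → LinHom (GradedDual.deg gr') A := fun A =>
    Quot.lift (F A) fun γ γ' h => by rw [hrel A γ γ' h]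
  have hG : ∀ A, Function.Bijective (G A) := by
    intro A
    constructor
    · intro x y hxy
      obtain ⟨γ, rfl⟩ := Quot.exists_rep x
      obtain ⟨γ', rfl⟩ := Quot.exists_rep y
      exact congrArg _ (Subtype.ext (gradedDualMap_injective hi A (congrArg Subtype.val hxy)))
    · intro ψ
      obtain ⟨z, h1, hm, hz⟩ := gradedDualMap_surjective hgr hi hfin ψ
      exact ⟨Quot.mk _ ⟨z, h1, hm, by simp [hD, hB]⟩, Subtype.ext hz⟩
  refine ⟨NatIso.ofComponents (fun A => (Equiv.ofBijective (G A) (hG A)).toIso) fun {A B} f => ?_⟩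
  ext x
  obtain ⟨γ, rfl⟩ := Quot.exists_rep x
  refine Subtype.ext ?_
  change gradedDualMap hi B (N.tensorMap f γ.1)
    = (GrArt.alg f).toLinearMap ∘ₗ gradedDualMap hi A γ.1
  refine DirectSum.linearMap_ext _ fun i => LinearMap.ext fun l => ?_
  rw [LinearMap.comp_apply, LinearMap.comp_apply, LinearMap.comp_apply, gradedDualMap_lof,
    gradedDualMap_lof]
  have : contract B (extendForm hi i l) ∘ₗ N.tensorMap f
      = (GrArt.alg f).toLinearMap ∘ₗ contract A (extendForm hi i l) := by
    ext x a
    simp [contract, tensorMap]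
  exact LinearMap.congr_fun this γ.1

variable (N) in
/-- The deformation functor of an abelian DGLA with zero differential is smooth. -/
theorem isSmoothFunctor_of_abelian (hd : N.d = 0) (hb : N.bracket = 0) :
    IsSmoothFunctor N.extDef := by
  intro A B f hf x
  obtain ⟨γ, rfl⟩ := Quot.exists_rep x
  have hD : N.tensorD A = 0 := by simp [tensorD, hd]
  have hB : N.tensorBracket A = 0 := by
    ext
    simp [tensorBracket, hb]
  have hlift : ∀ (i : ℤ), ∀ b ∈ B.gr i, ∃ a ∈ A.gr i, GrArt.alg f a = b := by
    intro i b hb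
    obtain ⟨a, ha⟩ := hf b
    refine ⟨gradeProj A.isInternal i a, gradeProj_mem _ _ _, ?_⟩
    have := map_gradeProj A.isInternal B.isInternal (f := (GrArt.alg f).toLinearMap) (r := 0)
      (fun i x hx => by simpa using GrArt.alg_mem f i x hx) i a
    rw [add_zero] at this
    refine this.trans ?_
    rw [AlgHom.toLinearMap_apply, ha, gradeProj_of_mem _ hb]
  obtain ⟨z, hz, hzγ⟩ : ∃ z ∈ N.tensorDeg A 1, N.tensorMap f z = γ.1 := by
    refine tensorDeg_induction N B
      (p := fun w => ∃ z ∈ N.tensorDeg A 1, N.tensorMap f z = w) ⟨0, zero_mem _, map_zero _⟩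
      ?_ ?_ ?_ γ.2.1
    · rintro x y ⟨z, hz, rfl⟩ ⟨z', hz', rfl⟩
      exact ⟨z + z', add_mem hz hz', map_add _ _ _⟩
    · rintro c x ⟨z, hz, rfl⟩
      exact ⟨c • z, Submodule.smul_mem _ c hz, map_smul _ _ _⟩
    · intro i j hij x hx b hb
      obtain ⟨a, ha, rfl⟩ := hlift j b hb
      exact ⟨x ⊗ₜ a, tmul_mem_tensorDeg hij hx ha, rfl⟩
  have hzm : z ∈ N.tensorMax A := by
    have h1 : A.aug.toLinearMap.lTensor N.carrier z
        = B.aug.toLinearMap.lTensor N.carrier (N.tensorMap f z) := by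
      rw [← GrArt.aug_comp f, tensorMap, ← LinearMap.comp_apply, ← LinearMap.lTensor_comp]
      rfl
    rw [tensorMax, LinearMap.mem_ker, h1, hzγ]
    exact γ.2.2.1
  exact ⟨Quot.mk _ ⟨z, hz, hzm, by simp [hD, hB]⟩, congrArg (Quot.mk _) (Subtype.ext hzγ)⟩

end DGLA

theorem IsSmoothFunctor.of_iso {k : Type u} [Field k] {F G : GrArt k ⥤ Type u} (e : F ≅ G)
    (hG : IsSmoothFunctor G) : IsSmoothFunctor F := by
  intro A B f hf x
  obtain ⟨y, hy⟩ := hG f hf (e.hom.app B x)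
  refine ⟨e.inv.app A y, ?_⟩
  have h1 : F.map f (e.inv.app A y) = e.inv.app B (G.map f y) :=
    (NatTrans.naturality_apply e.inv f y).symm
  rw [h1, hy]
  exact e.hom_inv_id_app_apply B x

/-! ### Power series in graded letters, as functions on words -/

section GradeSign

variable {k : Type u} [Field k] {C : Type u} [Ring C] [Algebra k C]
  (𝒞 : ℤ → Submodule k C) [GradedAlgebra 𝒞]

/-- Multiplication by `(-1) ^ (d i)` in degree `i`: the sign of an element of degree `d` that
passes the argument. -/
def gradeSign (d : ℤ) : C →ₗ[k] C :=
  gradeScale (DirectSum.Decomposition.isInternal 𝒞) (fun i => ((d * i).negOnePow : ℤ))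

variable {𝒞}

theorem gradeSign_of_mem (d : ℤ) {i : ℤ} {a : C} (ha : a ∈ 𝒞 i) :
    gradeSign 𝒞 d a = (d * i).negOnePow • a := gradeScale_of_mem _ _ ha

theorem gradeSign_mul (d : ℤ) (a b : C) :
    gradeSign 𝒞 d (a * b) = gradeSign 𝒞 d a * gradeSign 𝒞 d b := by
  refine grade_induction (DirectSum.Decomposition.isInternal 𝒞) (p := fun a =>
    gradeSign 𝒞 d (a * b) = gradeSign 𝒞 d a * gradeSign 𝒞 d b) (by simp) ?_ ?_ a
  · intro x y hx hy
    simp only [add_mul, map_add, hx, hy]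
  intro i a ha
  refine grade_induction (DirectSum.Decomposition.isInternal 𝒞) (p := fun b =>
    gradeSign 𝒞 d (a * b) = gradeSign 𝒞 d a * gradeSign 𝒞 d b) (by simp) ?_ ?_ b
  · intro x y hx hy
    simp only [mul_add, map_add, hx, hy]
  intro j b hb
  rw [gradeSign_of_mem d ha, gradeSign_of_mem d hb,
    gradeSign_of_mem d (SetLike.mul_mem_graded ha hb), smul_mul_smul_comm, ← Int.negOnePow_add,
    mul_add]

theorem gradeSign_one (d : ℤ) : gradeSign 𝒞 d 1 = 1 := by
  rw [gradeSign_of_mem d (SetLike.one_mem_graded 𝒞), mul_zero, Int.negOnePow_zero, one_smul]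

theorem map_gradeSign {C' : Type u} [Ring C'] [Algebra k C'] {𝒞' : ℤ → Submodule k C'}
    [GradedAlgebra 𝒞'] {f : C →ₗ[k] C'} {r : ℤ} (hf : ∀ i, ∀ a ∈ 𝒞 i, f a ∈ 𝒞' (i + r)) (d : ℤ)
    (a : C) : f (gradeSign 𝒞 d a) = (d * r).negOnePow • gradeSign 𝒞' d (f a) := by
  refine grade_induction (DirectSum.Decomposition.isInternal 𝒞) (p := fun a =>
    f (gradeSign 𝒞 d a) = (d * r).negOnePow • gradeSign 𝒞' d (f a)) (by simp) ?_ ?_ a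
  · intro x y hx hy
    simp only [map_add, hx, hy, smul_add]
  intro i a ha
  rw [gradeSign_of_mem d ha, gradeSign_of_mem d (hf i a ha), map_zunit_smul, smul_smul,
    ← Int.negOnePow_add]
  congr 1
  rw [Int.negOnePow_eq_iff]
  simp only [parity_simps]
  grind

theorem gradeSign_mem (d : ℤ) {i : ℤ} {a : C} (ha : a ∈ 𝒞 i) : gradeSign 𝒞 d a ∈ 𝒞 i := by
  rw [gradeSign_of_mem d ha]
  exact zunit_smul_mem _ _ ha

theorem gradeSign_comm (d e : ℤ) (a : C) :
    gradeSign 𝒞 d (gradeSign 𝒞 e a) = gradeSign 𝒞 e (gradeSign 𝒞 d a) := by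
  have := map_gradeSign (𝒞' := 𝒞) (f := gradeSign 𝒞 d) (r := 0) (fun i a ha => by
    rw [add_zero]
    exact gradeSign_mem d ha) e a
  simpa using this

end GradeSign

/-- The functions on the words in letters `i` of degree `deg i`, with values in `C`. Such a
function is regarded as a power series, its value at `i₁ ⋯ iₙ` being the iterated derivative
`∂_{iₙ} ⋯ ∂_{i₁}` at the origin. The derivations `∂_i` need not commute. -/
def Words {k : Type u} [Field k] {C : Type u} [Ring C] [Algebra k C]
    (𝒞 : ℤ → Submodule k C) [GradedAlgebra 𝒞] {ι : Type u} (_deg : ι → ℤ) : Type u :=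
  List ι → C

namespace Words

variable {k : Type u} [Field k] {C : Type u} [Ring C] [Algebra k C]
  {𝒞 : ℤ → Submodule k C} [GradedAlgebra 𝒞] {ι : Type u} {deg : ι → ℤ}

instance : AddCommGroup (Words 𝒞 deg) := inferInstanceAs (AddCommGroup (List ι → C))
instance : Module k (Words 𝒞 deg) := inferInstanceAs (Module k (List ι → C))

@[ext]
theorem ext {φ ψ : Words 𝒞 deg} (h : ∀ w, φ w = ψ w) : φ = ψ := funext h

theorem zero_apply (w : List ι) : (0 : Words 𝒞 deg) w = 0 := rfl
theorem add_apply (φ ψ : Words 𝒞 deg) (w : List ι) : (φ + ψ) w = φ w + ψ w := rfl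
theorem smul_apply (c : k) (φ : Words 𝒞 deg) (w : List ι) : (c • φ) w = c • φ w := rfl
theorem zunit_apply (c : ℤˣ) (φ : Words 𝒞 deg) (w : List ι) : (c • φ) w = c • φ w := rfl

/-- The degree of a word. -/
def wordDeg (deg : ι → ℤ) (w : List ι) : ℤ := (w.map deg).sum

theorem wordDeg_nil : wordDeg deg [] = 0 := rfl
theorem wordDeg_cons (i : ι) (w : List ι) : wordDeg deg (i :: w) = deg i + wordDeg deg w := by
  simp [wordDeg]

/-- The right derivation `∂_i`. -/
def der (i : ι) : Words 𝒞 deg →ₗ[k] Words 𝒞 deg where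
  toFun φ := fun w => φ (i :: w)
  map_add' _ _ := rfl
  map_smul' _ _ := rfl

theorem der_apply (i : ι) (φ : Words 𝒞 deg) (w : List ι) : der i φ w = φ (i :: w) := rfl

/-- A linear map on the coefficients, applied pointwise. -/
def lift {C' : Type u} [Ring C'] [Algebra k C'] {𝒞' : ℤ → Submodule k C'} [GradedAlgebra 𝒞']
    (f : C →ₗ[k] C') : Words 𝒞 deg →ₗ[k] Words 𝒞' deg where
  toFun φ := fun w => f (φ w)
  map_add' _ _ := funext fun _ => map_add _ _ _
  map_smul' _ _ := funext fun _ => map_smul _ _ _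

/-- The sign of an element of degree `d` that passes the argument. The letters have to be
counted with their degrees, since the coefficient of `w` in a power series of degree `n` has
degree `n + deg w`. -/
def sign (d : ℤ) : Words 𝒞 deg →ₗ[k] Words 𝒞 deg where
  toFun φ := fun w => (d * wordDeg deg w).negOnePow • gradeSign 𝒞 d (φ w)
  map_add' φ ψ := funext fun w =>
    (congrArg _ (map_add (gradeSign 𝒞 d) (φ w) (ψ w))).trans (smul_add _ _ _)
  map_smul' c φ := funext fun w =>
    (congrArg _ (map_smul (gradeSign 𝒞 d) c (φ w))).trans (smul_comm _ _ _)

theorem sign_apply (d : ℤ) (φ : Words 𝒞 deg) (w : List ι) :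
    sign d φ w = (d * wordDeg deg w).negOnePow • gradeSign 𝒞 d (φ w) := rfl

theorem lift_apply {C' : Type u} [Ring C'] [Algebra k C'] {𝒞' : ℤ → Submodule k C'}
    [GradedAlgebra 𝒞'] (f : C →ₗ[k] C') (φ : Words 𝒞 deg) (w : List ι) :
    (lift f φ : Words 𝒞' deg) w = f (φ w) := rfl

theorem der_lift {C' : Type u} [Ring C'] [Algebra k C'] {𝒞' : ℤ → Submodule k C'}
    [GradedAlgebra 𝒞'] (f : C →ₗ[k] C') (i : ι) (φ : Words 𝒞 deg) :
    der i (lift f φ : Words 𝒞' deg) = lift f (der i φ) := rfl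

theorem der_sign (d : ℤ) (i : ι) (φ : Words 𝒞 deg) :
    der i (sign d φ) = (d * deg i).negOnePow • sign d (der i φ) := by
  ext w
  rw [zunit_apply, der_apply, sign_apply, sign_apply, der_apply, wordDeg_cons, mul_add,
    Int.negOnePow_add, mul_smul]

theorem sign_comm (d e : ℤ) (φ : Words 𝒞 deg) : sign d (sign e φ) = sign e (sign d φ) := by
  ext w
  simp only [sign_apply, map_zunit_smul]
  rw [gradeSign_comm, smul_comm]

theorem lift_sign {C' : Type u} [Ring C'] [Algebra k C'] {𝒞' : ℤ → Submodule k C'}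
    [GradedAlgebra 𝒞'] {f : C →ₗ[k] C'} {r : ℤ} (hf : ∀ i, ∀ a ∈ 𝒞 i, f a ∈ 𝒞' (i + r)) (d : ℤ)
    (φ : Words 𝒞 deg) :
    (lift f (sign d φ) : Words 𝒞' deg) = (d * r).negOnePow • sign d (lift f φ) := by
  ext w
  simp only [lift_apply, sign_apply, zunit_apply, map_zunit_smul, map_gradeSign hf]
  rw [smul_comm]

/-- The coefficient of a word in a product, by recursion on the word and the Leibniz rule for
`∂_i`. -/
def conv : List ι → Words 𝒞 deg → Words 𝒞 deg → C
  | [], φ, ψ => φ [] * ψ []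
  | i :: w, φ, ψ => conv w φ (der i ψ) + conv w (der i φ) (sign (deg i) ψ)

instance : Mul (Words 𝒞 deg) := ⟨fun φ ψ w => conv w φ ψ⟩

theorem mul_nil (φ ψ : Words 𝒞 deg) : (φ * ψ) [] = φ [] * ψ [] := rfl

theorem der_mul (i : ι) (φ ψ : Words 𝒞 deg) :
    der i (φ * ψ) = φ * der i ψ + der i φ * sign (deg i) ψ := rfl

theorem mul_cons (φ ψ : Words 𝒞 deg) (i : ι) (w : List ι) :
    (φ * ψ) (i :: w) = (φ * der i ψ) w + (der i φ * sign (deg i) ψ) w := rfl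

protected theorem add_mul (φ φ' ψ : Words 𝒞 deg) : (φ + φ') * ψ = φ * ψ + φ' * ψ := by
  ext w
  induction w generalizing φ φ' ψ with
  | nil => exact add_mul _ _ _
  | cons i w ih =>
    rw [add_apply, mul_cons, mul_cons, mul_cons, map_add, ih, ih, add_apply, add_apply]
    abel

protected theorem mul_add (φ ψ ψ' : Words 𝒞 deg) : φ * (ψ + ψ') = φ * ψ + φ * ψ' := by
  ext w
  induction w generalizing φ ψ ψ' with
  | nil => exact mul_add _ _ _
  | cons i w ih =>
    rw [add_apply, mul_cons, mul_cons, mul_cons, map_add, map_add, ih, ih, add_apply, add_apply]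
    abel

protected theorem smul_mul (c : k) (φ ψ : Words 𝒞 deg) : (c • φ) * ψ = c • (φ * ψ) := by
  ext w
  induction w generalizing φ ψ with
  | nil => exact smul_mul_assoc _ _ _
  | cons i w ih =>
    rw [smul_apply, mul_cons, mul_cons, map_smul, ih, ih, smul_apply, smul_apply, smul_add]

protected theorem mul_smul (c : k) (φ ψ : Words 𝒞 deg) : φ * (c • ψ) = c • (φ * ψ) := by
  ext w
  induction w generalizing φ ψ with
  | nil => exact mul_smul_comm _ _ _
  | cons i w ih =>
    rw [smul_apply, mul_cons, mul_cons, map_smul, map_smul, ih, ih, smul_apply, smul_apply,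
      smul_add]

instance : NonUnitalNonAssocRing (Words 𝒞 deg) :=
  { (inferInstance : AddCommGroup (Words 𝒞 deg)), (inferInstance : Mul (Words 𝒞 deg)) with
    left_distrib := Words.mul_add
    right_distrib := Words.add_mul
    zero_mul := fun φ => by
      have := Words.smul_mul (0 : k) 0 φ
      rwa [zero_smul, zero_smul] at this
    mul_zero := fun φ => by
      have := Words.mul_smul (0 : k) φ 0
      rwa [zero_smul, zero_smul] at this }

protected theorem zunit_mul (c : ℤˣ) (φ ψ : Words 𝒞 deg) : (c • φ) * ψ = c • (φ * ψ) := by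
  rw [Units.smul_def, Units.smul_def, smul_mul_assoc]

protected theorem mul_zunit (c : ℤˣ) (φ ψ : Words 𝒞 deg) : φ * (c • ψ) = c • (φ * ψ) := by
  rw [Units.smul_def, Units.smul_def, mul_smul_comm]

/-- Pointwise application of a multiplicative map of degree `0` is multiplicative. -/
theorem lift_mul {C' : Type u} [Ring C'] [Algebra k C'] {𝒞' : ℤ → Submodule k C'}
    [GradedAlgebra 𝒞'] {f : C →ₗ[k] C'} (hf : ∀ i, ∀ a ∈ 𝒞 i, f a ∈ 𝒞' i)
    (hm : ∀ a b, f (a * b) = f a * f b) (φ ψ : Words 𝒞 deg) :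
    (lift f (φ * ψ) : Words 𝒞' deg) = lift f φ * lift f ψ := by
  ext w
  induction w generalizing φ ψ with
  | nil => exact hm _ _
  | cons i w ih =>
    have h := lift_sign (𝒞' := 𝒞') (deg := deg) (r := 0) (fun i a ha => by
      rw [add_zero]
      exact hf i a ha) (deg i) ψ
    rw [mul_zero, Int.negOnePow_zero, one_smul] at h
    rw [lift_apply, mul_cons, mul_cons, map_add, der_lift, der_lift, ← ih, ← h, ← ih, lift_apply,
      lift_apply]

theorem sign_mul (d : ℤ) (φ ψ : Words 𝒞 deg) : sign d (φ * ψ) = sign d φ * sign d ψ := by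
  ext w
  induction w generalizing φ ψ with
  | nil =>
    simp only [sign_apply, wordDeg_nil, mul_zero, Int.negOnePow_zero, one_smul, mul_nil]
    exact gradeSign_mul _ _ _
  | cons i w ih =>
    rw [mul_cons]
    change der i (sign d (φ * ψ)) w = _
    rw [der_sign, der_mul, der_sign, der_sign, map_add, zunit_apply,
      Words.mul_zunit, Words.zunit_mul, zunit_apply, zunit_apply, ← smul_add, add_apply, ih, ih,
      sign_comm (deg i) d ψ]

protected theorem mul_assoc (φ ψ χ : Words 𝒞 deg) : φ * ψ * χ = φ * (ψ * χ) := by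
  ext w
  induction w generalizing φ ψ χ with
  | nil => exact mul_assoc _ _ _
  | cons i w ih =>
    rw [mul_cons, mul_cons, der_mul, der_mul, Words.add_mul, Words.mul_add, add_apply, add_apply,
      ih, ih, ih, sign_mul]
    abel

/-- The constant power series. -/
def const : C →ₗ[k] Words 𝒞 deg where
  toFun c := fun w => match w with
    | [] => c
    | _ :: _ => 0
  map_add' a b := funext fun w => by
    cases w with
    | nil => rfl
    | cons i w => exact (add_zero (0 : C)).symm
  map_smul' a b := funext fun w => by
    cases w with
    | nil => rfl
    | cons i w => exact (smul_zero a).symm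

theorem const_nil (c : C) : (const c : Words 𝒞 deg) [] = c := rfl
theorem const_cons (c : C) (i : ι) (w : List ι) : (const c : Words 𝒞 deg) (i :: w) = 0 := rfl

theorem der_const (i : ι) (c : C) : der i (const c : Words 𝒞 deg) = 0 := rfl

theorem sign_const (d : ℤ) (c : C) :
    sign d (const c : Words 𝒞 deg) = const (gradeSign 𝒞 d c) := by
  ext w
  cases w with
  | nil => simp only [sign_apply, wordDeg_nil, mul_zero, Int.negOnePow_zero, one_smul, const_nil]
  | cons i w => simp only [sign_apply, const_cons, map_zero, smul_zero]

theorem const_mul_apply (c : C) (φ : Words 𝒞 deg) (w : List ι) :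
    (const c * φ : Words 𝒞 deg) w = c * φ w := by
  induction w generalizing φ with
  | nil => rfl
  | cons i w ih => rw [mul_cons, der_const, zero_mul, ih, zero_apply, add_zero, der_apply]

theorem mul_one_apply (φ : Words 𝒞 deg) (w : List ι) :
    (φ * const 1 : Words 𝒞 deg) w = φ w := by
  induction w generalizing φ with
  | nil => exact mul_one _
  | cons i w ih =>
    rw [mul_cons, der_const, mul_zero, sign_const, gradeSign_one, ih, zero_apply, zero_add,
      der_apply]

instance : Ring (Words 𝒞 deg) :=
  { (inferInstance : NonUnitalNonAssocRing (Words 𝒞 deg)) with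
    mul_assoc := Words.mul_assoc
    one := const 1
    one_mul := fun φ => Words.ext fun w => by
      have := const_mul_apply (1 : C) φ w
      rw [one_mul] at this
      exact this
    mul_one := fun φ => Words.ext (mul_one_apply φ) }

instance : Algebra k (Words 𝒞 deg) := Algebra.ofModule Words.smul_mul Words.mul_smul

/-- The power series of degree `n`. -/
def homog (𝒞 : ℤ → Submodule k C) [GradedAlgebra 𝒞] (deg : ι → ℤ) (n : ℤ) :
    Submodule k (Words 𝒞 deg) where
  carrier := {φ | ∀ w, φ w ∈ 𝒞 (n + wordDeg deg w)}
  zero_mem' _ := zero_mem _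
  add_mem' h h' w := add_mem (h w) (h' w)
  smul_mem' c _ h w := Submodule.smul_mem _ c (h w)

theorem der_mem {n : ℤ} {φ : Words 𝒞 deg} (h : φ ∈ homog 𝒞 deg n) (i : ι) :
    der i φ ∈ homog 𝒞 deg (n + deg i) := by
  intro w
  have := h (i :: w)
  rwa [wordDeg_cons, ← add_assoc] at this

theorem lift_mem {C' : Type u} [Ring C'] [Algebra k C'] {𝒞' : ℤ → Submodule k C'}
    [GradedAlgebra 𝒞'] {f : C →ₗ[k] C'} {r : ℤ} (hf : ∀ i, ∀ a ∈ 𝒞 i, f a ∈ 𝒞' (i + r))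
    {n : ℤ} {φ : Words 𝒞 deg} (h : φ ∈ homog 𝒞 deg n) : lift f φ ∈ homog 𝒞' deg (n + r) := by
  intro w
  have := hf _ _ (h w)
  rwa [add_right_comm] at this

theorem sign_of_mem (d : ℤ) {n : ℤ} {φ : Words 𝒞 deg} (h : φ ∈ homog 𝒞 deg n) :
    sign d φ = (d * n).negOnePow • φ := by
  ext w
  rw [sign_apply, gradeSign_of_mem d (h w), smul_smul, ← Int.negOnePow_add, zunit_apply]
  congr 1
  rw [Int.negOnePow_eq_iff]
  simp only [parity_simps]
  grind

theorem const_mem {n : ℤ} {c : C} (hc : c ∈ 𝒞 n) : const c ∈ homog 𝒞 deg n := by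
  intro w
  cases w with
  | nil => rwa [wordDeg_nil, add_zero]
  | cons i w => exact zero_mem _

theorem mul_mem {m n : ℤ} {φ ψ : Words 𝒞 deg} (h : φ ∈ homog 𝒞 deg m)
    (h' : ψ ∈ homog 𝒞 deg n) : φ * ψ ∈ homog 𝒞 deg (m + n) := by
  intro w
  induction w generalizing φ ψ m n with
  | nil =>
    rw [mul_nil, wordDeg_nil, add_zero]
    have h1 := h []
    have h2 := h' []
    rw [wordDeg_nil, add_zero] at h1 h2
    exact SetLike.mul_mem_graded h1 h2
  | cons i w ih =>
    rw [mul_cons, sign_of_mem _ h', Words.mul_zunit, zunit_apply]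
    refine add_mem ?_ (zunit_smul_mem _ _ ?_)
    · have := ih h (der_mem h' i)
      rwa [← add_assoc, add_assoc (m + n), ← wordDeg_cons] at this
    · have := ih (der_mem h i) h'
      rwa [add_right_comm m, add_assoc (m + n), ← wordDeg_cons] at this

theorem mul_comm_of_mem (hc : ∀ i j, ∀ a ∈ 𝒞 i, ∀ b ∈ 𝒞 j, a * b = (i * j).negOnePow • (b * a))
    {m n : ℤ} {φ ψ : Words 𝒞 deg} (h : φ ∈ homog 𝒞 deg m) (h' : ψ ∈ homog 𝒞 deg n) :
    φ * ψ = (m * n).negOnePow • (ψ * φ) := by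
  ext w
  induction w generalizing φ ψ m n with
  | nil =>
    have h1 := h []
    have h2 := h' []
    rw [wordDeg_nil, add_zero] at h1 h2
    exact hc _ _ _ h1 _ h2
  | cons i w ih =>
    rw [mul_cons, sign_of_mem _ h', Words.mul_zunit, zunit_apply, zunit_apply, mul_cons,
      sign_of_mem _ h, Words.mul_zunit, zunit_apply, ih h (der_mem h' i), ih (der_mem h i) h',
      zunit_apply, zunit_apply, smul_add, smul_smul, smul_smul, ← Int.negOnePow_add,
      ← Int.negOnePow_add, add_comm]
    congr 2 <;> rw [Int.negOnePow_eq_iff] <;> simp only [parity_simps] <;> grind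

/-- Pointwise application of a derivation of degree `1` is a derivation. -/
theorem lift_derivation {Q : C →ₗ[k] C} (hQ : ∀ i, ∀ a ∈ 𝒞 i, Q a ∈ 𝒞 (i + 1))
    (hQm : ∀ a b, Q (a * b) = Q a * b + gradeSign 𝒞 1 a * Q b) (φ ψ : Words 𝒞 deg) :
    lift Q (φ * ψ) = lift Q φ * ψ + sign 1 φ * lift Q ψ := by
  ext w
  induction w generalizing φ ψ with
  | nil =>
    simp only [lift_apply, mul_nil, add_apply, sign_apply, wordDeg_nil, mul_zero,
      Int.negOnePow_zero, one_smul, hQm]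
  | cons i w ih =>
    rw [lift_apply, mul_cons, map_add, ← lift_apply (𝒞' := 𝒞), ← lift_apply (𝒞' := 𝒞), ih, ih,
      add_apply, add_apply, add_apply, mul_cons, mul_cons, der_lift, der_lift, der_sign,
      lift_sign hQ, Words.zunit_mul, Words.mul_zunit, zunit_apply, zunit_apply, one_mul, mul_one]
    abel

/-- The bracket that measures the failure of a pointwise operator to be a derivation. -/
def br (Δ : C →ₗ[k] C) (φ ψ : Words 𝒞 deg) : Words 𝒞 deg :=
  lift Δ (sign 1 φ * ψ) - lift Δ (sign 1 φ) * ψ - φ * lift Δ ψ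

section Bracket

variable {Δ : C →ₗ[k] C}

theorem br_add (φ ψ ψ' : Words 𝒞 deg) : br Δ φ (ψ + ψ') = br Δ φ ψ + br Δ φ ψ' := by
  simp only [br, mul_add, map_add]
  abel

theorem br_zunit (c : ℤˣ) (φ ψ : Words 𝒞 deg) : br Δ φ (c • ψ) = c • br Δ φ ψ := by
  simp only [br, Words.mul_zunit, map_zunit_smul, smul_sub]

theorem br_zunit_left (c : ℤˣ) (φ ψ : Words 𝒞 deg) : br Δ (c • φ) ψ = c • br Δ φ ψ := by
  simp only [br, Words.zunit_mul, map_zunit_smul, smul_sub]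

theorem der_br (hΔ : ∀ i, ∀ a ∈ 𝒞 i, Δ a ∈ 𝒞 (i + 1)) (i : ι) (φ ψ : Words 𝒞 deg) :
    der i (br Δ φ ψ)
      = br Δ φ (der i ψ) + (deg i).negOnePow • br Δ (der i φ) (sign (deg i) ψ) := by
  have h : lift (𝒞' := 𝒞) Δ (sign (deg i) ψ)
      = (deg i).negOnePow • sign (deg i) (lift Δ ψ) := by
    rw [lift_sign hΔ, mul_one]
  simp only [br, map_sub, der_lift, der_mul, der_sign, h, map_add, map_zunit_smul,
    Words.zunit_mul, Words.mul_zunit, smul_sub, one_mul, smul_smul, Int.units_mul_self,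
    one_smul]
  abel

theorem sign_br (hΔ : ∀ i, ∀ a ∈ 𝒞 i, Δ a ∈ 𝒞 (i + 1)) (d : ℤ) (φ ψ : Words 𝒞 deg) :
    sign d (br Δ φ ψ) = d.negOnePow • br Δ (sign d φ) (sign d ψ) := by
  have h : ∀ φ : Words 𝒞 deg, sign d (lift (𝒞' := 𝒞) Δ φ)
      = d.negOnePow • lift (𝒞' := 𝒞) Δ (sign d φ) := by
    intro φ
    rw [lift_sign (𝒞' := 𝒞) hΔ, smul_smul, mul_one, Int.units_mul_self, one_smul]
  simp only [br, map_sub, h, sign_mul, smul_sub, Words.zunit_mul, Words.mul_zunit]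
  rw [sign_comm d 1]

/-- The bracket of power series is a derivation in its second argument if that of the
coefficients is. -/
theorem br_mul (hΔ : ∀ i, ∀ a ∈ 𝒞 i, Δ a ∈ 𝒞 (i + 1))
    (hp : ∀ i j, ∀ a ∈ 𝒞 i, ∀ b ∈ 𝒞 j, ∀ c, bvBracket 𝒞 Δ a (b * c)
      = bvBracket 𝒞 Δ a b * c + ((i + 1) * j).negOnePow • (b * bvBracket 𝒞 Δ a c))
    {m n : ℤ} {φ ψ : Words 𝒞 deg} (h : φ ∈ homog 𝒞 deg m) (h' : ψ ∈ homog 𝒞 deg n)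
    (χ : Words 𝒞 deg) :
    br Δ φ (ψ * χ) = br Δ φ ψ * χ + ((m + 1) * n).negOnePow • (ψ * br Δ φ χ) := by
  ext w
  induction w generalizing φ ψ χ m n with
  | nil =>
    have h1 := h []
    have h2 := h' []
    rw [wordDeg_nil, add_zero] at h1 h2
    have hn : ∀ ψ : Words 𝒞 deg, br Δ φ ψ [] = bvBracket 𝒞 Δ (φ []) (ψ []) := by
      intro ψ
      rw [bvBracket_apply, ghostParity_of_mem 𝒞 h1, br, sign_of_mem 1 h, one_mul]
      rfl
    rw [hn, add_apply, zunit_apply, mul_nil, mul_nil, mul_nil, hn, hn]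
    exact hp _ _ _ h1 _ h2 _
  | cons i w ih =>
    change der i (br Δ φ (ψ * χ)) w
      = der i (br Δ φ ψ * χ + ((m + 1) * n).negOnePow • (ψ * br Δ φ χ)) w
    rw [der_br hΔ, map_add, map_zunit_smul, der_mul, der_mul, der_mul,
      der_br hΔ, der_br hΔ, br_add, sign_mul, sign_br hΔ, sign_of_mem _ h, sign_of_mem _ h',
      br_zunit_left]
    simp only [Words.zunit_mul, Words.mul_zunit, br_zunit, add_mul, mul_add, smul_add, add_apply,
      zunit_apply, ih h h', ih h (der_mem h' i), ih (der_mem h i) h', smul_smul,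
      ← Int.negOnePow_add]
    have e2 : (deg i + deg i * n + (m * n + deg i * n + 1 * n)).negOnePow
        = (m * n + 1 * n + deg i).negOnePow := by
      rw [Int.negOnePow_eq_iff]
      simp only [parity_simps]
      grind
    have e3 : (m * n + 1 * n + (deg i + deg i * m)).negOnePow
        = (m * n + 1 * n + (m * deg i + 1 * deg i)).negOnePow := by
      congr 1
      ring
    rw [e2, e3]
    abel

end Bracket

variable (𝒞 deg) in
/-- The subalgebra of the sums of homogeneous power series. -/
def total : Subalgebra k (Words 𝒞 deg) :=
  (⨆ n, homog 𝒞 deg n).toSubalgebra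
    (Submodule.mem_iSup_of_mem 0 (const_mem (SetLike.one_mem_graded 𝒞)))
    (fun x y hx hy => by
      refine Submodule.iSup_induction _ (motive := fun x => x * y ∈ ⨆ n, homog 𝒞 deg n) hx ?_
        (by rw [zero_mul]; exact zero_mem _) ?_
      · intro m x hx
        refine Submodule.iSup_induction _ (motive := fun y => x * y ∈ ⨆ n, homog 𝒞 deg n) hy ?_
          (by rw [mul_zero]; exact zero_mem _) ?_
        · intro n y hy
          exact Submodule.mem_iSup_of_mem (m + n) (mul_mem hx hy)
        · intro y y' h h'
          rw [mul_add]
          exact add_mem h h'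
      · intro x x' h h'
        rw [add_mul]
        exact add_mem h h')

theorem mem_total_of_mem {n : ℤ} {φ : Words 𝒞 deg} (h : φ ∈ homog 𝒞 deg n) :
    φ ∈ total 𝒞 deg :=
  Submodule.mem_iSup_of_mem (p := homog 𝒞 deg) n h

theorem total_induction {p : Words 𝒞 deg → Prop} (h0 : p 0)
    (hadd : ∀ x y, p x → p y → p (x + y)) (hp : ∀ n, ∀ x ∈ homog 𝒞 deg n, p x)
    {x : Words 𝒞 deg} (hx : x ∈ total 𝒞 deg) : p x :=
  Submodule.iSup_induction (homog 𝒞 deg) (motive := p) hx hp h0 hadd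

variable (𝒞 deg) in
/-- The grading of the algebra of power series. -/
def gr (n : ℤ) : Submodule k (total 𝒞 deg) :=
  (homog 𝒞 deg n).comap (total 𝒞 deg).val.toLinearMap

/-- A linear map of degree `r` on the coefficients, applied pointwise. -/
def map {C' : Type u} [Ring C'] [Algebra k C'] {𝒞' : ℤ → Submodule k C'} [GradedAlgebra 𝒞']
    (f : C →ₗ[k] C') (r : ℤ) (hf : ∀ i, ∀ a ∈ 𝒞 i, f a ∈ 𝒞' (i + r)) :
    total 𝒞 deg →ₗ[k] total 𝒞' deg :=
  (lift f).restrict (p := (total 𝒞 deg).toSubmodule) (q := (total 𝒞' deg).toSubmodule)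
    fun x hx => by
      refine total_induction (p := fun x => lift f x ∈ (total 𝒞' deg).toSubmodule) ?_ ?_ ?_ hx
      · rw [map_zero]
        exact zero_mem _
      · intro x y hx hy
        rw [map_add]
        exact add_mem hx hy
      · intro n x hx
        exact mem_total_of_mem (lift_mem hf hx)

theorem map_mem {C' : Type u} [Ring C'] [Algebra k C'] {𝒞' : ℤ → Submodule k C'}
    [GradedAlgebra 𝒞'] {f : C →ₗ[k] C'} {r : ℤ} (hf : ∀ i, ∀ a ∈ 𝒞 i, f a ∈ 𝒞' (i + r))
    {n : ℤ} {x : total 𝒞 deg} (hx : x ∈ gr 𝒞 deg n) :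
    map f r hf x ∈ gr 𝒞' deg (n + r) :=
  lift_mem hf hx

/-- The projection to the power series of degree `n`. -/
def proj (n : ℤ) : Words 𝒞 deg →ₗ[k] Words 𝒞 deg where
  toFun φ := fun w =>
    gradeProj (DirectSum.Decomposition.isInternal 𝒞) (n + wordDeg deg w) (φ w)
  map_add' φ ψ := funext fun w => map_add (gradeProj _ _) (φ w) (ψ w)
  map_smul' c φ := funext fun w => map_smul (gradeProj _ _) c (φ w)

theorem isInternal_gr : DirectSum.IsInternal (gr 𝒞 deg) := by
  have hproj : ∀ n (x : total 𝒞 deg), proj n x.1 ∈ (total 𝒞 deg).toSubmodule := fun n x =>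
    mem_total_of_mem (n := n) fun w => gradeProj_mem _ _ _
  refine isInternal_of_proj ?_
    (fun n => ((proj n).comp (total 𝒞 deg).val.toLinearMap).codRestrict
      (total 𝒞 deg).toSubmodule (hproj n)) ?_ ?_
  · rw [eq_top_iff]
    rintro ⟨x, hx⟩ -
    obtain ⟨_, h⟩ := total_induction
      (p := fun x => ∃ hx : x ∈ total 𝒞 deg, (⟨x, hx⟩ : total 𝒞 deg) ∈ ⨆ n, gr 𝒞 deg n)
      ⟨zero_mem _, zero_mem _⟩ (fun x y hx hy => ⟨add_mem hx.1 hy.1, add_mem hx.2 hy.2⟩)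
      (fun n x hx => ⟨mem_total_of_mem hx, Submodule.mem_iSup_of_mem n hx⟩) hx
    exact h
  · intro i x hx
    apply Subtype.ext
    apply Words.ext
    intro w
    exact gradeProj_of_mem _ (hx w)
  · intro i j hij x hx
    apply Subtype.ext
    apply Words.ext
    intro w
    exact gradeProj_of_ne _ (hx w) (by simpa using hij)

instance : GradedAlgebra (gr 𝒞 deg) :=
  { (isInternal_gr (𝒞 := 𝒞) (deg := deg)).chooseDecomposition with
    one_mem := const_mem (SetLike.one_mem_graded 𝒞)
    mul_mem := fun _ _ _ _ h h' => mul_mem h h' }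

theorem bvBracket_coe {Δ : C →ₗ[k] C} (hΔ : ∀ i, ∀ a ∈ 𝒞 i, Δ a ∈ 𝒞 (i + 1)) {i : ℤ}
    {a : total 𝒞 deg} (ha : a ∈ gr 𝒞 deg i) (x : total 𝒞 deg) :
    (bvBracket (gr 𝒞 deg) (map Δ 1 hΔ) a x).1 = br Δ a.1 x.1 := by
  have ha' : a.1 ∈ homog 𝒞 deg i := ha
  rw [bvBracket_apply, ghostParity_of_mem _ ha, br, sign_of_mem 1 ha', one_mul]
  rfl

end Words

namespace DBVAlgebra

variable {k : Type u} [Field k] {C : Type u} [Ring C] [Algebra k C]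
  {𝒞 : ℤ → Submodule k C} [GradedAlgebra 𝒞] (B : DBVAlgebra 𝒞) {ι : Type u} (deg : ι → ℤ)

theorem Q_mul_gradeSign (a b : C) : B.Q (a * b) = B.Q a * b + gradeSign 𝒞 1 a * B.Q b := by
  refine grade_induction (DirectSum.Decomposition.isInternal 𝒞) (p := fun a =>
    B.Q (a * b) = B.Q a * b + gradeSign 𝒞 1 a * B.Q b) (by simp) ?_ ?_ a
  · intro x y hx hy
    simp only [add_mul, map_add, hx, hy]
    abel
  intro i a ha
  rw [B.Q_mul i a ha, gradeSign_of_mem 1 ha, one_mul, smul_mul_assoc]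

/-- The differential Batalin-Vilkovisky algebra of the power series with coefficients in a
differential Batalin-Vilkovisky algebra. -/
def words : DBVAlgebra (Words.gr 𝒞 deg) where
  graded_comm i j a ha b hb := Subtype.ext (Words.mul_comm_of_mem B.graded_comm ha hb)
  Q := Words.map B.Q 1 B.Q_mem
  Q_mem i a ha := Words.map_mem B.Q_mem ha
  Q_Q a := Subtype.ext (Words.ext fun w => B.Q_Q _)
  Q_mul i a ha b := by
    have ha' : a.1 ∈ Words.homog 𝒞 deg i := ha
    apply Subtype.ext
    refine (Words.lift_derivation B.Q_mem B.Q_mul_gradeSign a.1 b.1).trans ?_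
    rw [Words.sign_of_mem 1 ha', one_mul, Words.zunit_mul]
    rfl
  Δ := Words.map B.Δ 1 B.Δ_mem
  Δ_mem i a ha := Words.map_mem B.Δ_mem ha
  Δ_Δ a := Subtype.ext (Words.ext fun w => B.Δ_Δ _)
  poisson i j a ha b hb c := by
    have ha' : a.1 ∈ Words.homog 𝒞 deg i := ha
    have hb' : b.1 ∈ Words.homog 𝒞 deg j := hb
    have hbr := Words.bvBracket_coe B.Δ_mem ha
    apply Subtype.ext
    have := Words.br_mul B.Δ_mem B.poisson ha' hb' c.1
    rw [hbr]
    refine this.trans ?_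
    rw [← hbr, ← hbr]
    rfl
  Δ_Q a := Subtype.ext (Words.ext fun w => B.Δ_Q _)

end DBVAlgebra

/-! ### The quantum master equation -/

namespace DBVAlgebra

variable {k : Type u} [Field k] {C : Type u} [Ring C] [Algebra k C]
  {𝒞 : ℤ → Submodule k C} [GradedAlgebra 𝒞] (B : DBVAlgebra 𝒞)

theorem Q_one : B.Q 1 = 0 := by
  have := B.Q_mul 0 1 (SetLike.one_mem_graded 𝒞) 1
  simpa using this

/-- The quantum differential `Q + ħ Δ`. -/
def quantumD (ħ : C) : C →ₗ[k] C := B.Q + LinearMap.mulLeft k ħ ∘ₗ B.Δ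

theorem quantumD_apply (ħ x : C) : B.quantumD ħ x = B.Q x + ħ * B.Δ x := rfl

/-- The left hand side of the quantum master equation `(Q + ħ Δ) Γ + ½ (Γ, Γ) = 0`. -/
def master (ħ Γ : C) : C := B.quantumD ħ Γ + (2 : k)⁻¹ • B.bracket Γ Γ

/-- An element of degree `0` that is annihilated by `Q` and commutes with `Δ`, used as a
formal parameter. -/
structure IsParameter (ħ : C) : Prop where
  mem : ħ ∈ 𝒞 0
  Q_eq : B.Q ħ = 0
  Δ_mul : ∀ x, B.Δ (ħ * x) = ħ * B.Δ x

variable {B} {ħ : C}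

theorem even_comm (B : DBVAlgebra 𝒞) {a : C} (ha : a ∈ 𝒞 0) (x : C) : a * x = x * a := by
  refine grade_induction (DirectSum.Decomposition.isInternal 𝒞) (p := fun x => a * x = x * a)
    (by simp) ?_ ?_ x
  · intro x y hx hy
    rw [mul_add, add_mul, hx, hy]
  · intro i x hx
    rw [B.graded_comm _ _ _ ha _ hx]
    simp

theorem IsParameter.quantumD_mem (h : B.IsParameter ħ) {i : ℤ} {x : C} (hx : x ∈ 𝒞 i) :
    B.quantumD ħ x ∈ 𝒞 (i + 1) := by
  refine add_mem (B.Q_mem i x hx) ?_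
  have := SetLike.mul_mem_graded h.mem (B.Δ_mem i x hx)
  rwa [zero_add] at this

theorem IsParameter.Q_mul (h : B.IsParameter ħ) (x : C) : B.Q (ħ * x) = ħ * B.Q x := by
  rw [B.Q_mul 0 ħ h.mem, h.Q_eq]
  simp

theorem IsParameter.quantumD_mul (h : B.IsParameter ħ) (x : C) :
    B.quantumD ħ (ħ * x) = ħ * B.quantumD ħ x := by
  rw [quantumD_apply, quantumD_apply, h.Q_mul, h.Δ_mul, mul_add]

theorem IsParameter.quantumD_quantumD (h : B.IsParameter ħ) (x : C) :
    B.quantumD ħ (B.quantumD ħ x) = 0 := by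
  rw [B.quantumD_apply ħ x, map_add, h.quantumD_mul, quantumD_apply, quantumD_apply, B.Q_Q,
    B.Δ_Δ, B.Q_Δ]
  simp

theorem quantumD_even_mul {a : C} (ha : a ∈ 𝒞 0) (x : C) :
    B.quantumD ħ (a * x)
      = B.quantumD ħ a * x + a * B.quantumD ħ x + ħ * B.bracket a x := by
  simp only [quantumD_apply, B.Q_mul_even (by decide) ha, B.bracket_even (by decide) ha, add_mul,
    mul_add, mul_sub]
  rw [← mul_assoc a ħ, B.even_comm ha ħ]
  simp only [mul_assoc]
  abel

theorem bracket_pow {Γ : C} (hΓ : Γ ∈ 𝒞 0) (m : ℕ) :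
    B.bracket Γ (Γ ^ (m + 1)) = ((m : k) + 1) • (Γ ^ m * B.bracket Γ Γ) := by
  induction m with
  | zero => simp
  | succ m ih =>
    rw [pow_succ' Γ (m + 1), B.poisson _ _ _ hΓ _ hΓ, ih]
    have hp : Γ ^ (m + 1) ∈ 𝒞 0 := by simpa using SetLike.pow_mem_graded (m + 1) hΓ
    rw [← B.even_comm hp, mul_smul_comm, ← mul_assoc, ← pow_succ']
    simp only [add_smul, one_smul, Nat.cast_add, Nat.cast_one, mul_zero, Int.negOnePow_zero]
    abel

theorem quantumD_pow [CharZero k] {Γ : C} (hΓ : Γ ∈ 𝒞 0)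
    (m : ℕ) :
    B.quantumD ħ (Γ ^ (m + 2)) = ((m : k) + 2) • (Γ ^ (m + 1) * B.quantumD ħ Γ)
      + (((m : k) + 2) * ((m : k) + 1) * 2⁻¹) • (ħ * (Γ ^ m * B.bracket Γ Γ)) := by
  have hstep : ∀ m : ℕ, B.quantumD ħ (Γ ^ (m + 2)) = Γ ^ (m + 1) * B.quantumD ħ Γ
      + Γ * B.quantumD ħ (Γ ^ (m + 1)) + ((m : k) + 1) • (ħ * (Γ ^ m * B.bracket Γ Γ)) := by
    intro m
    have hp : Γ ^ (m + 1) ∈ 𝒞 0 := by simpa using SetLike.pow_mem_graded (m + 1) hΓ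
    rw [pow_succ' Γ (m + 1), quantumD_even_mul hΓ, bracket_pow hΓ, ← B.even_comm hp,
      mul_smul_comm]
  induction m with
  | zero =>
    rw [hstep]
    simp [two_smul]
  | succ m ih =>
    rw [hstep, ih]
    simp only [mul_add, mul_smul_comm]
    rw [← mul_assoc Γ (Γ ^ (m + 1)), ← pow_succ', ← mul_assoc Γ ħ, B.even_comm hΓ ħ,
      mul_assoc ħ Γ, ← mul_assoc Γ (Γ ^ m), ← pow_succ']
    push_cast
    match_scalars
    · ring
    · field_simp
      ring

/-- Up to terms of higher order in `Γ`, a power of `ħ` times the left hand side of the quantum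
master equation is exact. The primitive is the polynomial part of `ħ ^ (N + 2) exp (Γ / ħ)`. -/
theorem IsParameter.exists_primitive [CharZero k] (h : B.IsParameter ħ) {Γ : C} (hΓ : Γ ∈ 𝒞 0)
    (N : ℕ) : ∃ Z ∈ 𝒞 0, ∃ T : C, B.quantumD ħ Z = (ħ ^ (N + 1) + Γ * T) * B.master ħ Γ
      + ((N + 1).factorial : k)⁻¹ • (Γ ^ (N + 1) * B.quantumD ħ Γ) := by
  have hpow : ∀ m : ℕ, Γ ^ m ∈ 𝒞 0 := fun m => by simpa using SetLike.pow_mem_graded m hΓ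
  have hmul : ∀ x ∈ 𝒞 0, ħ * x ∈ 𝒞 0 := fun x hx => by
    simpa using SetLike.mul_mem_graded h.mem hx
  induction N with
  | zero =>
    refine ⟨ħ * Γ + (2 : k)⁻¹ • Γ ^ 2, add_mem (hmul _ hΓ) (Submodule.smul_mem _ _ (hpow 2)),
      0, ?_⟩
    rw [map_add, map_smul, h.quantumD_mul, quantumD_pow hΓ 0, master]
    simp only [mul_add, add_mul, mul_smul_comm, pow_zero, one_mul, zero_add, pow_one, mul_zero,
      add_zero, Nat.factorial_one]
    match_scalars <;> norm_num
  | succ N ih =>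
    obtain ⟨Z, hZ, T, hT⟩ := ih
    refine ⟨ħ * Z + ((N + 3).factorial : k)⁻¹ • Γ ^ (N + 3),
      add_mem (hmul _ hZ) (Submodule.smul_mem _ _ (hpow _)),
      ħ * T + ((N + 1).factorial : k)⁻¹ • (ħ * Γ ^ N), ?_⟩
    rw [map_add, map_smul, h.quantumD_mul, quantumD_pow hΓ (N + 1), hT, master]
    have f1 : ((N + 3).factorial : k) = (N + 3) * ((N + 2) * (N + 1).factorial) := by
      rw [Nat.factorial_succ (N + 2), Nat.factorial_succ (N + 1)]
      push_cast
      ring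
    have f2 : ((N + 1 + 1).factorial : k) = (N + 2) * (N + 1).factorial := by
      rw [Nat.factorial_succ (N + 1)]
      push_cast
      ring
    have f0 : ((N + 1).factorial : k) ≠ 0 := Nat.cast_ne_zero.2 (Nat.factorial_ne_zero _)
    have g1 : ((N : k) + 2) ≠ 0 := by exact_mod_cast Nat.succ_ne_zero (N + 1)
    have g2 : ((N : k) + 3) ≠ 0 := by exact_mod_cast Nat.succ_ne_zero (N + 2)
    obtain ⟨c₂, hc₂⟩ : ∃ c₂, c₂ = ((N + 1 + 1).factorial : k)⁻¹ := ⟨_, rfl⟩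
    obtain ⟨a, ha⟩ : ∃ a, a = ((N + 1 : ℕ) : k) + 2 := ⟨_, rfl⟩
    obtain ⟨b, hb⟩ : ∃ b, b = (((N + 1 : ℕ) : k) + 2) * (((N + 1 : ℕ) : k) + 1) * 2⁻¹ := ⟨_, rfl⟩
    obtain ⟨c₃, hc₃⟩ : ∃ c₃, c₃ = ((N + 3).factorial : k)⁻¹ := ⟨_, rfl⟩
    obtain ⟨c, hc⟩ : ∃ c, c = ((N + 1).factorial : k)⁻¹ := ⟨_, rfl⟩
    have e1 : c₃ * a = c₂ := by
      rw [hc₃, ha, hc₂, f1, f2]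
      push_cast
      field_simp
      ring
    have e2 : c₃ * b = 2⁻¹ * c := by
      rw [hc₃, hb, hc, f1]
      push_cast
      field_simp
      ring
    rw [← hc, ← hc₂, ← hc₃, ← hb, ← ha]
    have hΓħ : ∀ x, Γ * (ħ * x) = ħ * (Γ * x) := fun x => by
      rw [← mul_assoc, B.even_comm hΓ, mul_assoc]
    have hΓp : ∀ x, Γ * (Γ ^ N * x) = Γ ^ (N + 1) * x := fun x => by
      rw [← mul_assoc, ← pow_succ']
    simp only [mul_add, add_mul, mul_smul_comm, smul_mul_assoc, smul_add, pow_succ' ħ (N + 1),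
      mul_assoc, hΓħ, hΓp, smul_smul, e1, e2]
    abel

end DBVAlgebra

/-! ### Solutions of the quantum master equation in power series -/

namespace Words

variable {k : Type u} [Field k] {C : Type u} [Ring C] [Algebra k C]
  {𝒞 : ℤ → Submodule k C} [GradedAlgebra 𝒞] {ι : Type u} {deg : ι → ℤ}

variable (𝒞 deg) in
/-- The power series without terms of order less than `p`. -/
def fil (p : ℕ) : Submodule k (Words 𝒞 deg) where
  carrier := {φ | ∀ w : List ι, w.length < p → φ w = 0}
  zero_mem' _ _ := rfl
  add_mem' {φ ψ} h h' w hw := by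
    rw [add_apply, h w hw, h' w hw, add_zero]
  smul_mem' c φ h w hw := by
    rw [smul_apply, h w hw, smul_zero]

theorem fil_anti {p q : ℕ} (hpq : p ≤ q) : fil 𝒞 deg q ≤ fil 𝒞 deg p :=
  fun _ h w hw => h w (hw.trans_le hpq)

theorem mem_fil_zero (φ : Words 𝒞 deg) : φ ∈ fil 𝒞 deg 0 := fun _ hw => absurd hw (by simp)

theorem der_mem_fil {p : ℕ} {φ : Words 𝒞 deg} (h : φ ∈ fil 𝒞 deg p) (i : ι) :
    der i φ ∈ fil 𝒞 deg (p - 1) := fun w hw => h (i :: w) (by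
  rw [List.length_cons]
  omega)

theorem lift_mem_fil {C' : Type u} [Ring C'] [Algebra k C'] {𝒞' : ℤ → Submodule k C'}
    [GradedAlgebra 𝒞'] (f : C →ₗ[k] C') {p : ℕ} {φ : Words 𝒞 deg} (h : φ ∈ fil 𝒞 deg p) :
    lift f φ ∈ fil 𝒞' deg p := fun w hw => by
  rw [lift_apply, h w hw, map_zero]

theorem sign_mem_fil (d : ℤ) {p : ℕ} {φ : Words 𝒞 deg} (h : φ ∈ fil 𝒞 deg p) :
    sign d φ ∈ fil 𝒞 deg p := fun w hw => by
  rw [sign_apply, h w hw, map_zero, smul_zero]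

theorem mul_mem_fil {p q : ℕ} {φ ψ : Words 𝒞 deg} (h : φ ∈ fil 𝒞 deg p)
    (h' : ψ ∈ fil 𝒞 deg q) : φ * ψ ∈ fil 𝒞 deg (p + q) := by
  intro w hw
  induction w generalizing φ ψ p q with
  | nil =>
    rw [mul_nil]
    rcases Nat.eq_zero_or_pos p with hp | hp
    · rw [h' [] (by simpa [hp] using hw), mul_zero]
    · rw [h [] (by simpa using hp), zero_mul]
  | cons i w ih =>
    rw [List.length_cons] at hw
    rw [mul_cons, ih h (der_mem_fil h' i) (by omega),
      ih (der_mem_fil h i) (sign_mem_fil _ h') (by omega), add_zero]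

variable (𝒞 deg) in
/-- The homogeneous power series without terms of order less than `p`. -/
def totalFil (p : ℕ) : Submodule k (total 𝒞 deg) :=
  (fil 𝒞 deg p).comap (total 𝒞 deg).val.toLinearMap

theorem map_mem_totalFil {f : C →ₗ[k] C} {r : ℤ} (hf : ∀ i, ∀ a ∈ 𝒞 i, f a ∈ 𝒞 (i + r)) {p : ℕ}
    {x : total 𝒞 deg} (h : x ∈ totalFil 𝒞 deg p) : map f r hf x ∈ totalFil 𝒞 deg p :=
  lift_mem_fil (𝒞' := 𝒞) f h

theorem mul_mem_totalFil {p q : ℕ} {x y : total 𝒞 deg} (h : x ∈ totalFil 𝒞 deg p)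
    (h' : y ∈ totalFil 𝒞 deg q) : x * y ∈ totalFil 𝒞 deg (p + q) := mul_mem_fil h h'

end Words

namespace DBVAlgebra

variable {k : Type u} [Field k] {C : Type u} [Ring C] [Algebra k C]
  {𝒞 : ℤ → Submodule k C} [GradedAlgebra 𝒞] {B : DBVAlgebra 𝒞} {ι : Type u} {deg : ι → ℤ}

variable (𝒞 deg) in
/-- The constant power series `c`. -/
def wordsConst {n : ℤ} (c : C) (hc : c ∈ 𝒞 n) : Words.total 𝒞 deg :=
  ⟨Words.const c, Words.mem_total_of_mem (Words.const_mem hc)⟩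

theorem IsParameter.words {ħ : C} (h : B.IsParameter ħ) :
    (B.words deg).IsParameter (wordsConst 𝒞 deg ħ h.mem) where
  mem := Words.const_mem h.mem
  Q_eq := Subtype.ext (Words.ext fun w => by
    cases w with
    | nil => exact h.Q_eq
    | cons i w => exact map_zero B.Q)
  Δ_mul x := Subtype.ext (Words.ext fun w => by
    have e1 := Words.const_mul_apply ħ x.1 w
    have e2 := Words.const_mul_apply ħ (Words.lift (𝒞' := 𝒞) B.Δ x.1) w
    exact (congrArg B.Δ e1).trans ((h.Δ_mul _).trans e2.symm))

theorem IsParameter.words_quantumD {ħ : C} (h : B.IsParameter ħ) (x : Words.total 𝒞 deg)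
    (w : List ι) :
    ((B.words deg).quantumD (wordsConst 𝒞 deg ħ h.mem) x).1 w = B.quantumD ħ (x.1 w) :=
  congrArg (B.Q (x.1 w) + ·) (Words.const_mul_apply ħ (Words.lift (𝒞' := 𝒞) B.Δ x.1) w)

theorem words_bracket_mem_fil {x y : Words.total 𝒞 deg} (hx : x ∈ Words.gr 𝒞 deg 0) {p q : ℕ}
    (hp : x ∈ Words.totalFil 𝒞 deg p) (hq : y ∈ Words.totalFil 𝒞 deg q) :
    (B.words deg).bracket x y ∈ Words.totalFil 𝒞 deg (p + q) := by
  rw [(B.words deg).bracket_even (by decide) hx]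
  refine sub_mem (sub_mem ?_ ?_) ?_
  · exact Words.map_mem_totalFil B.Δ_mem (Words.mul_mem_totalFil hp hq)
  · exact Words.mul_mem_totalFil (Words.map_mem_totalFil B.Δ_mem hp) hq
  · exact Words.mul_mem_totalFil hp (Words.map_mem_totalFil B.Δ_mem hq)

theorem IsParameter.words_quantumD_mem_fil {ħ : C} (h : B.IsParameter ħ)
    {x : Words.total 𝒞 deg} {p : ℕ} (hp : x ∈ Words.totalFil 𝒞 deg p) :
    (B.words deg).quantumD (wordsConst 𝒞 deg ħ h.mem) x ∈ Words.totalFil 𝒞 deg p := by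
  intro w hw
  refine (h.words_quantumD x w).trans ?_
  have : x.1 w = 0 := hp w hw
  rw [this, map_zero]

theorem master_add (ħ Γ x : C) : B.master ħ (Γ + x) - B.master ħ Γ
    = B.quantumD ħ x + (2 : k)⁻¹ • (B.bracket Γ x + B.bracket x Γ + B.bracket x x) := by
  simp only [master, map_add, LinearMap.add_apply, smul_add]
  abel

/-- The property that makes the quantum master equation solvable order by order: an element that
becomes exact after multiplication by a power of `ħ` is exact. -/
def HasExactDivision (B : DBVAlgebra 𝒞) (ħ : C) : Prop :=
  ∀ (n : ℕ) (d : ℤ) (x : C), ∀ z ∈ 𝒞 d, ħ ^ n * x = B.quantumD ħ z →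
    ∃ y ∈ 𝒞 d, x = B.quantumD ħ y

theorem wordsConst_pow_mul_apply {ħ : C} (h : B.IsParameter ħ) (n : ℕ) (x : Words.total 𝒞 deg)
    (w : List ι) : ((wordsConst 𝒞 deg ħ h.mem) ^ n * x).1 w = ħ ^ n * x.1 w := by
  induction n with
  | zero => simp
  | succ n ih =>
    rw [pow_succ', pow_succ', mul_assoc, mul_assoc, ← ih]
    exact Words.const_mul_apply ħ _ w

/-- A solution of the quantum master equation up to order `p` can be improved to a solution up
to order `p + 1`: the terms of order `p` of the error become exact after multiplication by
`ħ ^ (p + 1)`, hence are exact. -/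
theorem IsParameter.exists_improvement [CharZero k] {ħ : C} (h : B.IsParameter ħ)
    (hdiv : B.HasExactDivision ħ) {Γ : Words.total 𝒞 deg} (hΓ : Γ ∈ Words.gr 𝒞 deg 0)
    (hΓ1 : Γ ∈ Words.totalFil 𝒞 deg 1) {p : ℕ} (hp : 1 ≤ p)
    (hE : (B.words deg).master (wordsConst 𝒞 deg ħ h.mem) Γ ∈ Words.totalFil 𝒞 deg p) :
    ∃ x ∈ Words.gr 𝒞 deg 0, x ∈ Words.totalFil 𝒞 deg p ∧
      (B.words deg).master (wordsConst 𝒞 deg ħ h.mem) (Γ + x) ∈ Words.totalFil 𝒞 deg (p + 1) := by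
  classical
  set E := (B.words deg).master (wordsConst 𝒞 deg ħ h.mem) Γ with hEdef
  obtain ⟨Z, hZ, T, hT⟩ := (h.words (deg := deg)).exists_primitive hΓ p
  have hex : ∀ w : List ι, w.length = p →
      ∃ y ∈ 𝒞 (Words.wordDeg deg w), E.1 w = B.quantumD ħ y := by
    intro w hw
    have hZw := hZ w
    rw [zero_add] at hZw
    refine hdiv (p + 1) _ (E.1 w) (Z.1 w) hZw ?_
    have hpow : ∀ n, Γ ^ n ∈ Words.totalFil 𝒞 deg n := by
      intro n
      induction n with
      | zero => exact Words.mem_fil_zero _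
      | succ n ih =>
        rw [pow_succ]
        exact Words.mul_mem_totalFil ih hΓ1
    have h1 : (Γ * T * E).1 w = 0 :=
      Words.mul_mem_totalFil (p := 1) (q := p)
        (Words.mul_mem_totalFil (q := 0) hΓ1 (Words.mem_fil_zero T.1)) hE w (by omega)
    have h2 : (Γ ^ (p + 1) * (B.words deg).quantumD (wordsConst 𝒞 deg ħ h.mem) Γ).1 w = 0 :=
      Words.mul_mem_totalFil (q := 0) (hpow (p + 1)) (Words.mem_fil_zero _) w (by omega)
    have h3 := h.words_quantumD Z w
    rw [hT, add_mul] at h3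
    rw [← h3, ← wordsConst_pow_mul_apply h]
    change _ = _ + (Γ * T * E).1 w
      + (((p + 1).factorial : k)⁻¹) • (Γ ^ (p + 1) * _ : Words.total 𝒞 deg).1 w
    rw [h1, h2, smul_zero, add_zero, add_zero]
  choose! y hy hEy using hex
  let φ : Words 𝒞 deg := fun w => if w.length = p then -y w else 0
  have hφ : φ ∈ Words.homog 𝒞 deg 0 := by
    intro w
    rw [zero_add]
    by_cases hw : w.length = p
    · rw [show φ w = -y w from if_pos hw]
      exact neg_mem (hy w hw)
    · rw [show φ w = 0 from if_neg hw]
      exact zero_mem _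
  let x : Words.total 𝒞 deg := ⟨φ, Words.mem_total_of_mem hφ⟩
  have hx : x ∈ Words.gr 𝒞 deg 0 := hφ
  have hxp : x ∈ Words.totalFil 𝒞 deg p := fun w hw => if_neg hw.ne
  refine ⟨x, hx, hxp, ?_⟩
  have h1 : E + (B.words deg).quantumD (wordsConst 𝒞 deg ħ h.mem) x
      ∈ Words.totalFil 𝒞 deg (p + 1) := by
    intro w hw
    have h2 := h.words_quantumD x w
    change E.1 w + ((B.words deg).quantumD (wordsConst 𝒞 deg ħ h.mem) x).1 w = 0
    rw [h2]
    rcases (Nat.lt_succ_iff.1 hw).lt_or_eq with hw' | hw'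
    · have e1 : E.1 w = 0 := hE w hw'
      have e2 : x.1 w = 0 := hxp w hw'
      rw [e1, e2, map_zero, add_zero]
    · have e2 : x.1 w = -y w := if_pos hw'
      rw [hEy w hw', e2, map_neg, add_neg_cancel]
  have h2 := master_add (B := B.words deg) (wordsConst 𝒞 deg ħ h.mem) Γ x
  rw [sub_eq_iff_eq_add, ← hEdef] at h2
  rw [h2, add_right_comm, add_comm _ E]
  refine add_mem h1 (Submodule.smul_mem _ _ (add_mem (add_mem ?_ ?_) ?_))
  · have := words_bracket_mem_fil (B := B) hΓ hΓ1 hxp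
    rwa [add_comm] at this
  · exact words_bracket_mem_fil (B := B) hx hxp hΓ1
  · exact Words.fil_anti (by omega) (words_bracket_mem_fil (B := B) hx hxp hxp)

/-- A solution of the quantum master equation with given linear part. -/
theorem IsParameter.exists_solution [CharZero k] {ħ : C} (h : B.IsParameter ħ)
    (hdiv : B.HasExactDivision ħ) (e : ι → C) (he : ∀ i, e i ∈ 𝒞 (deg i))
    (hKe : ∀ i, B.quantumD ħ (e i) = 0) :
    ∃ Γ ∈ Words.gr 𝒞 deg 0, Γ.1 [] = 0 ∧ (∀ i, Γ.1 [i] = e i) ∧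
      (B.words deg).master (wordsConst 𝒞 deg ħ h.mem) Γ = 0 := by
  let M := (B.words deg).master (wordsConst 𝒞 deg ħ h.mem)
  let φ₀ : Words 𝒞 deg := fun w => match w with
    | [i] => e i
    | _ => 0
  have hφ₀ : φ₀ ∈ Words.homog 𝒞 deg 0 := by
    intro w
    match w with
    | [] => exact zero_mem _
    | [i] =>
      change e i ∈ _
      rw [Words.wordDeg_cons, Words.wordDeg_nil, zero_add, add_zero]
      exact he i
    | i :: j :: w => exact zero_mem _
  let Γ₀ : Words.total 𝒞 deg := ⟨φ₀, Words.mem_total_of_mem hφ₀⟩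
  have hΓ₀ : Γ₀ ∈ Words.gr 𝒞 deg 0 := hφ₀
  have hΓ₀1 : Γ₀ ∈ Words.totalFil 𝒞 deg 1 := by
    intro w hw
    rw [Nat.lt_one_iff, List.length_eq_zero_iff] at hw
    rw [hw]
    rfl
  have hM₀ : M Γ₀ ∈ Words.totalFil 𝒞 deg 2 := by
    refine add_mem ?_ (Submodule.smul_mem _ _ (words_bracket_mem_fil hΓ₀ hΓ₀1 hΓ₀1))
    intro w _
    refine (h.words_quantumD Γ₀ w).trans ?_
    match w with
    | [] => exact map_zero _
    | [i] => exact hKe i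
    | i :: j :: w => exact map_zero _
  let S : ℕ → Type u := fun n => {Γ : Words.total 𝒞 deg // Γ ∈ Words.gr 𝒞 deg 0 ∧
    Γ ∈ Words.totalFil 𝒞 deg 1 ∧ M Γ ∈ Words.totalFil 𝒞 deg (n + 2)}
  have hstep : ∀ n (s : S n), ∃ t : S (n + 1), t.1 - s.1 ∈ Words.totalFil 𝒞 deg (n + 2) := by
    rintro n ⟨Γ, h0, h1, hM⟩
    obtain ⟨x, hx, hxp, hxM⟩ := h.exists_improvement hdiv h0 h1 (by omega) hM
    exact ⟨⟨Γ + x, add_mem h0 hx, add_mem h1 (Words.fil_anti (by omega) hxp), hxM⟩,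
      by simpa using hxp⟩
  choose next hnext using hstep
  let s : ∀ n, S n := fun n => Nat.rec ⟨Γ₀, hΓ₀, hΓ₀1, hM₀⟩ next n
  have hs : ∀ n, (s (n + 1)).1 - (s n).1 ∈ Words.totalFil 𝒞 deg (n + 2) := fun n => hnext n (s n)
  have hstab : ∀ (w : List ι) (m n : ℕ), w.length ≤ m + 1 → m ≤ n →
      (s n).1.1 w = (s m).1.1 w := by
    intro w m n hw hmn
    induction n, hmn using Nat.le_induction with
    | base => rfl
    | succ n hmn ih =>
      rw [← ih]
      exact sub_eq_zero.1 (hs n w (by omega))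
  let φ : Words 𝒞 deg := fun w => (s w.length).1.1 w
  have hφ : φ ∈ Words.homog 𝒞 deg 0 := fun w => (s w.length).2.1 w
  let Γ : Words.total 𝒞 deg := ⟨φ, Words.mem_total_of_mem hφ⟩
  have hΓn : ∀ n, Γ - (s n).1 ∈ Words.totalFil 𝒞 deg (n + 2) := by
    intro n w hw
    refine sub_eq_zero.2 ?_
    rcases le_total n w.length with hn | hn
    · exact hstab w n w.length (by omega) hn
    · exact (hstab w w.length n (by omega) hn).symm
  refine ⟨Γ, hφ, ?_, fun i => ?_, ?_⟩
  · exact (s 0).2.2.1 [] (by simp)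
  · exact hstab [i] 0 1 (by simp) (by omega)
  · apply Subtype.ext
    apply Words.ext
    intro w
    have hmem : ∀ n, M Γ ∈ Words.totalFil 𝒞 deg (n + 2) := by
      intro n
      have e := master_add (B := B.words deg) (wordsConst 𝒞 deg ħ h.mem) (s n).1 (Γ - (s n).1)
      rw [add_sub_cancel, sub_eq_iff_eq_add] at e
      have hd : Γ - (s n).1 ∈ Words.gr 𝒞 deg 0 := sub_mem hφ (s n).2.1
      change (B.words deg).master (wordsConst 𝒞 deg ħ h.mem) Γ ∈ _
      rw [e]
      refine add_mem (add_mem (h.words_quantumD_mem_fil (hΓn n))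
        (Submodule.smul_mem _ _ (add_mem (add_mem ?_ ?_) ?_))) (s n).2.2.2
      · have := words_bracket_mem_fil (B := B) (q := n + 2) (s n).2.1 (Words.mem_fil_zero _) (hΓn n)
        rwa [zero_add] at this
      · exact words_bracket_mem_fil (B := B) (q := 0) hd (hΓn n) (Words.mem_fil_zero _)
      · exact words_bracket_mem_fil (B := B) (q := 0) hd (hΓn n) (Words.mem_fil_zero _)
    exact hmem w.length w (by omega)

/-! ### The formal parameter -/

/-- The degree of the formal parameter `ħ`. -/
def paramDeg : PUnit.{u + 1} → ℤ := fun _ => 0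

variable (𝒞) in
/-- The formal parameter `ħ`, as a power series in one letter. -/
def param : Words.total 𝒞 paramDeg :=
  ⟨fun w => match w with
    | [_] => 1
    | _ => 0, Words.mem_total_of_mem (n := 0) fun w => by
      match w with
      | [] => exact zero_mem _
      | [i] => exact SetLike.one_mem_graded 𝒞
      | i :: j :: w => exact zero_mem _⟩

theorem wordDeg_paramDeg (w : List PUnit.{u + 1}) : Words.wordDeg paramDeg w = 0 := by
  induction w with
  | nil => rfl
  | cons i w ih =>
    rw [Words.wordDeg_cons, ih]
    rfl

theorem param_mul_nil (φ : Words 𝒞 paramDeg) : ((param 𝒞).1 * φ) [] = 0 := zero_mul (φ [])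

theorem param_mul_cons (φ : Words 𝒞 paramDeg) (i : PUnit.{u + 1}) (w : List PUnit.{u + 1}) :
    ((param 𝒞).1 * φ) (i :: w) = ((w.length : k) + 1) • φ w := by
  have hder : ∀ (φ : Words 𝒞 paramDeg) i w,
      ((Words.der i (param 𝒞).1) * (Words.sign (paramDeg i) φ)) w = φ w := by
    intro φ i w
    have h1 : Words.der i (param 𝒞).1 = Words.const 1 := by
      apply Words.ext
      intro w
      cases w <;> rfl
    have h2 : Words.sign (paramDeg i) φ = φ := by
      apply Words.ext
      intro w
      have : gradeSign 𝒞 0 (φ w) = φ w := by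
        refine grade_induction (DirectSum.Decomposition.isInternal 𝒞)
          (p := fun a => gradeSign 𝒞 0 a = a) (by simp) (fun x y hx hy => by
            rw [map_add, hx, hy]) (fun i a ha => by
            rw [gradeSign_of_mem 0 ha]
            simp) _
      rw [Words.sign_apply, wordDeg_paramDeg, mul_zero, Int.negOnePow_zero, one_smul]
      exact this
    rw [h1, h2, Words.const_mul_apply, one_mul]
  induction w generalizing φ i with
  | nil =>
    rw [Words.mul_cons, hder, param_mul_nil]
    simp
  | cons j w ih =>
    rw [Words.mul_cons, hder, ih, Words.der_apply, List.length_cons]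
    push_cast
    rw [add_smul ((w.length : k) + 1) 1, one_smul]

theorem isParameter_param (B : DBVAlgebra 𝒞) :
    (B.words paramDeg).IsParameter (param 𝒞) where
  mem w := by
    change (param 𝒞).1 w ∈ _
    rw [wordDeg_paramDeg]
    match w with
    | [] => exact zero_mem _
    | [i] => exact SetLike.one_mem_graded 𝒞
    | i :: j :: w => exact zero_mem _
  Q_eq := Subtype.ext (Words.ext fun w => by
    match w with
    | [] => exact map_zero B.Q
    | [i] => exact B.Q_one
    | i :: j :: w => exact map_zero B.Q)
  Δ_mul x := by
    apply Subtype.ext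
    apply Words.ext
    intro w
    change B.Δ (((param 𝒞).1 * x.1) w) = ((param 𝒞).1 * Words.lift (𝒞' := 𝒞) B.Δ x.1) w
    cases w with
    | nil => rw [param_mul_nil, param_mul_nil, map_zero]
    | cons i w =>
      rw [param_mul_cons, param_mul_cons, map_smul]
      rfl

/-- If all classes of `Q` are represented in the kernel of `Δ`, then `ħ x = (Q + ħ Δ) z` implies
that `x` is exact: the constant term of `z` is a `Q`-cocycle, and after subtraction of a
representative `h` in the kernel of `Δ` and of a boundary, `z` is divisible by `ħ`. -/
theorem hasExactDivision_param [CharZero k] (B : DBVAlgebra 𝒞)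
    (hH : ∀ d, ∀ x ∈ 𝒞 d, B.Q x = 0 →
      ∃ h ∈ 𝒞 d, ∃ v ∈ 𝒞 (d - 1), B.Q h = 0 ∧ B.Δ h = 0 ∧ x = h + B.Q v) :
    (B.words paramDeg).HasExactDivision (param 𝒞) := by
  have hpar := isParameter_param B
  have hlen : ∀ n : ℕ, ((n : k) + 1) ≠ 0 := fun n => by exact_mod_cast Nat.succ_ne_zero n
  have hinj : ∀ x y : Words.total 𝒞 paramDeg, param 𝒞 * x = param 𝒞 * y → x = y := by
    intro x y hxy
    apply Subtype.ext
    apply Words.ext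
    intro w
    have h1 : ((param 𝒞).1 * x.1) (PUnit.unit :: w) = ((param 𝒞).1 * y.1) (PUnit.unit :: w) :=
      congrArg (fun z : Words.total 𝒞 paramDeg => z.1 (PUnit.unit :: w)) hxy
    rw [param_mul_cons, param_mul_cons] at h1
    exact smul_right_injective C (hlen w.length) h1
  intro n d x z hz hxz
  induction n generalizing z with
  | zero => exact ⟨z, hz, by simpa using hxz⟩
  | succ n ih =>
    rw [pow_succ', mul_assoc] at hxz
    -- the constant term of `z` is a cocycle, and can be removed without changing the boundary
    have hz0 : z.1 [] ∈ 𝒞 d := by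
      have := hz []
      rwa [Words.wordDeg_nil, add_zero] at this
    have hQz : B.Q (z.1 []) = 0 := by
      have h1 : ((param 𝒞).1 * (param 𝒞 ^ n * x).1) []
          = B.Q (z.1 []) + ((param 𝒞).1 * Words.lift (𝒞' := 𝒞) B.Δ z.1) [] :=
        congrArg (fun z : Words.total 𝒞 paramDeg => z.1 []) hxz
      rw [param_mul_nil, param_mul_nil, add_zero] at h1
      exact h1.symm
    obtain ⟨h, hh, v, hv, hQh, hΔh, hzh⟩ := hH d _ hz0 hQz
    let h' := wordsConst 𝒞 paramDeg h hh
    let v' := wordsConst 𝒞 paramDeg v hv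
    have hKh : (B.words paramDeg).quantumD (param 𝒞) h' = 0 := by
      have h1 : (B.words paramDeg).Q h' = 0 := Subtype.ext (Words.ext fun w => by
        cases w with
        | nil => exact hQh
        | cons i w => exact map_zero B.Q)
      have h2 : (B.words paramDeg).Δ h' = 0 := Subtype.ext (Words.ext fun w => by
        cases w with
        | nil => exact hΔh
        | cons i w => exact map_zero B.Δ)
      rw [quantumD_apply, h1, h2, mul_zero, add_zero]
    let z' := z - h' - (B.words paramDeg).quantumD (param 𝒞) v'
    have hz' : z' ∈ Words.gr 𝒞 paramDeg d := by
      refine sub_mem (sub_mem hz (Words.const_mem hh)) ?_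
      have := hpar.quantumD_mem (i := d - 1) (x := v') (Words.const_mem hv)
      rwa [sub_add_cancel] at this
    have hKz' : (B.words paramDeg).quantumD (param 𝒞) z'
        = (B.words paramDeg).quantumD (param 𝒞) z := by
      rw [map_sub, map_sub, hKh, hpar.quantumD_quantumD, sub_zero, sub_zero]
    have hz'0 : z'.1 [] = 0 := by
      change z.1 [] - h - (B.Q v + ((param 𝒞).1 * Words.lift (𝒞' := 𝒞) B.Δ v'.1) []) = 0
      rw [param_mul_nil, hzh]
      abel
    let ψ : Words 𝒞 paramDeg := fun w => ((w.length : k) + 1)⁻¹ • z'.1 (PUnit.unit :: w)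
    have hψ : ψ ∈ Words.homog 𝒞 paramDeg d := by
      intro w
      have := hz' (PUnit.unit :: w)
      refine Submodule.smul_mem _ _ ?_
      rw [wordDeg_paramDeg]
      rw [wordDeg_paramDeg] at this
      exact this
    let y : Words.total 𝒞 paramDeg := ⟨ψ, Words.mem_total_of_mem hψ⟩
    have hy : param 𝒞 * y = z' := by
      apply Subtype.ext
      apply Words.ext
      intro w
      cases w with
      | nil => exact (param_mul_nil ψ).trans hz'0.symm
      | cons i w => exact (param_mul_cons ψ i w).trans (smul_inv_smul₀ (hlen w.length) _)
    refine ih y hψ (hinj _ _ ?_)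
    rw [hxz, ← hKz', ← hy, hpar.quantumD_mul]

/-- The universal solution of the master equation: a power series whose linear part is given by
representatives in the kernels of `Q` and `Δ`. -/
theorem exists_universal_solution [CharZero k] (B : DBVAlgebra 𝒞)
    (hH : ∀ d, ∀ x ∈ 𝒞 d, B.Q x = 0 →
      ∃ h ∈ 𝒞 d, ∃ v ∈ 𝒞 (d - 1), B.Q h = 0 ∧ B.Δ h = 0 ∧ x = h + B.Q v)
    (e : ι → C) (he : ∀ i, e i ∈ 𝒞 (deg i)) (hQe : ∀ i, B.Q (e i) = 0)
    (hΔe : ∀ i, B.Δ (e i) = 0) :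
    ∃ Γ ∈ Words.gr 𝒞 deg 0, Γ.1 [] = 0 ∧ (∀ i, Γ.1 [i] = e i) ∧
      (B.words deg).Q Γ + (2 : k)⁻¹ • (B.words deg).bracket Γ Γ = 0 := by
  have hpar := isParameter_param B
  obtain ⟨Γ, hΓ, h0, h1, hM⟩ := hpar.exists_solution (deg := deg) (hasExactDivision_param B hH)
    (fun i => wordsConst 𝒞 paramDeg (e i) (he i)) (fun i => Words.const_mem (he i)) (fun i => by
      have h1 : (B.words paramDeg).Q (wordsConst 𝒞 paramDeg (e i) (he i)) = 0 :=
        Subtype.ext (Words.ext fun w => by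
          cases w with
          | nil => exact hQe i
          | cons i w => exact map_zero B.Q)
      have h2 : (B.words paramDeg).Δ (wordsConst 𝒞 paramDeg (e i) (he i)) = 0 :=
        Subtype.ext (Words.ext fun w => by
          cases w with
          | nil => exact hΔe i
          | cons i w => exact map_zero B.Δ)
      rw [quantumD_apply, h1, h2, mul_zero, add_zero])
  -- evaluation at `ħ = 0`
  let ev : Words.total 𝒞 (paramDeg.{u}) →ₗ[k] C :=
    { toFun := fun x => x.1 []
      map_add' := fun _ _ => rfl
      map_smul' := fun _ _ => rfl }
  have hev : ∀ i, ∀ x ∈ Words.gr 𝒞 paramDeg i, ev x ∈ 𝒞 (i + 0) := fun i x hx => hx []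
  have hev' : ∀ i, ∀ x ∈ Words.gr 𝒞 paramDeg i, ev x ∈ 𝒞 i := fun i x hx => by
    simpa using hev i x hx
  let F := Words.map (deg := deg) ev 0 hev
  have hF : ∀ x y, F (x * y) = F x * F y := fun x y =>
    Subtype.ext (Words.lift_mul hev' (fun _ _ => rfl) x.1 y.1)
  have hFQ : ∀ x, F (((B.words paramDeg).words deg).Q x) = (B.words deg).Q (F x) := fun _ => rfl
  have hFΔ : ∀ x, F (((B.words paramDeg).words deg).Δ x) = (B.words deg).Δ (F x) := fun _ => rfl
  have hFΓ : F Γ ∈ Words.gr 𝒞 deg 0 := by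
    have := Words.map_mem (deg := deg) hev hΓ
    rwa [add_zero] at this
  refine ⟨F Γ, hFΓ, congrArg ev h0, fun i => congrArg ev (h1 i), ?_⟩
  have hFħ : F (wordsConst (Words.gr 𝒞 paramDeg) deg (param 𝒞) hpar.mem) = 0 :=
    Subtype.ext (Words.ext fun w => by
      cases w with
      | nil => rfl
      | cons i w => rfl)
  have hFM := congrArg F hM
  rw [master, map_add, map_smul, quantumD_apply, map_add, hF, hFħ, zero_mul, add_zero, hFQ,
    ((B.words paramDeg).words deg).bracket_even (by decide) hΓ, map_sub, map_sub, hF, hF, hFΔ,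
    hFΔ, hF, map_zero, ← (B.words deg).bracket_even (by decide) hFΓ] at hFM
  exact hFM

end DBVAlgebra

/-! ### The path DGLA -/

theorem negOnePow_eq_ite (n : ℤ) : n.negOnePow = if Even n then 1 else -1 := by
  split_ifs with h
  · exact Int.negOnePow_even _ h
  · exact Int.negOnePow_odd _ (by simpa using h)

namespace DGLA

variable {k : Type u} [Field k]

theorem parity_mem (L : DGLA k) {i : ℤ} {x : L.carrier} (hx : x ∈ L.gr i) :
    L.parity x ∈ L.gr i := by
  rw [L.parity_of_mem hx]
  exact zunit_smul_mem _ _ hx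

theorem d_parity (L : DGLA k) (x : L.carrier) : L.d (L.parity x) = -L.parity (L.d x) := by
  refine grade_induction L.isInternal (p := fun x => L.d (L.parity x) = -L.parity (L.d x))
    (by simp) ?_ ?_ x
  · intro x y hx hy
    simp only [map_add, hx, hy]
    abel
  · intro i x hx
    rw [L.parity_of_mem hx, L.parity_of_mem (L.d_mem i x hx), Int.negOnePow_succ,
      map_zunit_smul, Units.neg_smul, neg_neg]

theorem Hom.map_parity {L M : DGLA k} (f : Hom L M) (x : L.carrier) :
    f.toLinearMap (L.parity x) = M.parity (f.toLinearMap x) :=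
  map_gradeScale L.isInternal M.isInternal _ f.map_mem x

/-- The composition of morphisms of DGLAs. -/
def Hom.comp {L M N : DGLA k} (g : Hom M N) (f : Hom L M) : Hom L N where
  toLinearMap := g.toLinearMap ∘ₗ f.toLinearMap
  map_mem i x hx := g.map_mem i _ (f.map_mem i x hx)
  map_d x := by simp only [LinearMap.comp_apply, f.map_d, g.map_d]
  map_bracket x y := by simp only [LinearMap.comp_apply, f.map_bracket, g.map_bracket]

/-- The data on a DGLA `A` that make it a model for paths in a formal moduli space with tangent
space `N`: an invertible derivation `D` of degree `0`, and for each `h` in `N` a right derivation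
`der h` of the bracket, whose commutator with the differential is the bracket with a cocycle
`c h` that is fixed by `D`. The degree of `der h` is `1` less than that of `h`. -/
structure PathData (A N : DGLA k) where
  D : A.carrier →ₗ[k] A.carrier
  D_mem : ∀ i, ∀ a ∈ A.gr i, D a ∈ A.gr i
  D_bracket : ∀ a b, D (A.bracket a b) = A.bracket (D a) b + A.bracket a (D b)
  D_d : ∀ a, D (A.d a) = A.d (D a)
  D_bijective : Function.Bijective D
  c : N.carrier →ₗ[k] A.carrier
  c_mem : ∀ n, ∀ h ∈ N.gr n, c h ∈ A.gr n
  d_c : ∀ h, A.d (c h) = 0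
  D_c : ∀ h, D (c h) = c h
  der : N.carrier →ₗ[k] A.carrier →ₗ[k] A.carrier
  der_mem : ∀ n i, ∀ h ∈ N.gr n, ∀ a ∈ A.gr i, der h a ∈ A.gr (i + (n - 1))
  der_bracket : ∀ n i j, ∀ h ∈ N.gr n, ∀ a ∈ A.gr i, ∀ b ∈ A.gr j,
    der h (A.bracket a b)
      = A.bracket a (der h b) + ((n - 1) * j).negOnePow • A.bracket (der h a) b
  d_der : ∀ n i, ∀ h ∈ N.gr n, ∀ a ∈ A.gr i,
    A.d (der h a) = der h (A.d a) + i.negOnePow • A.bracket a (c h)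

namespace PathData

variable {A N : DGLA k} (T : PathData A N)

/-- The derivations with the sign `(-1) ^ (|h| |a|)`. -/
def derSign : N.carrier →ₗ[k] A.carrier →ₗ[k] A.carrier :=
  T.der.compl₂ (gradeScale A.isInternal (fun i => if Even i then 1 else 0))
    + (T.der ∘ₗ N.parity).compl₂ (gradeScale A.isInternal (fun i => if Even i then 0 else 1))

theorem derSign_of_mem {n i : ℤ} {h : N.carrier} (hh : h ∈ N.gr n) {a : A.carrier}
    (ha : a ∈ A.gr i) : T.derSign h a = (n * i).negOnePow • T.der h a := by
  simp only [derSign, LinearMap.add_apply, LinearMap.compl₂_apply, LinearMap.comp_apply,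
    gradeScale_of_mem A.isInternal _ ha, N.parity_of_mem hh]
  by_cases hi : Even i
  · simp [hi, Int.negOnePow_even _ (hi.mul_left n)]
  · have hi' : Odd i := by simpa using hi
    have : (n * i).negOnePow = n.negOnePow := by
      rw [Int.negOnePow_eq_iff]
      simp only [parity_simps]
      grind
    rw [this]
    simp only [hi, if_false, zero_smul, one_smul, map_zero, zero_add, map_zunit_smul,
      zunit_smul_apply]

/-- The grading of the path DGLA. -/
def gr (_T : PathData A N) (n : ℤ) : Submodule k (A.carrier × A.carrier × N.carrier) :=
  (A.gr n).prod ((A.gr (n - 1)).prod (N.gr n))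

theorem isInternal_gr : DirectSum.IsInternal T.gr := by
  refine isInternal_of_proj ?_ (fun n => (gradeProj A.isInternal n).prodMap
    ((gradeProj A.isInternal (n - 1)).prodMap (gradeProj N.isInternal n))) ?_ ?_
  · rw [eq_top_iff]
    rintro ⟨a, b, h⟩ -
    have h1 : (a, 0, 0) ∈ ⨆ n, T.gr n := by
      refine grade_induction A.isInternal (p := fun a => (a, 0, 0) ∈ ⨆ n, T.gr n)
        (zero_mem _) ?_ ?_ a
      · intro x y hx hy
        simpa using add_mem hx hy
      · intro n x hx
        exact Submodule.mem_iSup_of_mem n ⟨hx, zero_mem _, zero_mem _⟩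
    have h2 : (0, b, 0) ∈ ⨆ n, T.gr n := by
      refine grade_induction A.isInternal (p := fun b => (0, b, 0) ∈ ⨆ n, T.gr n)
        (zero_mem _) ?_ ?_ b
      · intro x y hx hy
        simpa using add_mem hx hy
      · intro n x hx
        refine Submodule.mem_iSup_of_mem (n + 1) ⟨zero_mem _, ?_, zero_mem _⟩
        rwa [add_sub_cancel_right]
    have h3 : (0, 0, h) ∈ ⨆ n, T.gr n := by
      refine grade_induction N.isInternal (p := fun h => (0, 0, h) ∈ ⨆ n, T.gr n)
        (zero_mem _) ?_ ?_ h
      · intro x y hx hy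
        simpa using add_mem hx hy
      · intro n x hx
        exact Submodule.mem_iSup_of_mem n ⟨zero_mem _, zero_mem _, hx⟩
    simpa using add_mem (add_mem h1 h2) h3
  · rintro i ⟨a, b, h⟩ ⟨ha, hb, hh⟩
    simp only [LinearMap.prodMap_apply, gradeProj_of_mem A.isInternal ha,
      gradeProj_of_mem A.isInternal hb, gradeProj_of_mem N.isInternal hh]
  · rintro i j hij ⟨a, b, h⟩ ⟨ha, hb, hh⟩
    simp only [LinearMap.prodMap_apply, gradeProj_of_ne A.isInternal ha hij,
      gradeProj_of_ne A.isInternal hb (by omega : j - 1 ≠ i - 1),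
      gradeProj_of_ne N.isInternal hh hij]
    rfl

/-- The differential of the path DGLA. -/
def dPath : A.carrier × A.carrier × N.carrier →ₗ[k] A.carrier × A.carrier × N.carrier where
  toFun x := (A.d x.1, A.d x.2.1 + T.c x.2.2 + T.D (A.parity x.1), 0)
  map_add' x y := by
    ext <;> simp
    abel
  map_smul' r x := by
    ext <;> simp

/-- The bracket of the path DGLA. -/
def bracketPath : A.carrier × A.carrier × N.carrier →ₗ[k] A.carrier × A.carrier × N.carrier →ₗ[k]
    A.carrier × A.carrier × N.carrier :=
  LinearMap.mk₂ k
    (fun x y => (A.bracket x.1 y.1, A.bracket x.1 y.2.1 + A.bracket x.2.1 (A.parity y.1)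
      + T.der y.2.2 x.1 - T.derSign x.2.2 y.1, 0))
    (fun x x' y => by
      ext <;> simp
      abel)
    (fun r x y => by
      ext <;> simp [smul_sub])
    (fun x y y' => by
      ext <;> simp
      abel)
    (fun r x y => by
      ext <;> simp [smul_sub])

theorem dPath_of_mem {i : ℤ} {a b : A.carrier} {h : N.carrier} (ha : a ∈ A.gr i) :
    T.dPath (a, b, h) = (A.d a, A.d b + T.c h + i.negOnePow • T.D a, 0) := by
  rw [← map_zunit_smul, ← A.parity_of_mem ha]
  rfl

theorem bracketPath_of_mem {i j : ℤ} {x y : A.carrier × A.carrier × N.carrier} (hx : x ∈ T.gr i)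
    (hy : y ∈ T.gr j) : T.bracketPath x y = (A.bracket x.1 y.1, A.bracket x.1 y.2.1
      + j.negOnePow • A.bracket x.2.1 y.1 + T.der y.2.2 x.1
      - (i * j).negOnePow • T.der x.2.2 y.1, 0) := by
  rw [← T.derSign_of_mem hx.2.2 hy.1, ← map_zunit_smul, ← A.parity_of_mem hy.1]
  rfl

theorem dPath_mem {i : ℤ} {x : A.carrier × A.carrier × N.carrier} (hx : x ∈ T.gr i) :
    T.dPath x ∈ T.gr (i + 1) := by
  obtain ⟨h1, h2, h3⟩ := hx
  refine ⟨A.d_mem _ _ h1, ?_, zero_mem _⟩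
  rw [add_sub_cancel_right]
  refine add_mem (add_mem ?_ (T.c_mem _ _ h3)) (T.D_mem _ _ (A.parity_mem h1))
  have := A.d_mem _ _ h2
  rwa [sub_add_cancel] at this

theorem bracketPath_mem {i j : ℤ} {x y : A.carrier × A.carrier × N.carrier} (hx : x ∈ T.gr i)
    (hy : y ∈ T.gr j) : T.bracketPath x y ∈ T.gr (i + j) := by
  rw [T.bracketPath_of_mem hx hy]
  obtain ⟨h1, h2, h3⟩ := hx
  obtain ⟨h1', h2', h3'⟩ := hy
  refine ⟨A.bracket_mem _ _ _ h1 _ h1', ?_, zero_mem _⟩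
  have e1 := A.bracket_mem _ _ _ h1 _ h2'
  have e2 := A.bracket_mem _ _ _ h2 _ h1'
  have e3 := T.der_mem _ _ _ h3' _ h1
  have e4 := T.der_mem _ _ _ h3 _ h1'
  rw [← add_sub_assoc] at e1 e3 e4
  rw [sub_add_eq_add_sub] at e2
  rw [add_comm j i] at e4
  exact sub_mem (add_mem (add_mem e1 (zunit_smul_mem _ _ e2)) e3) (zunit_smul_mem _ _ e4)

theorem dPath_dPath (x : A.carrier × A.carrier × N.carrier) : T.dPath (T.dPath x) = 0 := by
  refine grade_induction T.isInternal_gr (p := fun x => T.dPath (T.dPath x) = 0) (by simp) ?_ ?_ x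
  · intro x y hx hy
    simp only [map_add, hx, hy, add_zero]
  · rintro i ⟨a, b, h⟩ ⟨ha, hb, hh⟩
    rw [T.dPath_of_mem ha, T.dPath_of_mem (A.d_mem _ _ ha)]
    simp only [map_add, map_zunit_smul, A.d_d, T.d_c, T.D_d, map_zero, Int.negOnePow_succ,
      Units.neg_smul]
    simp

theorem dPath_bracketPath (i : ℤ) (x : A.carrier × A.carrier × N.carrier) (hx : x ∈ T.gr i)
    (y : A.carrier × A.carrier × N.carrier) : T.dPath (T.bracketPath x y)
      = T.bracketPath (T.dPath x) y + i.negOnePow • T.bracketPath x (T.dPath y) := by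
  refine grade_induction T.isInternal_gr (p := fun y => T.dPath (T.bracketPath x y)
      = T.bracketPath (T.dPath x) y + i.negOnePow • T.bracketPath x (T.dPath y)) (by simp) ?_ ?_ y
  · intro y y' h h'
    simp only [map_add, h, h', smul_add]
    abel
  · intro j y hy
    rw [T.bracketPath_of_mem hx hy, T.bracketPath_of_mem (T.dPath_mem hx) hy,
      T.bracketPath_of_mem hx (T.dPath_mem hy)]
    obtain ⟨a, b, h⟩ := x
    obtain ⟨a', b', h'⟩ := y
    obtain ⟨ha, hb, hh⟩ := hx
    obtain ⟨ha', hb', hh'⟩ := hy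
    dsimp only at *
    rw [T.dPath_of_mem (A.bracket_mem _ _ _ ha _ ha'), T.dPath_of_mem ha, T.dPath_of_mem ha']
    have e1 := A.d_bracket i a ha b'
    have e2 := A.d_bracket (i - 1) b hb a'
    have e3 := T.d_der j i h' hh' a ha
    have e4 := T.d_der i j h hh a' ha'
    have e5 := A.skew j i a' ha' (T.c h) (T.c_mem i h hh)
    rw [e5] at e4
    refine Prod.ext (A.d_bracket i a ha a') (Prod.ext ?_ ?_)
    · simp only [map_add, map_sub, map_zunit_smul, e1, e2, e3, e4, T.D_bracket, map_zero,
        LinearMap.add_apply, LinearMap.zero_apply, zunit_smul_apply, Prod.snd_add, Prod.fst_add,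
        Prod.smul_snd, Prod.smul_fst, negOnePow_eq_ite, parity_simps]
      by_cases hi : Even i <;> by_cases hj : Even j <;>
        simp only [hi, hj, iff_true, iff_false, or_true, or_false, not_true, if_true, if_false, one_smul,
          Units.neg_smul, Int.not_even_one, smul_neg,
          neg_neg, smul_zero, iff_self] <;> abel
    · simp

theorem bracketPath_skew (i j : ℤ) (x : A.carrier × A.carrier × N.carrier) (hx : x ∈ T.gr i)
    (y : A.carrier × A.carrier × N.carrier) (hy : y ∈ T.gr j) :
    T.bracketPath x y = -((i * j).negOnePow • T.bracketPath y x) := by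
  rw [T.bracketPath_of_mem hx hy, T.bracketPath_of_mem hy hx]
  obtain ⟨a, b, h⟩ := x
  obtain ⟨a', b', h'⟩ := y
  obtain ⟨ha, hb, hh⟩ := hx
  obtain ⟨ha', hb', hh'⟩ := hy
  dsimp only at *
  have e1 := A.skew i (j - 1) a ha b' hb'
  have e2 := A.skew (i - 1) j b hb a' ha'
  refine Prod.ext (A.skew i j a ha a' ha') (Prod.ext ?_ ?_)
  · rw [e1, e2]
    simp only [Prod.snd_neg, Prod.fst_neg, Prod.smul_snd, Prod.smul_fst, negOnePow_eq_ite,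
      parity_simps]
    by_cases hi : Even i <;> by_cases hj : Even j <;>
      simp only [hi, hj, iff_false, or_true, or_false, not_true,
        if_true, if_false, one_smul,
          Units.neg_smul, Int.not_even_one, smul_neg,
        neg_neg, iff_self] <;> abel
  · simp

theorem bracketPath_jacobi (i j : ℤ) (x : A.carrier × A.carrier × N.carrier) (hx : x ∈ T.gr i)
    (y : A.carrier × A.carrier × N.carrier) (hy : y ∈ T.gr j)
    (z : A.carrier × A.carrier × N.carrier) :
    T.bracketPath x (T.bracketPath y z) = T.bracketPath (T.bracketPath x y) z
      + (i * j).negOnePow • T.bracketPath y (T.bracketPath x z) := by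
  refine grade_induction T.isInternal_gr (p := fun z =>
    T.bracketPath x (T.bracketPath y z) = T.bracketPath (T.bracketPath x y) z
      + (i * j).negOnePow • T.bracketPath y (T.bracketPath x z)) (by simp) ?_ ?_ z
  · intro z z' h h'
    simp only [map_add, h, h', smul_add]
    abel
  · intro l z hz
    rw [T.bracketPath_of_mem hx (T.bracketPath_mem hy hz),
      T.bracketPath_of_mem (T.bracketPath_mem hx hy) hz,
      T.bracketPath_of_mem hy (T.bracketPath_mem hx hz), T.bracketPath_of_mem hy hz,
      T.bracketPath_of_mem hx hy, T.bracketPath_of_mem hx hz]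
    obtain ⟨a, b, h⟩ := x
    obtain ⟨a', b', h'⟩ := y
    obtain ⟨a'', b'', h''⟩ := z
    obtain ⟨ha, hb, hh⟩ := hx
    obtain ⟨ha', hb', hh'⟩ := hy
    obtain ⟨ha'', hb'', hh''⟩ := hz
    dsimp only at *
    have e1 := A.jacobi i j a ha a' ha' b''
    have e2 := A.jacobi i (j - 1) a ha b' hb' a''
    have e3 := A.jacobi (i - 1) j b hb a' ha' a''
    have e4 := T.der_bracket l i j h'' hh'' a ha a' ha'
    have e5 := T.der_bracket j i l h' hh' a ha a'' ha''
    have e6 := T.der_bracket i j l h hh a' ha' a'' ha''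
    have e7 := A.skew (i + (l - 1)) j (T.der h'' a) (T.der_mem _ _ _ hh'' _ ha) a' ha'
    rw [e7] at e4
    refine Prod.ext (A.jacobi i j a ha a' ha' a'') (Prod.ext ?_ ?_)
    · simp only [map_add, map_sub, map_zunit_smul, e1, e2, e3, e4, e5, e6, map_zero,
        LinearMap.add_apply, LinearMap.sub_apply, LinearMap.zero_apply, zunit_smul_apply,
        Prod.snd_add, Prod.fst_add, Prod.smul_snd, Prod.smul_fst, negOnePow_eq_ite, parity_simps]
      by_cases hi : Even i <;> by_cases hj : Even j <;> by_cases hl : Even l <;>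
        simp only [hi, hj, hl, iff_true, iff_false, or_true, or_false, not_true,
          if_true, if_false, one_smul,
          Units.neg_smul, Int.not_even_one, smul_neg,
          neg_neg, smul_zero, iff_self] <;> abel
    · simp

/-- The path DGLA. Its elements `(a, b, h)` stand for `a + b ε + h`, where `ε` is a formal
differential form of degree `1` along the path. -/
def path : DGLA k where
  carrier := A.carrier × A.carrier × N.carrier
  gr := T.gr
  isInternal := T.isInternal_gr
  d := T.dPath
  bracket := T.bracketPath
  d_mem _ _ hx := T.dPath_mem hx
  bracket_mem _ _ _ hx _ hy := T.bracketPath_mem hx hy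
  d_d := T.dPath_dPath
  d_bracket := T.dPath_bracketPath
  skew := T.bracketPath_skew
  jacobi := T.bracketPath_jacobi

theorem path_d (a b : A.carrier) (h : N.carrier) :
    T.path.d (a, b, h) = (A.d a, A.d b + T.c h + T.D (A.parity a), 0) := rfl

/-- The projection of the path DGLA to `A`. -/
def toPath : Hom T.path A where
  toLinearMap := LinearMap.fst k _ _
  map_mem _ _ hx := hx.1
  map_d _ := rfl
  map_bracket _ _ := rfl

/-- The projection of the path DGLA to the tangent space. -/
def toTangent (hd : N.d = 0) (hb : N.bracket = 0) : Hom T.path N where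
  toLinearMap := LinearMap.snd k _ _ ∘ₗ LinearMap.snd k _ _
  map_mem _ _ hx := hx.2.2
  map_d x := by
    rw [hd]
    rfl
  map_bracket x y := by
    rw [hb]
    rfl

/-- The kernel of the projection to the tangent space is acyclic because `D` is bijective. -/
theorem isAcyclicFibration_toTangent (hd : N.d = 0) (hb : N.bracket = 0) :
    (T.toTangent hd hb).IsAcyclicFibration := by
  refine ⟨fun h => ⟨(0, 0, h), rfl⟩, ?_⟩
  rintro ⟨a, b, h⟩ hh hx
  obtain rfl : h = 0 := hh
  rw [path_d, map_zero, add_zero] at hx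
  have hb : A.d b + T.D (A.parity a) = 0 := congrArg (fun x => x.2.1) hx
  obtain ⟨v, rfl⟩ := T.D_bijective.2 b
  refine ⟨(A.parity v, 0, 0), rfl, ?_⟩
  have hv : A.d v + A.parity a = 0 := by
    apply T.D_bijective.1
    rw [map_add, T.D_d, hb, map_zero]
  rw [path_d, A.parity_parity, A.d_parity, eq_neg_of_add_eq_zero_left hv, map_neg,
    A.parity_parity, neg_neg, map_zero, map_zero, zero_add, zero_add]

/-- The path DGLA is an acyclic fibration over a quotient `L` of `A` if the cocycles `c h` map
to representatives of the cohomology classes of `L`. -/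
theorem isAcyclicFibration_comp_toPath (hd : N.d = 0) (hb : N.bracket = 0) {L : DGLA k}
    (g : Hom A L) (hg : Function.Surjective g.toLinearMap)
    (h1 : ∀ h y, L.d y = g.toLinearMap (T.c h) → h = 0)
    (h2 : ∀ y, L.d y = 0 → ∃ h z, y = g.toLinearMap (T.c h) + L.d z) :
    (g.comp T.toPath).IsAcyclicFibration := by
  -- the cocycle of the path DGLA that lifts a tangent vector
  have hr : ∀ h, T.path.d (-A.parity (T.c h), 0, h) = 0 := by
    intro h
    rw [path_d, map_neg, map_neg, map_neg, A.parity_parity, A.d_parity, T.d_c, T.D_c, map_zero,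
      map_zero, neg_zero, neg_zero, zero_add, add_neg_cancel]
    rfl
  refine Hom.isAcyclicFibration_of_cocycles _ (fun y => ?_) ?_ ?_
  · obtain ⟨a, rfl⟩ := hg y
    exact ⟨(a, 0, 0), rfl⟩
  · rintro ⟨a, b, h⟩ hx ⟨y, hy⟩
    have hxr : T.path.d ((a, b, h) - (-A.parity (T.c h), 0, h)) = 0 :=
      (map_sub T.path.d _ _).trans (by rw [hx, hr, sub_zero])
    obtain ⟨z, -, hz⟩ := (T.isAcyclicFibration_toTangent hd hb).acyclic _ (sub_self h) hxr
    have hgz : L.d (g.toLinearMap z.1) = L.d y + L.parity (g.toLinearMap (T.c h)) := by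
      have e1 : A.d z.1 = a - -A.parity (T.c h) := congrArg Prod.fst hz
      have e2 : L.d y = g.toLinearMap a := hy
      rw [← g.map_d, e1, map_sub, map_neg, g.map_parity, e2, sub_neg_eq_add]
    have h0 : h = 0 := by
      refine h1 h (-L.parity (g.toLinearMap z.1 - y)) ?_
      rw [map_neg, L.d_parity, map_sub, hgz, add_sub_cancel_left, L.parity_parity, neg_neg]
    refine ⟨z, hz.trans ?_⟩
    rw [h0, map_zero, map_zero, neg_zero]
    exact sub_zero _
  · intro y hy
    obtain ⟨h, z, hz⟩ := h2 (-L.parity y) (by rw [map_neg, L.d_parity, hy]; simp)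
    refine ⟨(-A.parity (T.c h), 0, h), L.parity z, hr h, ?_⟩
    change y = g.toLinearMap (-A.parity (T.c h)) + L.d (L.parity z)
    rw [map_neg, g.map_parity, L.d_parity, ← neg_add, ← map_add, ← hz, map_neg, neg_neg,
      L.parity_parity]

end PathData

end DGLA

/-! ### Twisted and polynomial DGLAs -/

namespace DGLA

variable {k : Type u} [Field k]

/-- The DGLA `L` with the differential `d + [γ, ·]`, for a Maurer-Cartan element `γ`. -/
def twist [CharZero k] (L : DGLA k) (γ : L.carrier) (hγ : γ ∈ L.gr 1)
    (hMC : L.d γ + (2 : k)⁻¹ • L.bracket γ γ = 0) : DGLA k where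
  carrier := L.carrier
  gr := L.gr
  isInternal := L.isInternal
  d := L.d + L.bracket γ
  bracket := L.bracket
  d_mem i x hx := by
    refine add_mem (L.d_mem i x hx) ?_
    have := L.bracket_mem _ _ _ hγ _ hx
    rwa [add_comm] at this
  bracket_mem := L.bracket_mem
  d_d x := by
    have h1 := L.jacobi 1 1 γ hγ γ hγ x
    have h2 := L.d_bracket 1 γ hγ x
    have h3 : L.bracket γ (L.bracket γ x) = (2 : k)⁻¹ • L.bracket (L.bracket γ γ) x := by
      rw [mul_one, Int.negOnePow_one, Units.neg_smul, one_smul, ← sub_eq_add_neg,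
        eq_sub_iff_add_eq, ← two_smul k] at h1
      rw [← h1, inv_smul_smul₀ two_ne_zero]
    have h4 : L.bracket (L.d γ + (2 : k)⁻¹ • L.bracket γ γ) x = 0 := by
      rw [hMC, map_zero, LinearMap.zero_apply]
    rw [map_add, map_smul, LinearMap.add_apply, LinearMap.smul_apply] at h4
    simp only [LinearMap.add_apply, map_add, L.d_d, h2, h3, Int.negOnePow_one, Units.neg_smul,
      one_smul]
    refine Eq.trans ?_ h4
    abel
  d_bracket i x hx y := by
    have h := L.jacobi 1 i γ hγ x hx y
    rw [one_mul] at h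
    simp only [LinearMap.add_apply, map_add, L.d_bracket i x hx, h, smul_add]
    abel
  skew := L.skew
  jacobi := L.jacobi

open Polynomial in
/-- The product `X f g` on `k[X]`, that is, the product of `X k[X]` transported to `k[X]` by
`f ↦ X f`. -/
def mulX (k : Type u) [Field k] : k[X] →ₗ[k] k[X] →ₗ[k] k[X] :=
  (LinearMap.mul k k[X]).compr₂ (LinearMap.mulLeft k X)

open Polynomial in
theorem mulX_apply (f g : k[X]) : mulX k f g = X * (f * g) := rfl

section Poly

open Polynomial

variable (L : DGLA k)

/-- The grading of `L ⊗ k[X]`. -/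
def polyGr (n : ℤ) : Submodule k (L.carrier ⊗[k] k[X]) :=
  Submodule.span k {z | ∃ x ∈ L.gr n, ∃ f, z = x ⊗ₜ f}

variable {L}

theorem polyGr_induction {n : ℤ} {p : L.carrier ⊗[k] k[X] → Prop} (h0 : p 0)
    (hadd : ∀ x y, p x → p y → p (x + y)) (hsmul : ∀ (c : k) x, p x → p (c • x))
    (hp : ∀ x ∈ L.gr n, ∀ f, p (x ⊗ₜ f)) {z} (hz : z ∈ L.polyGr n) : p z := by
  refine Submodule.span_induction (p := fun z _ => p z) ?_ h0 (fun x y _ _ => hadd x y)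
    (fun c x _ => hsmul c x) hz
  rintro _ ⟨x, hx, f, rfl⟩
  exact hp x hx f

theorem tmul_mem_polyGr {n : ℤ} {x : L.carrier} (hx : x ∈ L.gr n) (f : k[X]) :
    x ⊗ₜ f ∈ L.polyGr n := Submodule.subset_span ⟨x, hx, f, rfl⟩

theorem map_mem_polyGr {M : DGLA k} {n m : ℤ} {f : L.carrier →ₗ[k] M.carrier}
    (hf : ∀ x ∈ L.gr n, f x ∈ M.gr m) (g : k[X] →ₗ[k] k[X]) {z} (hz : z ∈ L.polyGr n) :
    TensorProduct.map f g z ∈ M.polyGr m := by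
  refine polyGr_induction (p := fun z => TensorProduct.map f g z ∈ M.polyGr m) ?_ ?_ ?_ ?_ hz
  · rw [map_zero]
    exact zero_mem _
  · intro x y hx hy
    rw [map_add]
    exact add_mem hx hy
  · intro c x hx
    rw [map_smul]
    exact Submodule.smul_mem _ c hx
  · intro x hx p
    exact tmul_mem_polyGr (hf x hx) _

variable (L)

theorem isInternal_polyGr : DirectSum.IsInternal L.polyGr := by
  refine isInternal_of_proj ?_ (fun n => (gradeProj L.isInternal n).rTensor k[X]) ?_ ?_
  · rw [eq_top_iff]
    rintro z -
    induction z using TensorProduct.induction_on with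
    | zero => exact zero_mem _
    | add x y hx hy => exact add_mem hx hy
    | tmul x f =>
      refine grade_induction L.isInternal (p := fun x => x ⊗ₜ f ∈ ⨆ n, L.polyGr n) ?_ ?_ ?_ x
      · rw [TensorProduct.zero_tmul]
        exact zero_mem _
      · intro x y hx hy
        rw [TensorProduct.add_tmul]
        exact add_mem hx hy
      · intro n x hx
        exact Submodule.mem_iSup_of_mem n (tmul_mem_polyGr hx f)
  · intro i z hz
    refine polyGr_induction (p := fun z => (gradeProj L.isInternal i).rTensor k[X] z = z)
      (map_zero _) (fun x y hx hy => by rw [map_add, hx, hy])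
      (fun c x hx => by rw [map_smul, hx]) (fun x hx f => ?_) hz
    rw [LinearMap.rTensor_tmul, gradeProj_of_mem _ hx]
  · intro i j hij z hz
    refine polyGr_induction (p := fun z => (gradeProj L.isInternal i).rTensor k[X] z = 0)
      (map_zero _) (fun x y hx hy => by rw [map_add, hx, hy, add_zero])
      (fun c x hx => by rw [map_smul, hx, smul_zero]) (fun x hx f => ?_) hz
    rw [LinearMap.rTensor_tmul, gradeProj_of_ne _ hx hij, TensorProduct.zero_tmul]

/-- The DGLA `L ⊗ X k[X]` of the polynomial paths in `L` that start at `0`. Its elements are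
written as `X` times an element of `L ⊗ k[X]`. -/
def poly : DGLA k where
  carrier := L.carrier ⊗[k] k[X]
  gr := L.polyGr
  isInternal := L.isInternal_polyGr
  d := L.d.rTensor k[X]
  bracket := TensorProduct.map₂ L.bracket (mulX k)
  d_mem i z hz := map_mem_polyGr (L.d_mem i) LinearMap.id hz
  bracket_mem i j z hz w hw := by
    refine polyGr_induction
      (p := fun z => TensorProduct.map₂ L.bracket (mulX k) z w ∈ L.polyGr (i + j)) ?_ ?_ ?_ ?_ hz
    · simp
    · intro x y hx hy
      rw [map_add]
      exact add_mem hx hy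
    · intro c x hx
      rw [map_smul]
      exact Submodule.smul_mem _ c hx
    intro x hx f
    refine polyGr_induction (p := fun w =>
      TensorProduct.map₂ L.bracket (mulX k) (x ⊗ₜ f) w ∈ L.polyGr (i + j)) ?_ ?_ ?_ ?_ hw
    · simp
    · intro x y hx hy
      rw [map_add]
      exact add_mem hx hy
    · intro c x hx
      rw [map_smul]
      exact Submodule.smul_mem _ c hx
    intro y hy g
    exact tmul_mem_polyGr (L.bracket_mem i j x hx y hy) _
  d_d z := by
    induction z using TensorProduct.induction_on with
    | zero => simp
    | add x y hx hy => rw [map_add, map_add, hx, hy, add_zero]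
    | tmul x f => rw [LinearMap.rTensor_tmul, LinearMap.rTensor_tmul, L.d_d, TensorProduct.zero_tmul]
  d_bracket i z hz w := by
    refine polyGr_induction (p := fun z => L.d.rTensor k[X] (TensorProduct.map₂ L.bracket (mulX k) z w)
      = TensorProduct.map₂ L.bracket (mulX k) (L.d.rTensor k[X] z) w
        + i.negOnePow • TensorProduct.map₂ L.bracket (mulX k) z (L.d.rTensor k[X] w)) ?_ ?_ ?_ ?_ hz
    · simp
    · intro x y hx hy
      simp only [map_add, LinearMap.add_apply, hx, hy, smul_add]
      abel
    · intro c x hx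
      simp only [map_smul, LinearMap.smul_apply, hx, smul_add, smul_comm c]
    intro x hx f
    induction w using TensorProduct.induction_on with
    | zero => simp
    | add y z hy hz =>
      simp only [map_add, hy, hz, smul_add]
      abel
    | tmul y g =>
      simp only [TensorProduct.map₂_apply_tmul, TensorProduct.map_tmul, LinearMap.rTensor_tmul,
        L.d_bracket i x hx,
        TensorProduct.add_tmul, zunit_smul_tmul]
  skew i j z hz w hw := by
    refine polyGr_induction (p := fun z => TensorProduct.map₂ L.bracket (mulX k) z w
      = -((i * j).negOnePow • TensorProduct.map₂ L.bracket (mulX k) w z)) ?_ ?_ ?_ ?_ hz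
    · simp
    · intro x y hx hy
      simp only [map_add, LinearMap.add_apply, hx, hy, smul_add, neg_add]
    · intro c x hx
      simp only [map_smul, LinearMap.smul_apply, hx, smul_neg, smul_comm c]
    intro x hx f
    refine polyGr_induction (p := fun w => TensorProduct.map₂ L.bracket (mulX k) (x ⊗ₜ f) w
      = -((i * j).negOnePow • TensorProduct.map₂ L.bracket (mulX k) w (x ⊗ₜ f))) ?_ ?_ ?_ ?_ hw
    · simp
    · intro x y hx hy
      simp only [map_add, LinearMap.add_apply, hx, hy, smul_add, neg_add]
    · intro c x hx
      simp only [map_smul, LinearMap.smul_apply, hx, smul_neg, smul_comm c]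
    intro y hy g
    rw [TensorProduct.map₂_apply_tmul, TensorProduct.map₂_apply_tmul, TensorProduct.map_tmul,
      TensorProduct.map_tmul, L.skew i j x hx y hy,
      TensorProduct.neg_tmul, zunit_smul_tmul, mulX_apply, mulX_apply, mul_comm f g]
  jacobi i j z hz w hw v := by
    refine polyGr_induction (p := fun z => TensorProduct.map₂ L.bracket (mulX k) z
        (TensorProduct.map₂ L.bracket (mulX k) w v)
      = TensorProduct.map₂ L.bracket (mulX k) (TensorProduct.map₂ L.bracket (mulX k) z w) v
        + (i * j).negOnePow • TensorProduct.map₂ L.bracket (mulX k) w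
          (TensorProduct.map₂ L.bracket (mulX k) z v)) ?_ ?_ ?_ ?_ hz
    · simp
    · intro x y hx hy
      simp only [map_add, LinearMap.add_apply, hx, hy, smul_add]
      abel
    · intro c x hx
      simp only [map_smul, LinearMap.smul_apply, hx, smul_add, smul_comm c]
    intro x hx f
    refine polyGr_induction (p := fun w => TensorProduct.map₂ L.bracket (mulX k) (x ⊗ₜ f)
        (TensorProduct.map₂ L.bracket (mulX k) w v)
      = TensorProduct.map₂ L.bracket (mulX k) (TensorProduct.map₂ L.bracket (mulX k) (x ⊗ₜ f) w) v
        + (i * j).negOnePow • TensorProduct.map₂ L.bracket (mulX k) w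
          (TensorProduct.map₂ L.bracket (mulX k) (x ⊗ₜ f) v)) ?_ ?_ ?_ ?_ hw
    · simp
    · intro x y hx hy
      simp only [map_add, LinearMap.add_apply, hx, hy, smul_add]
      abel
    · intro c x hx
      simp only [map_smul, LinearMap.smul_apply, hx, smul_add, smul_comm c]
    intro y hy g
    induction v using TensorProduct.induction_on with
    | zero => simp
    | add y z hy hz =>
      simp only [map_add, hy, hz, smul_add]
      abel
    | tmul z h =>
      simp only [TensorProduct.map₂_apply_tmul, TensorProduct.map_tmul, mulX_apply]
      rw [L.jacobi i j x hx y hy z, TensorProduct.add_tmul, zunit_smul_tmul]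
      congr 3 <;> ring

/-- The evaluation at `X = 1`. -/
def evalOne (V : Type u) [AddCommGroup V] [Module k V] : V ⊗[k] k[X] →ₗ[k] V :=
  (TensorProduct.rid k V).toLinearMap ∘ₗ (leval (1 : k)).lTensor V

theorem evalOne_tmul {V : Type u} [AddCommGroup V] [Module k V] (x : V) (f : k[X]) :
    evalOne V (x ⊗ₜ f) = f.eval 1 • x := by
  simp [evalOne]

theorem evalOne_map₂ (z w : L.carrier ⊗[k] k[X]) :
    evalOne L.carrier (TensorProduct.map₂ L.bracket (mulX k) z w)
      = L.bracket (evalOne L.carrier z) (evalOne L.carrier w) := by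
  induction z using TensorProduct.induction_on with
  | zero => simp
  | add x y hx hy => simp only [map_add, LinearMap.add_apply, hx, hy]
  | tmul x f =>
    induction w using TensorProduct.induction_on with
    | zero => simp
    | add x y hx hy => simp only [map_add, hx, hy]
    | tmul y g =>
      simp only [TensorProduct.map₂_apply_tmul, TensorProduct.map_tmul, evalOne_tmul, mulX_apply,
        eval_mul, eval_X, one_mul, map_smul, LinearMap.smul_apply, smul_smul]
      rw [mul_comm]

/-- The end point of a path. -/
def polyEval : Hom L.poly L where
  toLinearMap := evalOne L.carrier
  map_mem i z hz := by
    refine polyGr_induction (p := fun z => evalOne L.carrier z ∈ L.gr i) ?_ ?_ ?_ ?_ hz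
    · rw [map_zero]
      exact zero_mem _
    · intro x y hx hy
      rw [map_add]
      exact add_mem hx hy
    · intro c x hx
      rw [map_smul]
      exact Submodule.smul_mem _ c hx
    · intro x hx f
      rw [evalOne_tmul]
      exact Submodule.smul_mem _ _ hx
  map_d z := by
    refine TensorProduct.induction_on (motive := fun z : L.carrier ⊗[k] k[X] =>
      evalOne L.carrier (L.d.rTensor k[X] z) = L.d (evalOne L.carrier z)) z (by simp) ?_ ?_
    · intro x f
      rw [LinearMap.rTensor_tmul, evalOne_tmul, evalOne_tmul, map_smul]
    · intro x y hx hy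
      rw [map_add, map_add, map_add, map_add, hx, hy]
  map_bracket := L.evalOne_map₂

theorem polyEval_tmul (x : L.carrier) (f : k[X]) :
    L.polyEval.toLinearMap (x ⊗ₜ f) = f.eval 1 • x := evalOne_tmul x f

end Poly

end DGLA

/-! ### Paths in a formal moduli space -/

namespace DGLA

variable {k : Type u} [Field k]

open Polynomial

/-- The operator `f ↦ (X f)'`, that is, the Euler derivation of `X k[X]`. -/
def euler (k : Type u) [Field k] : k[X] →ₗ[k] k[X] :=
  derivative ∘ₗ LinearMap.mulLeft k X

theorem euler_apply (f : k[X]) : euler k f = derivative (X * f) := rfl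

theorem euler_mulX (f g : k[X]) :
    euler k (mulX k f g) = mulX k (euler k f) g + mulX k f (euler k g) := by
  simp only [euler_apply, mulX_apply, derivative_mul, derivative_X]
  ring

theorem euler_coeff (f : k[X]) (n : ℕ) : (euler k f).coeff n = f.coeff n * (n + 1) := by
  rw [euler_apply, coeff_derivative, coeff_X_mul]

theorem euler_bijective [CharZero k] : Function.Bijective (euler k) := by
  have hn : ∀ n : ℕ, (n : k) + 1 ≠ 0 := fun n => by exact_mod_cast Nat.succ_ne_zero n
  constructor
  · rw [injective_iff_map_eq_zero]
    intro f hf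
    ext n
    have := euler_coeff f n
    rw [hf, coeff_zero] at this
    simpa [hn n] using this.symm
  · intro f
    induction f using Polynomial.induction_on' with
    | add p q hp hq =>
      obtain ⟨p, rfl⟩ := hp
      obtain ⟨q, rfl⟩ := hq
      exact ⟨p + q, map_add _ _ _⟩
    | monomial n a =>
      refine ⟨monomial n (a / (n + 1)), ?_⟩
      ext m
      rw [euler_coeff, coeff_monomial, coeff_monomial]
      split_ifs with h
      · rw [← h, div_mul_cancel₀ _ (hn n)]
      · simp

section PathData

variable {L N : DGLA k}

/-- Right derivations on a DGLA whose commutators with the differential are the brackets with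
cocycles give rise to path data on the DGLA of polynomial paths. -/
def polyPathData [CharZero k] (c : N.carrier →ₗ[k] L.carrier) (c_mem : ∀ n, ∀ h ∈ N.gr n, c h ∈ L.gr n)
    (d_c : ∀ h, L.d (c h) = 0) (der : N.carrier →ₗ[k] L.carrier →ₗ[k] L.carrier)
    (der_mem : ∀ n i, ∀ h ∈ N.gr n, ∀ a ∈ L.gr i, der h a ∈ L.gr (i + (n - 1)))
    (der_bracket : ∀ n i j, ∀ h ∈ N.gr n, ∀ a ∈ L.gr i, ∀ b ∈ L.gr j,
      der h (L.bracket a b)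
        = L.bracket a (der h b) + ((n - 1) * j).negOnePow • L.bracket (der h a) b)
    (d_der : ∀ n i, ∀ h ∈ N.gr n, ∀ a ∈ L.gr i,
      L.d (der h a) = der h (L.d a) + i.negOnePow • L.bracket a (c h)) :
    PathData L.poly N where
  D := (euler k).lTensor L.carrier
  D_mem i a ha := map_mem_polyGr (f := LinearMap.id) (fun _ h => h) (euler k) ha
  D_bracket a b := by
    change (euler k).lTensor L.carrier (TensorProduct.map₂ L.bracket (mulX k) a b)
      = TensorProduct.map₂ L.bracket (mulX k) ((euler k).lTensor L.carrier a) b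
        + TensorProduct.map₂ L.bracket (mulX k) a ((euler k).lTensor L.carrier b)
    change L.carrier ⊗[k] k[X] at a b
    induction a using TensorProduct.induction_on with
    | zero => simp
    | add x y hx hy =>
      simp only [map_add, LinearMap.add_apply, hx, hy]
      abel
    | tmul x f =>
      induction b using TensorProduct.induction_on with
      | zero => simp
      | add x y hx hy =>
        simp only [map_add, hx, hy]
        abel
      | tmul y g =>
        simp only [TensorProduct.map₂_apply_tmul, TensorProduct.map_tmul, LinearMap.lTensor_tmul,
          euler_mulX, TensorProduct.tmul_add]
  D_d a := by
    change (euler k).lTensor L.carrier (L.d.rTensor k[X] a)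
      = L.d.rTensor k[X] ((euler k).lTensor L.carrier a)
    change L.carrier ⊗[k] k[X] at a
    rw [← LinearMap.comp_apply, ← LinearMap.comp_apply, LinearMap.lTensor_comp_rTensor,
      LinearMap.rTensor_comp_lTensor]
  D_bijective := ((LinearEquiv.ofBijective (euler k) euler_bijective).lTensor L.carrier).bijective
  c := (TensorProduct.mk k L.carrier k[X]).flip 1 ∘ₗ c
  c_mem n h hh := tmul_mem_polyGr (c_mem n h hh) 1
  d_c h := by
    change L.d (c h) ⊗ₜ[k] (1 : k[X]) = 0
    rw [d_c, TensorProduct.zero_tmul]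
  D_c h := by
    change c h ⊗ₜ[k] (euler k 1) = c h ⊗ₜ[k] 1
    rw [euler_apply, mul_one, derivative_X]
  der :=
    { toFun := fun h => TensorProduct.map (der h) (LinearMap.mulLeft k X)
      map_add' := fun h h' => (congrArg (fun φ => TensorProduct.map φ (LinearMap.mulLeft k X))
        (map_add der h h')).trans (TensorProduct.map_add_left _ _ _)
      map_smul' := fun r h => (congrArg (fun φ => TensorProduct.map φ (LinearMap.mulLeft k X))
        (map_smul der r h)).trans (TensorProduct.map_smul_left _ _ _) }
  der_mem n i h hh a ha := map_mem_polyGr (der_mem n i h hh) _ ha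
  der_bracket n i j h hh a ha b hb := by
    change L.carrier ⊗[k] k[X] at a b
    change a ∈ L.polyGr i at ha
    change b ∈ L.polyGr j at hb
    change TensorProduct.map (der h) (LinearMap.mulLeft k X) (TensorProduct.map₂ L.bracket (mulX k) a b)
      = TensorProduct.map₂ L.bracket (mulX k) a (TensorProduct.map (der h) (LinearMap.mulLeft k X) b)
        + ((n - 1) * j).negOnePow • TensorProduct.map₂ L.bracket (mulX k)
          (TensorProduct.map (der h) (LinearMap.mulLeft k X) a) b
    refine polyGr_induction (p := fun a => TensorProduct.map (der h) (LinearMap.mulLeft k X)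
      (TensorProduct.map₂ L.bracket (mulX k) a b)
      = TensorProduct.map₂ L.bracket (mulX k) a (TensorProduct.map (der h) (LinearMap.mulLeft k X) b)
        + ((n - 1) * j).negOnePow • TensorProduct.map₂ L.bracket (mulX k)
          (TensorProduct.map (der h) (LinearMap.mulLeft k X) a) b) ?_ ?_ ?_ ?_ ha
    · simp
    · intro x y hx hy
      simp only [map_add, LinearMap.add_apply, hx, hy, smul_add]
      abel
    · intro r x hx
      simp only [map_smul, LinearMap.smul_apply, hx, smul_add, smul_comm r]
    intro x hx f
    refine polyGr_induction (p := fun b => TensorProduct.map (der h) (LinearMap.mulLeft k X)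
      (TensorProduct.map₂ L.bracket (mulX k) (x ⊗ₜ f) b)
      = TensorProduct.map₂ L.bracket (mulX k) (x ⊗ₜ f)
          (TensorProduct.map (der h) (LinearMap.mulLeft k X) b)
        + ((n - 1) * j).negOnePow • TensorProduct.map₂ L.bracket (mulX k)
          (TensorProduct.map (der h) (LinearMap.mulLeft k X) (x ⊗ₜ f)) b) ?_ ?_ ?_ ?_ hb
    · simp
    · intro x y hx hy
      simp only [map_add, hx, hy, smul_add]
      abel
    · intro r x hx
      simp only [map_smul, hx, smul_add, smul_comm r]
    intro y hy g
    simp only [TensorProduct.map₂_apply_tmul, TensorProduct.map_tmul, mulX_apply,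
      LinearMap.mulLeft_apply, der_bracket n i j h hh x hx y hy, TensorProduct.add_tmul,
      zunit_smul_tmul]
    congr 3 <;> ring
  d_der n i h hh a ha := by
    change L.carrier ⊗[k] k[X] at a
    change a ∈ L.polyGr i at ha
    change L.d.rTensor k[X] (TensorProduct.map (der h) (LinearMap.mulLeft k X) a)
      = TensorProduct.map (der h) (LinearMap.mulLeft k X) (L.d.rTensor k[X] a)
        + i.negOnePow • TensorProduct.map₂ L.bracket (mulX k) a (c h ⊗ₜ 1)
    refine polyGr_induction (p := fun a =>
      L.d.rTensor k[X] (TensorProduct.map (der h) (LinearMap.mulLeft k X) a)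
      = TensorProduct.map (der h) (LinearMap.mulLeft k X) (L.d.rTensor k[X] a)
        + i.negOnePow • TensorProduct.map₂ L.bracket (mulX k) a (c h ⊗ₜ 1)) ?_ ?_ ?_ ?_ ha
    · simp
    · intro x y hx hy
      simp only [map_add, LinearMap.add_apply, hx, hy, smul_add]
      abel
    · intro r x hx
      simp only [map_smul, LinearMap.smul_apply, hx, smul_add, smul_comm r]
    intro x hx f
    simp only [TensorProduct.map₂_apply_tmul, TensorProduct.map_tmul, mulX_apply,
      LinearMap.mulLeft_apply, LinearMap.rTensor_tmul, d_der n i h hh x hx, TensorProduct.add_tmul,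
      zunit_smul_tmul, mul_one]

end PathData

/-- For right derivations of a DGLA that commute with the differential, the derivatives of a
Maurer-Cartan element are cocycles for the twisted differential, and they measure by how much
the derivations fail to commute with it. -/
theorem d_der_twist [CharZero k] {L N : DGLA k} {γ : L.carrier} (hγ : γ ∈ L.gr 1)
    (hMC : L.d γ + (2 : k)⁻¹ • L.bracket γ γ = 0)
    (der : N.carrier →ₗ[k] L.carrier →ₗ[k] L.carrier)
    (der_mem : ∀ n i, ∀ h ∈ N.gr n, ∀ a ∈ L.gr i, der h a ∈ L.gr (i + (n - 1)))
    (der_bracket : ∀ n i j, ∀ h ∈ N.gr n, ∀ a ∈ L.gr i, ∀ b ∈ L.gr j,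
      der h (L.bracket a b)
        = L.bracket a (der h b) + ((n - 1) * j).negOnePow • L.bracket (der h a) b)
    (d_der : ∀ h a, L.d (der h a) = der h (L.d a)) :
    (∀ h, (L.twist γ hγ hMC).d (der h γ) = 0) ∧
    ∀ n i, ∀ h ∈ N.gr n, ∀ a ∈ L.gr i, (L.twist γ hγ hMC).d (der h a)
      = der h ((L.twist γ hγ hMC).d a) + i.negOnePow • L.bracket a (der h γ) := by
  constructor
  · intro h
    refine grade_induction N.isInternal
      (p := fun h => L.d (der h γ) + L.bracket γ (der h γ) = 0) (by simp) ?_ ?_ h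
    · intro x y hx hy
      rw [map_add, LinearMap.add_apply, map_add, map_add, add_add_add_comm, hx, hy, add_zero]
    · intro n h hh
      have hγ' := der_mem n 1 h hh γ hγ
      have e1 := der_bracket n 1 1 h hh γ hγ γ hγ
      have e2 := L.skew _ _ _ hγ' _ hγ
      have e3 : der h (L.d γ) + (2 : k)⁻¹ • der h (L.bracket γ γ) = 0 := by
        rw [← map_smul, ← map_add, hMC, map_zero]
      have e4 : der h (L.bracket γ γ) = (2 : k) • L.bracket γ (der h γ) := by
        rw [e1, e2, smul_neg, smul_smul, ← Int.negOnePow_add,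
          Int.negOnePow_odd _ (by simp only [parity_simps]; grind), two_smul, Units.neg_smul,
          one_smul, neg_neg]
      rw [e4, inv_smul_smul₀ two_ne_zero, ← d_der] at e3
      exact e3
  · intro n i h hh a ha
    have e1 := der_bracket n 1 i h hh γ hγ a ha
    have e2 := L.skew _ _ _ (der_mem n 1 h hh γ hγ) _ ha
    change L.d (der h a) + L.bracket γ (der h a)
      = der h (L.d a + L.bracket γ a) + i.negOnePow • L.bracket a (der h γ)
    have e3 : (n - 1) * i + (1 + (n - 1)) * i = i + 2 * ((n - 1) * i) := by ring
    rw [map_add, e1, e2, d_der, smul_neg, smul_smul, ← Int.negOnePow_add, e3,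
      Int.negOnePow_add, Int.negOnePow_even _ (even_two_mul _), mul_one]
    abel

/-- The path construction: let `N` be a tangent space that acts on the DGLA `L` by derivations
that commute with the differential, let `γ` be a Maurer-Cartan element of `L`, and let `f` be a
morphism from the twist of `L` by `γ` to `M`. If the derivatives of `γ` represent the
cohomology of `M`, then `M` and `N` have a common acyclic fibration. -/
theorem exists_common_acyclicFibration [CharZero k] {L M N : DGLA k} (hd : N.d = 0)
    (hb : N.bracket = 0) {γ : L.carrier} (hγ : γ ∈ L.gr 1)
    (hMC : L.d γ + (2 : k)⁻¹ • L.bracket γ γ = 0)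
    (der : N.carrier →ₗ[k] L.carrier →ₗ[k] L.carrier)
    (der_mem : ∀ n i, ∀ h ∈ N.gr n, ∀ a ∈ L.gr i, der h a ∈ L.gr (i + (n - 1)))
    (der_bracket : ∀ n i j, ∀ h ∈ N.gr n, ∀ a ∈ L.gr i, ∀ b ∈ L.gr j,
      der h (L.bracket a b)
        = L.bracket a (der h b) + ((n - 1) * j).negOnePow • L.bracket (der h a) b)
    (d_der : ∀ h a, L.d (der h a) = der h (L.d a))
    (f : Hom (L.twist γ hγ hMC) M) (hf : Function.Surjective f.toLinearMap)
    (h1 : ∀ h y, M.d y = f.toLinearMap (der h γ) → h = 0)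
    (h2 : ∀ y, M.d y = 0 → ∃ h z, y = f.toLinearMap (der h γ) + M.d z) :
    ∃ P : DGLA k, (∃ g : Hom P M, g.IsAcyclicFibration) ∧
      ∃ g : Hom P N, g.IsAcyclicFibration := by
  obtain ⟨d_c, d_der'⟩ := d_der_twist hγ hMC der der_mem der_bracket d_der
  let T := polyPathData (L := L.twist γ hγ hMC) (N := N) (der.flip γ) (fun n h hh => by
    have := der_mem n 1 h hh γ hγ
    rwa [add_sub_cancel] at this) d_c der der_mem der_bracket d_der'
  have hone : ∀ x : L.carrier, (f.comp (L.twist γ hγ hMC).polyEval).toLinearMap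
      (x ⊗ₜ[k] (1 : k[X]) : L.carrier ⊗[k] k[X]) = f.toLinearMap x := by
    intro x
    refine congrArg f.toLinearMap (((L.twist γ hγ hMC).polyEval_tmul x 1).trans ?_)
    rw [eval_one]
    exact one_smul k x
  have hc : ∀ h, (f.comp (L.twist γ hγ hMC).polyEval).toLinearMap (T.c h)
      = f.toLinearMap (der h γ) := fun h => hone (der h γ)
  refine ⟨T.path, ⟨_, T.isAcyclicFibration_comp_toPath hd hb
    (f.comp (L.twist γ hγ hMC).polyEval) (fun y => ?_) ?_ ?_⟩,
    T.toTangent hd hb, T.isAcyclicFibration_toTangent hd hb⟩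
  · obtain ⟨x, rfl⟩ := hf y
    exact ⟨_, hone x⟩
  · intro h y hy
    exact h1 h y (hy.trans (hc h))
  · intro y hy
    obtain ⟨h, z, hz⟩ := h2 y hy
    exact ⟨h, z, by rw [hc, hz]⟩

end DGLA

/-! ### Homogeneous bases -/

section GradedBasis

variable {k : Type u} [Field k] {M N : Type u} [AddCommGroup M] [Module k M]
  [AddCommGroup N] [Module k N]

/-- The index set of a homogeneous basis of a graded vector space. -/
abbrev GradedIndex (gr : ℤ → Submodule k M) : Type u :=
  Σ n : ℤ, Module.Basis.ofVectorSpaceIndex k (gr n)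

/-- The vectors of a homogeneous basis. -/
def gradedBasis {gr : ℤ → Submodule k M} (l : GradedIndex gr) : M :=
  (Module.Basis.ofVectorSpace k (gr l.1) l.2 : gr l.1)

theorem gradedBasis_mem {gr : ℤ → Submodule k M} (l : GradedIndex gr) :
    gradedBasis l ∈ gr l.1 := Subtype.property _

/-- The linear map with prescribed values on a homogeneous basis. -/
def gradedConstr {gr : ℤ → Submodule k M} (h : DirectSum.IsInternal gr)
    (f : GradedIndex gr → N) : M →ₗ[k] N :=
  gradeLift h fun n => (Module.Basis.ofVectorSpace k (gr n)).constr k fun j => f ⟨n, j⟩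

theorem gradedConstr_basis {gr : ℤ → Submodule k M} (h : DirectSum.IsInternal gr)
    (f : GradedIndex gr → N) (l : GradedIndex gr) : gradedConstr h f (gradedBasis l) = f l := by
  rw [gradedConstr, gradeLift_of_mem h _ (gradedBasis_mem l)]
  exact Module.Basis.constr_basis _ k _ l.2

theorem gradedBasis_induction {gr : ℤ → Submodule k M} {n : ℤ} {p : M → Prop} (h0 : p 0)
    (hadd : ∀ x y, p x → p y → p (x + y)) (hsmul : ∀ (c : k) x, p x → p (c • x))
    (hp : ∀ j, p (gradedBasis (⟨n, j⟩ : GradedIndex gr))) {x : M} (hx : x ∈ gr n) : p x := by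
  have h : ∀ y ∈ Submodule.span k (Set.range (Module.Basis.ofVectorSpace k (gr n))),
      p (y : gr n) := by
    intro y hy
    refine Submodule.span_induction (p := fun y _ => p (y : gr n)) ?_ h0
      (fun x y _ _ => hadd x y) (fun c x _ => hsmul c x) hy
    rintro _ ⟨j, rfl⟩
    exact hp j
  exact h ⟨x, hx⟩ (by rw [Module.Basis.span_eq]; trivial)

theorem apply_mem_of_gradedBasis {gr : ℤ → Submodule k M} {n : ℤ} (f : M →ₗ[k] N)
    (S : Submodule k N) (hf : ∀ j, f (gradedBasis (⟨n, j⟩ : GradedIndex gr)) ∈ S) {x : M}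
    (hx : x ∈ gr n) : f x ∈ S :=
  gradedBasis_induction (p := fun x => x ∈ S.comap f) (zero_mem _) (fun _ _ => add_mem)
    (fun c _ => Submodule.smul_mem _ c) hf hx

theorem apply_eq_of_gradedBasis {gr : ℤ → Submodule k M} {n : ℤ} (f g : M →ₗ[k] N)
    (hfg : ∀ j, f (gradedBasis (⟨n, j⟩ : GradedIndex gr)) = g (gradedBasis ⟨n, j⟩)) {x : M}
    (hx : x ∈ gr n) : f x = g x :=
  gradedBasis_induction (p := fun x => x ∈ LinearMap.eqLocus f g) (zero_mem _)
    (fun _ _ => add_mem) (fun c _ => Submodule.smul_mem _ c) hfg hx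

theorem linearMap_ext_gradedBasis {gr : ℤ → Submodule k M} (h : DirectSum.IsInternal gr)
    {f g : M →ₗ[k] N} (hfg : ∀ l : GradedIndex gr, f (gradedBasis l) = g (gradedBasis l)) :
    f = g :=
  grade_linearMap_ext h fun _ _ hx => apply_eq_of_gradedBasis f g (fun _ => hfg _) hx

end GradedBasis

/-! ### Partial derivatives of power series -/

namespace Words

variable {k : Type u} [Field k] {C : Type u} [Ring C] [Algebra k C]
  {𝒞 : ℤ → Submodule k C} [GradedAlgebra 𝒞] {ι : Type u} {deg : ι → ℤ}

/-- The right partial derivatives of sums of homogeneous power series. -/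
def derTotal (i : ι) : total 𝒞 deg →ₗ[k] total 𝒞 deg :=
  (der i).restrict (p := (total 𝒞 deg).toSubmodule) (q := (total 𝒞 deg).toSubmodule)
    fun x hx => by
      refine total_induction (p := fun x => der i x ∈ (total 𝒞 deg).toSubmodule) ?_ ?_ ?_ hx
      · rw [map_zero]
        exact zero_mem _
      · intro x y hx hy
        rw [map_add]
        exact add_mem hx hy
      · intro n x hx
        exact mem_total_of_mem (der_mem hx i)

theorem derTotal_mem {n : ℤ} {x : total 𝒞 deg} (hx : x ∈ gr 𝒞 deg n) (i : ι) :
    derTotal i x ∈ gr 𝒞 deg (n + deg i) := der_mem hx i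

/-- The constant term of a power series. -/
def constTerm (𝒞 : ℤ → Submodule k C) [GradedAlgebra 𝒞] (deg : ι → ℤ) :
    total 𝒞 deg →ₗ[k] C where
  toFun x := x.1 []
  map_add' _ _ := rfl
  map_smul' _ _ := rfl

theorem constTerm_mem {n : ℤ} {x : total 𝒞 deg} (hx : x ∈ gr 𝒞 deg n) :
    constTerm 𝒞 deg x ∈ 𝒞 n := by
  have := hx []
  rwa [wordDeg_nil, add_zero] at this

theorem constTerm_surjective : Function.Surjective (constTerm 𝒞 deg) := by
  intro c
  refine grade_induction (DirectSum.Decomposition.isInternal 𝒞)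
    (p := fun c => ∃ x, constTerm 𝒞 deg x = c) ⟨0, map_zero _⟩ ?_ ?_ c
  · rintro _ _ ⟨x, rfl⟩ ⟨y, rfl⟩
    exact ⟨x + y, map_add _ _ _⟩
  · intro n c hc
    exact ⟨⟨const c, mem_total_of_mem (const_mem hc)⟩, rfl⟩

end Words

namespace DBVAlgebra

variable {k : Type u} [Field k] {C : Type u} [Ring C] [Algebra k C]
  {𝒞 : ℤ → Submodule k C} [GradedAlgebra 𝒞] (B : DBVAlgebra 𝒞)

section Derivatives

variable {ι : Type u} {deg : ι → ℤ}

theorem words_bracket_coe {i : ℤ} {a : Words.total 𝒞 deg} (ha : a ∈ Words.gr 𝒞 deg i)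
    (x : Words.total 𝒞 deg) : ((B.words deg).bracket a x).1 = Words.br B.Δ a.1 x.1 :=
  Words.bvBracket_coe B.Δ_mem ha x

theorem derTotal_Q (i : ι) (x : Words.total 𝒞 deg) :
    (B.words deg).Q (Words.derTotal i x) = Words.derTotal i ((B.words deg).Q x) := rfl

theorem derTotal_bracket {m n : ℤ} {a b : Words.total 𝒞 deg} (ha : a ∈ Words.gr 𝒞 deg m)
    (hb : b ∈ Words.gr 𝒞 deg n) (i : ι) :
    Words.derTotal i ((B.words deg).bracket a b)
      = (B.words deg).bracket a (Words.derTotal i b)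
        + (deg i * (n + 1)).negOnePow • (B.words deg).bracket (Words.derTotal i a) b := by
  have hb' : b.1 ∈ Words.homog 𝒞 deg n := hb
  have h := Words.der_br B.Δ_mem i a.1 b.1
  rw [Words.sign_of_mem _ hb', Words.br_zunit, smul_smul, ← Int.negOnePow_add,
    ← mul_one_add, add_comm 1 n, ← B.words_bracket_coe ha] at h
  apply Subtype.ext
  refine h.trans ?_
  refine congrArg₂ (· + ·) (B.words_bracket_coe ha (Words.derTotal i b)).symm ?_
  exact congrArg (fun z : Words 𝒞 deg => (deg i * (n + 1)).negOnePow • z)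
    (B.words_bracket_coe (Words.derTotal_mem ha i) b).symm

theorem constTerm_bracket (x y : Words.total 𝒞 deg) :
    Words.constTerm 𝒞 deg ((B.words deg).bracket x y)
      = B.bracket (Words.constTerm 𝒞 deg x) (Words.constTerm 𝒞 deg y) := by
  refine grade_induction Words.isInternal_gr (p := fun x =>
    Words.constTerm 𝒞 deg ((B.words deg).bracket x y)
      = B.bracket (Words.constTerm 𝒞 deg x) (Words.constTerm 𝒞 deg y)) (by simp) ?_ ?_ x
  · intro x x' hx hx'
    simp only [map_add, LinearMap.add_apply, hx, hx']
  · intro n x hx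
    change ((B.words deg).bracket x y).1 [] = _
    have hx' : x.1 ∈ Words.homog 𝒞 deg n := hx
    rw [B.words_bracket_coe hx, Words.br, Words.sign_of_mem 1 hx', one_mul, bracket,
      bvBracket_apply, ghostParity_of_mem _ (Words.constTerm_mem hx)]
    rfl

/-- The constant term is a morphism from the power series to the coefficients. The twist of the
differential by a power series without constant term does not affect it. -/
def constTermHom [CharZero k] (Γ : Words.total 𝒞 deg) (hΓ : Γ ∈ (B.words deg).toDGLA.gr 1)
    (hMC : (B.words deg).toDGLA.d Γ + (2 : k)⁻¹ • (B.words deg).toDGLA.bracket Γ Γ = 0)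
    (h0 : Words.constTerm 𝒞 deg Γ = 0) :
    DGLA.Hom ((B.words deg).toDGLA.twist Γ hΓ hMC) B.toDGLA where
  toLinearMap := Words.constTerm 𝒞 deg
  map_mem i x hx := Words.constTerm_mem (𝒞 := 𝒞) (deg := deg) (n := i - 1) (x := x) hx
  map_d x := by
    change Words.total 𝒞 deg at x
    change Words.constTerm 𝒞 deg ((B.words deg).Q x + (B.words deg).bracket Γ x)
      = B.Q (Words.constTerm 𝒞 deg x)
    rw [map_add, constTerm_bracket, h0, map_zero, LinearMap.zero_apply, add_zero]
    rfl
  map_bracket := B.constTerm_bracket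

end Derivatives

section Tangent

/-- The degrees of the letters of the power series on the cohomology, which are the vectors of a
homogeneous basis. -/
def letterDeg (l : GradedIndex B.cohDegree) : ℤ := l.1

/-- The tangent vector `h` acts on power series as the derivative in the direction of `h`. -/
def tangentDer : Cohomology B.Q →ₗ[k]
    Words.total 𝒞 B.letterDeg →ₗ[k]
    Words.total 𝒞 B.letterDeg :=
  gradedConstr (isInternal_cohDeg (DirectSum.Decomposition.isInternal 𝒞) B.Q_mem)
    fun l => Words.derTotal l

theorem tangentDer_basis (l : GradedIndex B.cohDegree) :
    B.tangentDer (gradedBasis l) = Words.derTotal l := gradedConstr_basis _ _ l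

theorem tangentDer_mem {m n : ℤ} {h : Cohomology B.Q} (hh : h ∈ B.cohDegree m)
    {a : Words.total 𝒞 B.letterDeg} (ha : a ∈ Words.gr 𝒞 B.letterDeg n) :
    B.tangentDer h a ∈ Words.gr 𝒞 B.letterDeg (n + m) := by
  refine apply_mem_of_gradedBasis (B.tangentDer.flip a) (Words.gr 𝒞 B.letterDeg (n + m)) ?_ hh
  intro j
  have := Words.derTotal_mem ha (⟨m, j⟩ : GradedIndex B.cohDegree)
  rw [LinearMap.flip_apply, tangentDer_basis]
  exact this

theorem tangentDer_Q (h : Cohomology B.Q) (a : Words.total 𝒞 B.letterDeg) :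
    (B.words B.letterDeg).Q (B.tangentDer h a)
      = B.tangentDer h ((B.words B.letterDeg).Q a) := by
  have : (B.words B.letterDeg).Q ∘ₗ B.tangentDer.flip a
      = B.tangentDer.flip ((B.words B.letterDeg).Q a) := by
    refine linearMap_ext_gradedBasis
      (isInternal_cohDeg (DirectSum.Decomposition.isInternal 𝒞) B.Q_mem) fun l => ?_
    rw [LinearMap.comp_apply, LinearMap.flip_apply, LinearMap.flip_apply, tangentDer_basis,
      derTotal_Q]
  exact LinearMap.congr_fun this h

theorem tangentDer_bracket {l m n : ℤ} {h : Cohomology B.Q} (hh : h ∈ B.cohDegree l)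
    {a b : Words.total 𝒞 B.letterDeg} (ha : a ∈ Words.gr 𝒞 B.letterDeg m)
    (hb : b ∈ Words.gr 𝒞 B.letterDeg n) :
    B.tangentDer h ((B.words B.letterDeg).bracket a b)
      = (B.words B.letterDeg).bracket a (B.tangentDer h b)
        + (l * (n + 1)).negOnePow • (B.words B.letterDeg).bracket (B.tangentDer h a) b := by
  refine apply_eq_of_gradedBasis (B.tangentDer.flip ((B.words B.letterDeg).bracket a b))
    ((B.words B.letterDeg).bracket a ∘ₗ B.tangentDer.flip b
      + (l * (n + 1)).negOnePow • (B.words B.letterDeg).bracket.flip b ∘ₗ B.tangentDer.flip a)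
    (fun j => ?_) hh
  change B.tangentDer (gradedBasis ⟨l, j⟩) ((B.words B.letterDeg).bracket a b)
    = (B.words B.letterDeg).bracket a (B.tangentDer (gradedBasis ⟨l, j⟩) b)
      + (l * (n + 1)).negOnePow •
        (B.words B.letterDeg).bracket (B.tangentDer (gradedBasis ⟨l, j⟩) a) b
  rw [tangentDer_basis, derTotal_bracket B ha hb]
  rfl

end Tangent

/-! ### Representatives in the kernel of `Δ` -/

section Representatives

variable {B}

/-- The homogeneous components of a representative in the kernel of `Δ` lie in the kernel
of `Δ` as well. -/
theorem exists_homogeneous_rep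
    (hΔ : ∀ c : Cohomology B.Q, ∃ x : LinearMap.ker B.Q, cohClass B.Q x = c ∧ B.Δ x = 0)
    {n : ℤ} {c : Cohomology B.Q} (hc : c ∈ B.cohDegree n) :
    ∃ x : LinearMap.ker B.Q, x.1 ∈ 𝒞 n ∧ B.Δ x.1 = 0 ∧ cohClass B.Q x = c := by
  have hi := DirectSum.Decomposition.isInternal 𝒞
  obtain ⟨y, hy, rfl⟩ := hc
  obtain ⟨x, hx, hΔx⟩ := hΔ (cohClass B.Q y)
  rw [← sub_eq_zero, ← map_sub, DGLA.cohClass_eq_zero] at hx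
  obtain ⟨z, hz⟩ := hx
  have hQ : B.Q (gradeProj hi n x.1) = 0 := by
    rw [map_gradeProj hi hi B.Q_mem, LinearMap.mem_ker.mp x.2, map_zero]
  refine ⟨⟨gradeProj hi n x.1, hQ⟩, gradeProj_mem _ _ _, ?_, ?_⟩
  · rw [map_gradeProj hi hi B.Δ_mem, hΔx, map_zero]
  · rw [← sub_eq_zero, ← map_sub, DGLA.cohClass_eq_zero]
    refine ⟨gradeProj hi (n - 1) z, ?_⟩
    rw [map_gradeProj hi hi B.Q_mem, sub_add_cancel, hz]
    change gradeProj hi n (x.1 - y.1) = gradeProj hi n x.1 - y.1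
    have hy' : y.1 ∈ 𝒞 n := hy
    rw [map_sub, gradeProj_of_mem hi hy']

theorem exists_homogeneous_decomposition
    (hΔ : ∀ c : Cohomology B.Q, ∃ x : LinearMap.ker B.Q, cohClass B.Q x = c ∧ B.Δ x = 0)
    (d : ℤ) (x : C) (hx : x ∈ 𝒞 d) (hQx : B.Q x = 0) :
    ∃ h ∈ 𝒞 d, ∃ v ∈ 𝒞 (d - 1), B.Q h = 0 ∧ B.Δ h = 0 ∧ x = h + B.Q v := by
  have hi := DirectSum.Decomposition.isInternal 𝒞
  have hc : cohClass B.Q ⟨x, hQx⟩ ∈ B.cohDegree d := ⟨⟨x, hQx⟩, hx, rfl⟩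
  obtain ⟨h, hh, hΔh, hhx⟩ := exists_homogeneous_rep hΔ hc
  rw [eq_comm, ← sub_eq_zero, ← map_sub,
      DGLA.cohClass_eq_zero] at hhx
  obtain ⟨v, hv⟩ := hhx
  refine ⟨h.1, hh, gradeProj hi (d - 1) v, gradeProj_mem _ _ _, h.2, hΔh, ?_⟩
  have hv' : B.Q v = x - h.1 := hv
  rw [map_gradeProj hi hi B.Q_mem, sub_add_cancel, hv', gradeProj_of_mem hi (sub_mem hx hh),
    add_sub_cancel]

/-- The induced bracket on cohomology vanishes: up to sign, the bracket of representatives in the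
kernel of `Δ` is `Δ` of their product, and `Δ` maps cocycles to coboundaries. -/
theorem cohomology_bracket_eq_zero
    (hΔ : ∀ c : Cohomology B.Q, ∃ x : LinearMap.ker B.Q, cohClass B.Q x = c ∧ B.Δ x = 0) :
    B.toDGLA.cohomology.bracket = 0 := by
  have hi := isInternal_cohDeg (DirectSum.Decomposition.isInternal 𝒞) B.Q_mem
  refine grade_linearMap_ext hi (f := B.toDGLA.cohBracket) (g := 0) fun i x hx => ?_
  refine grade_linearMap_ext hi fun j y hy => ?_
  obtain ⟨a, ha, hΔa, rfl⟩ := exists_homogeneous_rep hΔ hx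
  obtain ⟨b, hb, hΔb, rfl⟩ := exists_homogeneous_rep hΔ hy
  have hab : B.Q (a.1 * b.1) = 0 := by
    rw [B.Q_mul i _ ha, LinearMap.mem_ker.mp a.2, LinearMap.mem_ker.mp b.2]
    simp
  obtain ⟨h, -, v, -, -, hΔh, hv⟩ :=
    exists_homogeneous_decomposition hΔ _ _ (SetLike.mul_mem_graded ha hb) hab
  have hbr : B.bracket a.1 b.1 = B.Q (i.negOnePow • -B.Δ v) := by
    have h1 := bvBracket_eq 𝒞 B.Δ ha b.1
    rw [hΔa, hΔb, zero_mul, mul_zero, smul_zero, sub_zero, sub_zero, hv, map_add, hΔh,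
      zero_add] at h1
    rw [map_zunit_smul, map_neg, B.Q_Δ, neg_neg, ← h1, smul_smul, Int.units_mul_self, one_smul]
  have hker : B.bracket a.1 b.1 ∈ LinearMap.ker B.Q := by
    rw [hbr]
    exact B.Q_Q _
  exact (DGLA.cohClass_eq_zero B.Q ⟨_, hker⟩).2 ⟨_, hbr.symm⟩

/-- The DGLA of a differential Batalin-Vilkovisky algebra and its cohomology have a common
acyclic fibration: the path DGLA over the power series on the cohomology, twisted by the universal
solution of the Maurer-Cartan equation. -/
theorem exists_acyclicFibrations [CharZero k]
    (hΔ : ∀ c : Cohomology B.Q, ∃ x : LinearMap.ker B.Q, cohClass B.Q x = c ∧ B.Δ x = 0) :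
    ∃ P : DGLA k,
    (∃ f : DGLA.Hom P B.toDGLA, f.IsAcyclicFibration) ∧
      ∃ f : DGLA.Hom P B.toDGLA.cohomology, f.IsAcyclicFibration := by
  let N := B.toDGLA.cohomology
  have hb : N.bracket = 0 := cohomology_bracket_eq_zero hΔ
  choose e he hΔe hec using fun l : GradedIndex B.cohDegree =>
    exists_homogeneous_rep hΔ (gradedBasis_mem l)
  obtain ⟨Γ, hΓ, h0, hΓe, hMC⟩ := exists_universal_solution (deg := B.letterDeg) B
    (exists_homogeneous_decomposition hΔ) (fun l => (e l).1) he (fun l => (e l).2) hΔe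
  let G := (B.words B.letterDeg).toDGLA
  have hΓ1 : Γ ∈ G.gr 1 := hΓ
  have der_mem : ∀ n i, ∀ h ∈ N.gr n, ∀ a ∈ G.gr i, B.tangentDer h a ∈ G.gr (i + (n - 1)) := by
    intro n i h hh a ha
    have := B.tangentDer_mem (m := n - 1) (n := i - 1) hh ha
    rwa [sub_add_eq_add_sub] at this
  have der_bracket : ∀ n i j, ∀ h ∈ N.gr n, ∀ a ∈ G.gr i, ∀ b ∈ G.gr j,
      B.tangentDer h (G.bracket a b)
        = G.bracket a (B.tangentDer h b)
          + ((n - 1) * j).negOnePow • G.bracket (B.tangentDer h a) b := by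
    intro n i j h hh a ha b hb
    have := B.tangentDer_bracket (l := n - 1) (m := i - 1) (n := j - 1) hh ha hb
    rwa [sub_add_cancel] at this
  let E := Words.constTerm 𝒞 B.letterDeg ∘ₗ B.tangentDer.flip Γ
  -- the value of the derivative of `Γ` at the origin represents the tangent vector
  have hi := isInternal_cohDeg (DirectSum.Decomposition.isInternal 𝒞) B.Q_mem
  have hEe : ∀ l, E (gradedBasis l) = (e l).1 := by
    intro l
    rw [← hΓe]
    change Words.constTerm 𝒞 B.letterDeg (B.tangentDer (gradedBasis l) Γ) = _
    rw [tangentDer_basis]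
    rfl
  have hQE : B.Q ∘ₗ E = 0 := linearMap_ext_gradedBasis hi fun l => by
    rw [LinearMap.comp_apply, hEe, LinearMap.zero_apply]
    exact (e l).2
  have hE : cohClass B.Q ∘ₗ E.codRestrict (LinearMap.ker B.Q) (LinearMap.congr_fun hQE)
      = LinearMap.id := linearMap_ext_gradedBasis hi fun l =>
    (congrArg (cohClass B.Q) (Subtype.ext (hEe l))).trans (hec l)
  refine DGLA.exists_common_acyclicFibration (L := G) (N := N) rfl hb hΓ1 hMC B.tangentDer
    der_mem der_bracket B.tangentDer_Q (B.constTermHom Γ hΓ1 hMC h0)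
    (Words.constTerm_surjective (𝒞 := 𝒞) (deg := B.letterDeg)) ?_ ?_
  · intro h y hy
    exact (LinearMap.congr_fun hE h).symm.trans ((DGLA.cohClass_eq_zero _ _).2 ⟨y, hy⟩)
  · intro y hy
    have hh := LinearMap.congr_fun hE (cohClass B.Q ⟨y, hy⟩)
    rw [LinearMap.comp_apply, LinearMap.id_apply, eq_comm, ← sub_eq_zero, ← map_sub,
      DGLA.cohClass_eq_zero] at hh
    obtain ⟨z, hz⟩ := hh
    exact ⟨cohClass B.Q ⟨y, hy⟩, z, (add_eq_of_eq_sub' hz).symm⟩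

end Representatives

end DBVAlgebra

end

theorem corollary11 {k : Type u} [Field k] [CharZero k] {C : Type u} [Ring C] [Algebra k C]
    (𝒞 : ℤ → Submodule k C) [GradedAlgebra 𝒞] (B : DBVAlgebra 𝒞)
    (hfin : ∀ i : ℤ, Module.Finite k (B.cohDegree i))
    (hΔ : ∀ c : Cohomology B.Q, ∃ x : LinearMap.ker B.Q, cohClass B.Q x = c ∧ B.Δ x = 0) :
    B.toDGLA.IsFormal ∧
      Nonempty (B.toDGLA.extDef ≅ B.powerSeriesFunctor) ∧
      IsSmoothFunctor B.toDGLA.extDef := by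
  obtain ⟨P, ⟨f, hf⟩, g, hg⟩ := DBVAlgebra.exists_acyclicFibrations hΔ
  have hb := DBVAlgebra.cohomology_bracket_eq_zero hΔ
  have := hf.isIso_extDefMap
  have := hg.isIso_extDefMap
  let e : B.toDGLA.extDef ≅ B.toDGLA.cohomology.extDef :=
    (asIso f.extDefMap).symm ≪≫ asIso g.extDefMap
  obtain ⟨e'⟩ := DGLA.extDef_iso_linFunctor_of_abelian B.toDGLA.cohomology (gr' := B.cohDegree)
    rfl hb (fun _ => rfl)
    (isInternal_cohDeg (DirectSum.Decomposition.isInternal 𝒞) B.Q_mem) hfin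
  exact ⟨.trans _ _ _ (.symm _ _ (.rel _ _ ⟨f, hf.isQuasiIso⟩)) (.rel _ _ ⟨g, hg.isQuasiIso⟩),
    ⟨e ≪≫ e' ≪≫ (proRepIsoLin _).symm⟩,
    .of_iso e (DGLA.isSmoothFunctor_of_abelian _ rfl hb)⟩
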